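/- Let $(M,g)$ be a smooth Riemannian surface whose Gauss curvature $K$ is negative everywhere. Let $U\subseteq M$ be open and let $(v_1,v_2)$ be a smooth $g$-orthonormal frame field on $U$, with dual coframe $\eta^1,\eta^2$ and connection form $\eta^1_2=-\eta^2_1$ determined by $$d\eta^1=-\eta^1_2\wedge\eta^2,\qquad d\eta^2=-\eta^2_1\wedge\eta^1,\qquad\text{so that}\quad d\eta^1_2=K\,\eta^1\wedge\eta^2 .$$ Let $\mathcal F$ be the orthonormal frame bundle of $\mathbb R^3$, with points $(\rho;e_1,e_2,e_3)$ and with the canonical and connection forms $\omega^i,\omega^i_j$ defined by $d\rho=e_i\omega^i$, $de_j=e_i\omega^i_j$. The isometric embedding system $\mathcal I$ is the exterior differential system on the 8-dimensional manifold $U\times\mathcal F$ generated differentially by the pullbacks of $$\theta_0=\omega^3,\quad \theta_1=\omega^1-\eta^1,\quad \theta_2=\omega^2-\eta^2,\quad \theta_3=\omega^1_2-\eta^1_2 .$$ An exterior differential system on a manifold $N$ is called *Darboux integrable* if the following holds. 1. *(Decomposability.)* There are subbundles $\hat V,\check V\subseteq T^*N$ such that about each point there is a coframe $\theta^1,\dots,\theta^r,\hat\sigma^1,\dots,\hat\sigma^p,\check\sigma^1,\dots,\check\sigma^q$,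 $p,q\ge 2$, for which the system is algebraically generated by the $\theta^i$, by at least one 2-form $\hat\Omega^b$ in the $\hat\sigma$'s and by at least one 2-form $\check\Omega^c$ in the $\check\sigma$'s, with $\hat V=\operatorname{span}\{\theta^i,\hat\sigma^a\}$ and $\check V=\operatorname{span}\{\theta^i,\check\sigma^a\}$; and the singular systems, generated algebraically by $\{\theta^i,\hat\sigma^a,\check\Omega^c\}$ and by $\{\theta^i,\check\sigma^a,\hat\Omega^b\}$, are Pfaffian, that is, they are generated differentially by the sections of $\hat V$ and of $\check V$ respectively. 2. *(Darboux pair.)* $\hat V+\check V^\infty=T^*N=\check V+\hat V^\infty$; $\hat V^\infty\cap\check V^\infty=0$; and $d\omega\in\Omega^2(\hat V)+\Omega^2(\check V)$ for all local sections $\omega$ of $\hat V\cap\check V$. Here $V^\infty$ is the final element of the derived flag of $V$, and $\Omega^2(V)$ denotes the sections of $\Lambda^2V$. Put $q=(-K)^{-3/4}$ and define the functions $q_i,q_{ij}$ on $U$ by $dq=q_i\eta^i$ and $dq_i=q_j\eta^j_i+q_{ij}\eta^j$. Then $\mathcal I$ is Darboux integrable if and only if, everywhere on $U$, $$q_{11}=q_{22}=-3q^{-1/3},\qquad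 q_{12}=q_{21}=0 .$$ Consequently, every point of $M$ has a neighbourhood with an orthonormal frame field whose system $\mathcal I$ is Darboux integrable if and only if these equations hold for every local orthonormal frame field of $M$. -/

import Mathlib

open Set Bundle Manifold
open scoped ContDiff Matrix

noncomputable section

namespace IsoEmbedding

/-! ### Exterior differential systems on a smooth manifold -/

section EDS

variable {E : Type*} [NormedAddCommGroup E] [NormedSpace ℝ E]
  {H : Type*} [TopologicalSpace H] (I : ModelWithCorners ℝ E H)
  {N : Type*} [TopologicalSpace N] [ChartedSpace H N]

/-- The cotangent space at `x`. -/
abbrev Covector (x : N) : Type _ := TangentSpace I x →L[ℝ] ℝ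

/-- Bilinear forms on the tangent space at `x`; the values of 2-forms are alternating ones. -/
abbrev Bicovector (x : N) : Type _ := TangentSpace I x →ₗ[ℝ] TangentSpace I x →ₗ[ℝ] ℝ

variable (N) in
/-- A (not necessarily smooth) differential 1-form. -/
abbrev OneForm : Type _ := ∀ x : N, Covector I x

variable (N) in
/-- A (not necessarily smooth) differential 2-form. -/
abbrev TwoForm : Type _ := ∀ x : N, Bicovector I x

variable {I}

/-- Smoothness of a 1-form on a set, as a section of the cotangent bundle. -/
def SmoothOneFormOn [IsManifold I 1 N] (α : OneForm I N) (W : Set N) : Prop :=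
  ContMDiffOn I (I.prod 𝓘(ℝ, E →L[ℝ] ℝ)) ∞
    (fun x ↦ TotalSpace.mk' (E →L[ℝ] ℝ)
      (E := fun x : N ↦ TangentSpace I x →L[ℝ] Bundle.Trivial N ℝ x) x (α x)) W

/-- The wedge product of two covectors, `(a ∧ b)(X, Y) = a(X) b(Y) - a(Y) b(X)`. -/
def wedge {x : N} (a b : Covector I x) : Bicovector I x :=
  LinearMap.mk₂ ℝ (fun X Y ↦ a X * b Y - a Y * b X)
    (fun X X' Y ↦ by simp only [map_add]; ring)
    (fun c X Y ↦ by simp only [map_smul, smul_eq_mul]; ring)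
    (fun X Y Y' ↦ by simp only [map_add]; ring)
    (fun c X Y ↦ by simp only [map_smul, smul_eq_mul]; ring)

theorem wedge_apply {x : N} (a b : Covector I x) (X Y : TangentSpace I x) :
    wedge a b X Y = a X * b Y - a Y * b X := rfl

/-- The expression of a 1-form in the preferred chart at `x`: the pullback of the form by the
inverse of that chart. -/
def coordForm (α : OneForm I N) (x : N) (y : E) : E →L[ℝ] ℝ :=
  (α ((extChartAt I x).symm y)).comp
    (mfderivWithin 𝓘(ℝ, E) I (extChartAt I x).symm (range I) y)

/-- The exterior derivative of a 1-form, computed in the preferred chart at each point: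
`dα(X, Y) = X(α(Y)) - Y(α(X))` for constant coordinate vector fields `X`, `Y`. -/
def extD (α : OneForm I N) : TwoForm I N := fun x ↦
  let D : E →L[ℝ] E →L[ℝ] ℝ := fderivWithin ℝ (coordForm α x) (range I) (extChartAt I x x)
  let L : TangentSpace I x →L[ℝ] E := mfderiv I 𝓘(ℝ, E) (extChartAt I x) x
  LinearMap.mk₂ ℝ (fun X Y ↦ D (L X) (L Y) - D (L Y) (L X))
    (fun X X' Y ↦ by simp only [map_add, add_apply]; ring)
    (fun c X Y ↦ by simp only [map_smul, smul_apply, smul_eq_mul]; ring)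
    (fun X Y Y' ↦ by simp only [map_add, add_apply]; ring)
    (fun c X Y ↦ by simp only [map_smul, smul_apply, smul_eq_mul]; ring)

theorem extD_apply (α : OneForm I N) (x : N) (X Y : TangentSpace I x) :
    extD α x X Y =
      fderivWithin ℝ (coordForm α x) (range I) (extChartAt I x x)
        (mfderiv I 𝓘(ℝ, E) (extChartAt I x) x X) (mfderiv I 𝓘(ℝ, E) (extChartAt I x) x Y)
      - fderivWithin ℝ (coordForm α x) (range I) (extChartAt I x x)
        (mfderiv I 𝓘(ℝ, E) (extChartAt I x) x Y) (mfderiv I 𝓘(ℝ, E) (extChartAt I x) x X) := rfl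

variable (I N) in
/-- A Pfaffian system, given as a family of subspaces of the cotangent spaces. -/
abbrev Pfaffian : Type _ := ∀ x : N, Submodule ℝ (Covector I x)

/-- `α` is a smooth section of `V` over `W`. -/
def IsSectionOn [IsManifold I 1 N] (V : Pfaffian I N) (W : Set N) (α : OneForm I N) : Prop :=
  SmoothOneFormOn α W ∧ ∀ y ∈ W, α y ∈ V y

/-- The degree two part `V ∧ T*` of the algebraic ideal generated by a space `V` of covectors. -/
def idealTwo {x : N} (V : Submodule ℝ (Covector I x)) : Submodule ℝ (Bicovector I x) :=
  Submodule.span ℝ {τ | ∃ a ∈ V, ∃ b : Covector I x, τ = wedge a b}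

/-- `Λ²V`, for a space `V` of covectors. -/
def lambdaTwo {x : N} (V : Submodule ℝ (Covector I x)) : Submodule ℝ (Bicovector I x) :=
  Submodule.span ℝ {τ | ∃ a ∈ V, ∃ b ∈ V, τ = wedge a b}

/-- The values at `x` of the 2-forms in the differential ideal generated by the sections of `V`:
the span of `V ∧ T*` and of the values of the exterior derivatives of the sections of `V`. -/
def differentialIdealTwo [IsManifold I 1 N] (V : Pfaffian I N) (x : N) :
    Submodule ℝ (Bicovector I x) :=
  idealTwo (V x) ⊔ Submodule.span ℝ
    {τ | ∃ W : Set N, IsOpen W ∧ x ∈ W ∧ ∃ α : OneForm I N, IsSectionOn V W α ∧ τ = extD α x}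

/-- The derived system of `V`: its sections are the sections `α` of `V` with `dα ≡ 0 mod V`. -/
def derived [IsManifold I 1 N] (V : Pfaffian I N) : Pfaffian I N := fun x ↦
  Submodule.span ℝ {a | ∃ W : Set N, IsOpen W ∧ x ∈ W ∧ ∃ α : OneForm I N,
    IsSectionOn V W α ∧ (∀ y ∈ W, extD α y ∈ idealTwo (V y)) ∧ a = α x}

/-- The derived flag `V ⊇ V⁽¹⁾ ⊇ V⁽²⁾ ⊇ …`. -/
def derivedFlag [IsManifold I 1 N] (V : Pfaffian I N) (n : ℕ) : Pfaffian I N :=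
  derived^[n] V

/-- The final element `V^∞` of the derived flag. -/
def derivedFinal [IsManifold I 1 N] (V : Pfaffian I N) : Pfaffian I N := fun x ↦
  ⨅ n : ℕ, derivedFlag V n x

/-- `V₁` and `V₂` form a Darboux pair on the open set `Ω`. -/
structure IsDarbouxPairOn [IsManifold I 1 N] (V₁ V₂ : Pfaffian I N) (Ω : Set N) : Prop where
  sup_left : ∀ x ∈ Ω, V₁ x ⊔ derivedFinal V₂ x = ⊤
  sup_right : ∀ x ∈ Ω, V₂ x ⊔ derivedFinal V₁ x = ⊤
  inf_final : ∀ x ∈ Ω, derivedFinal V₁ x ⊓ derivedFinal V₂ x = ⊥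
  extD_mem : ∀ W ⊆ Ω, IsOpen W → ∀ α : OneForm I N, IsSectionOn (fun x ↦ V₁ x ⊓ V₂ x) W α →
    ∀ y ∈ W, extD α y ∈ lambdaTwo (V₁ y) ⊔ lambdaTwo (V₂ y)

/-- On the open set `W` there is a smooth coframe `θ¹,…,θʳ, σ¹,…,σᵖ, τ¹,…,τ^q` with `p, q ≥ 2`, and
there are 2-forms `Φᵇ` in the `σ` and `Ψᶜ` in the `τ` (at least one of each), such that

* the exterior differential system generated differentially by `J` is generated algebraically by
  `θⁱ, Φᵇ, Ψᶜ`;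
* `V₁` is spanned by `θⁱ, σᵃ` and `V₂` by `θⁱ, τᵃ`;
* the singular systems, generated algebraically by `{θⁱ, σᵃ, Ψᶜ}` and `{θⁱ, τᵃ, Φᵇ}`, are Pfaffian,
  that is, they are the exterior differential systems generated differentially by `V₁` and `V₂`.

All these ideals are generated in degrees one and two, so that only these degrees are compared. -/
def IsDecompositionOn [IsManifold I 1 N] (J V₁ V₂ : Pfaffian I N) (W : Set N) : Prop :=
  ∃ (r p q s t : ℕ) (θ : Fin r → OneForm I N) (σ : Fin p → OneForm I N) (τ : Fin q → OneForm I N)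
    (f : Fin s → Fin p → Fin p → N → ℝ) (h : Fin t → Fin q → Fin q → N → ℝ)
    (Φ : Fin s → TwoForm I N) (Ψ : Fin t → TwoForm I N),
    2 ≤ p ∧ 2 ≤ q ∧ 1 ≤ s ∧ 1 ≤ t ∧
    (∀ i, SmoothOneFormOn (θ i) W) ∧ (∀ a, SmoothOneFormOn (σ a) W) ∧
    (∀ a, SmoothOneFormOn (τ a) W) ∧
    (∀ b i j, ContMDiffOn I 𝓘(ℝ, ℝ) ∞ (f b i j) W) ∧
    (∀ c i j, ContMDiffOn I 𝓘(ℝ, ℝ) ∞ (h c i j) W) ∧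
    ∀ y ∈ W,
      LinearIndependent ℝ (Sum.elim (fun i ↦ θ i y) (Sum.elim (fun a ↦ σ a y) (fun a ↦ τ a y))) ∧
      Submodule.span ℝ (range
        (Sum.elim (fun i ↦ θ i y) (Sum.elim (fun a ↦ σ a y) (fun a ↦ τ a y)))) = ⊤ ∧
      (∀ b, Φ b y = ∑ i, ∑ j, f b i j y • wedge (σ i y) (σ j y)) ∧
      (∀ c, Ψ c y = ∑ i, ∑ j, h c i j y • wedge (τ i y) (τ j y)) ∧
      J y = Submodule.span ℝ (range fun i ↦ θ i y) ∧
      differentialIdealTwo J y = idealTwo (J y) ⊔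
        Submodule.span ℝ (range (fun b ↦ Φ b y) ∪ range (fun c ↦ Ψ c y)) ∧
      V₁ y = Submodule.span ℝ (range (fun i ↦ θ i y) ∪ range (fun a ↦ σ a y)) ∧
      V₂ y = Submodule.span ℝ (range (fun i ↦ θ i y) ∪ range (fun a ↦ τ a y)) ∧
      differentialIdealTwo V₁ y = idealTwo (V₁ y) ⊔ Submodule.span ℝ (range fun c ↦ Ψ c y) ∧
      differentialIdealTwo V₂ y = idealTwo (V₂ y) ⊔ Submodule.span ℝ (range fun b ↦ Φ b y)

/-- The exterior differential system generated differentially by the Pfaffian system `J` is Darboux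
integrable on the open set `Ω`: it is decomposable about each point of `Ω`, with Pfaffian singular
systems `V₁`, `V₂` which form a Darboux pair. -/
def IsDarbouxIntegrableOn [IsManifold I 1 N] (J : Pfaffian I N) (Ω : Set N) : Prop :=
  ∃ V₁ V₂ : Pfaffian I N,
    (∀ x ∈ Ω, ∃ W ⊆ Ω, IsOpen W ∧ x ∈ W ∧ IsDecompositionOn J V₁ V₂ W) ∧ IsDarbouxPairOn V₁ V₂ Ω

/-- The pullback of a 1-form. -/
def pullback {E' : Type*} [NormedAddCommGroup E'] [NormedSpace ℝ E']
    {H' : Type*} [TopologicalSpace H'] {I' : ModelWithCorners ℝ E' H'}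
    {N' : Type*} [TopologicalSpace N'] [ChartedSpace H' N'] (φ : N → N') (α : OneForm I' N') :
    OneForm I N :=
  fun x ↦ (α (φ x)).comp (mfderiv I I' φ x)

end EDS

/-! ### The orthonormal frame bundle of Euclidean 3-space -/

section FrameBundle

/-- Euclidean 3-space. -/
abbrev E3 : Type := EuclideanSpace ℝ (Fin 3)

/-- Orthonormal frames of `E3`, written as orthogonal matrices; the columns are the members of the
frame. -/
abbrev O3 : Type := Matrix.orthogonalGroup (Fin 3) ℝ

/-- The Cayley transform of the skew matrix `v ↦ a × v`: the rotation about the axis `a` by the angle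
`2 arctan |a|`. -/
def cayley (a : E3) : Matrix (Fin 3) (Fin 3) ℝ :=
  (1 + (a 0 ^ 2 + a 1 ^ 2 + a 2 ^ 2))⁻¹ •
    !![1 + a 0 ^ 2 - a 1 ^ 2 - a 2 ^ 2, 2 * (a 0 * a 1 - a 2), 2 * (a 0 * a 2 + a 1);
       2 * (a 0 * a 1 + a 2), 1 - a 0 ^ 2 + a 1 ^ 2 - a 2 ^ 2, 2 * (a 1 * a 2 - a 0);
       2 * (a 0 * a 2 - a 1), 2 * (a 1 * a 2 + a 0), 1 - a 0 ^ 2 - a 1 ^ 2 + a 2 ^ 2]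

/-- The inverse of the Cayley transform. -/
def cayleyInv (P : Matrix (Fin 3) (Fin 3) ℝ) : E3 :=
  (2 * (1 + P).det⁻¹) • !₂[P 2 1 - P 1 2, P 0 2 - P 2 0, P 1 0 - P 0 1]

theorem cayley_pos (a : E3) : 1 + (a 0 ^ 2 + a 1 ^ 2 + a 2 ^ 2) ≠ 0 := by positivity

theorem cayley_orthogonal (a : E3) : (cayley a)ᵀ * cayley a = 1 := by
  have h := cayley_pos a
  ext i j
  fin_cases i <;> fin_cases j <;>
    simp [cayley, Matrix.mul_apply, Fin.sum_univ_three] <;> field_simp <;> ring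

theorem det_one_add_cayley (a : E3) :
    (1 + cayley a).det = 8 * (1 + (a 0 ^ 2 + a 1 ^ 2 + a 2 ^ 2))⁻¹ := by
  have h := cayley_pos a
  simp [cayley, Matrix.det_fin_three]
  field_simp
  ring

theorem cayleyInv_cayley (a : E3) : cayleyInv (cayley a) = a := by
  have h := cayley_pos a
  rw [cayleyInv, det_one_add_cayley]
  ext i
  fin_cases i <;> simp [cayley] <;> field_simp <;> ring

theorem cayley_cayleyInv {P : Matrix (Fin 3) (Fin 3) ℝ} (hP : Pᵀ * P = 1)
    (h : (1 + P).det ≠ 0) : cayley (cayleyInv P) = P := by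
  have hP' : P * Pᵀ = 1 := mul_eq_one_comm.mp hP
  have e (i j : Fin 3) := congrFun (congrFun hP i) j
  have e' (i j : Fin 3) := congrFun (congrFun hP' i) j
  simp only [Matrix.mul_apply, Fin.sum_univ_three, Matrix.transpose_apply, Matrix.one_apply] at e e'
  have hdet : P.det = 1 := by
    have h2 : P.det * P.det = 1 := by
      have := congrArg Matrix.det hP
      rwa [Matrix.det_mul, Matrix.det_transpose, Matrix.det_one] at this
    rcases mul_self_eq_one_iff.mp h2 with h1 | h1
    · exact h1
    · exfalso
      apply h
      have h3 : (Pᵀ * (1 + P)).det = (1 + P).det := by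
        rw [Matrix.mul_add, hP, mul_one, add_comm, ← Matrix.transpose_one (n := Fin 3) (α := ℝ),
          ← Matrix.transpose_add, Matrix.det_transpose]
        simp
      rw [Matrix.det_mul, Matrix.det_transpose, h1] at h3
      linarith
  have hadj : P.adjugate = Pᵀ := by
    have : P.adjugate = P.adjugate * (P * Pᵀ) := by rw [hP', mul_one]
    rw [this, ← mul_assoc, Matrix.adjugate_mul, hdet, one_smul, one_mul]
  have c (i j : Fin 3) := congrFun (congrFun hadj i) j
  simp only [Matrix.adjugate_fin_three, Matrix.transpose_apply] at c
  have c00 := c 0 0; have c11 := c 1 1; have c22 := c 2 2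
  have c01 := c 0 1; have c10 := c 1 0; have c02 := c 0 2
  have c20 := c 2 0; have c12 := c 1 2; have c21 := c 2 1
  have e00 := e 0 0; have e11 := e 1 1; have e22 := e 2 2
  have e01 := e 0 1; have e02 := e 0 2; have e12 := e 1 2
  have f00 := e' 0 0; have f11 := e' 1 1; have f22 := e' 2 2
  have f01 := e' 0 1; have f02 := e' 0 2; have f12 := e' 1 2
  clear c e e' hadj
  simp at c00 c11 c22 c01 c10 c02 c20 c12 c21 e00 e11 e22 e01 e02 e12 f00 f11 f22 f01 f02 f12
  rw [Matrix.det_fin_three] at hdet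
  obtain ⟨s, hs⟩ : ∃ s, s = 1 + P 0 0 + P 1 1 + P 2 2 := ⟨_, rfl⟩
  have hd : (1 + P).det = 2 * s := by
    rw [Matrix.det_fin_three]
    simp
    linear_combination hdet + c00 + c11 + c22 - 2 * hs
  rw [hd] at h
  have hs0 : s ≠ 0 := fun h0 ↦ h (by rw [h0]; ring)
  have d0 : (P 2 1 - P 1 2) ^ 2 = 2 * s * P 0 0 - s ^ 2 + 2 * s := by
    subst hs
    linear_combination e11 + e22 - f00 + 2 * c00
  have d1 : (P 0 2 - P 2 0) ^ 2 = 2 * s * P 1 1 - s ^ 2 + 2 * s := by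
    subst hs
    linear_combination e00 + e22 - f11 + 2 * c11
  have d2 : (P 1 0 - P 0 1) ^ 2 = 2 * s * P 2 2 - s ^ 2 + 2 * s := by
    subst hs
    linear_combination e00 + e11 - f22 + 2 * c22
  have m01 : (P 2 1 - P 1 2) * (P 0 2 - P 2 0) = s * (P 0 1 + P 1 0) := by
    subst hs
    linear_combination -e01 - f01 + c01 + c10
  have m02 : (P 2 1 - P 1 2) * (P 1 0 - P 0 1) = s * (P 0 2 + P 2 0) := by
    subst hs
    linear_combination -e02 - f02 + c02 + c20
  have m12 : (P 0 2 - P 2 0) * (P 1 0 - P 0 1) = s * (P 1 2 + P 2 1) := by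
    subst hs
    linear_combination -e12 - f12 + c12 + c21
  set a := cayleyInv P with ha
  have hcoef : (2 * (2 * s)⁻¹ : ℝ) = s⁻¹ := by field_simp
  have a0 : a 0 = (P 2 1 - P 1 2) / s := by
    rw [ha, cayleyInv, hd, hcoef]; simp; ring
  have a1 : a 1 = (P 0 2 - P 2 0) / s := by
    rw [ha, cayleyInv, hd, hcoef]; simp; ring
  have a2 : a 2 = (P 1 0 - P 0 1) / s := by
    rw [ha, cayleyInv, hd, hcoef]; simp; ring
  have hn : 1 + (a 0 ^ 2 + a 1 ^ 2 + a 2 ^ 2) = 4 / s := by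
    rw [a0, a1, a2, div_pow, div_pow, div_pow, d0, d1, d2]
    field_simp
    rw [hs]
    ring
  have q0 : a 0 ^ 2 = (2 * P 0 0 - s + 2) / s := by
    rw [a0, div_pow, d0]; field_simp
  have q1 : a 1 ^ 2 = (2 * P 1 1 - s + 2) / s := by
    rw [a1, div_pow, d1]; field_simp
  have q2 : a 2 ^ 2 = (2 * P 2 2 - s + 2) / s := by
    rw [a2, div_pow, d2]; field_simp
  have q01 : a 0 * a 1 = (P 0 1 + P 1 0) / s := by
    rw [a0, a1, div_mul_div_comm, m01]; field_simp
  have q02 : a 0 * a 2 = (P 0 2 + P 2 0) / s := by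
    rw [a0, a2, div_mul_div_comm, m02]; field_simp
  have q12 : a 1 * a 2 = (P 1 2 + P 2 1) / s := by
    rw [a1, a2, div_mul_div_comm, m12]; field_simp
  rw [cayley, hn, q01, q02, q12, q0, q1, q2, a0, a1, a2]
  ext i j
  fin_cases i <;> fin_cases j <;> simp <;> field_simp <;> (try rw [hs]) <;> ring

theorem contDiff_cayley (i j : Fin 3) : ContDiff ℝ ∞ fun a : E3 ↦ cayley a i j := by
  have h (k : Fin 3) : ContDiff ℝ ∞ fun a : E3 ↦ a k := by fun_prop
  have hn : ContDiff ℝ ∞ fun a : E3 ↦ (1 + (a 0 ^ 2 + a 1 ^ 2 + a 2 ^ 2))⁻¹ :=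
    ContDiff.inv (by fun_prop) cayley_pos
  fin_cases i <;> fin_cases j <;> simp [cayley] <;> fun_prop

theorem contDiffOn_cayleyInv {F : E3 → Matrix (Fin 3) (Fin 3) ℝ} {S : Set E3}
    (hF : ∀ i j, ContDiffOn ℝ ∞ (fun a ↦ F a i j) S) (hS : ∀ a ∈ S, (1 + F a).det ≠ 0) :
    ContDiffOn ℝ ∞ (fun a ↦ cayleyInv (F a)) S := by
  have hd : ContDiffOn ℝ ∞ (fun a ↦ (1 + F a).det) S := by
    simp only [Matrix.det_fin_three, Matrix.add_apply]
    fun_prop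
  have hi : ContDiffOn ℝ ∞ (fun a ↦ (1 + F a).det⁻¹) S := hd.inv hS
  rw [contDiffOn_euclidean]
  intro i
  fin_cases i <;> simp [cayleyInv] <;> fun_prop

/-- The chart of `O3` centred at `R`: `Q = R * cayley a` has the coordinate `a`. -/
def chartO3 (R : O3) : OpenPartialHomeomorph O3 E3 where
  toFun Q := cayleyInv ((R : Matrix (Fin 3) (Fin 3) ℝ)ᵀ * Q)
  invFun a := ⟨R * cayley a, mul_mem R.2
    ((Matrix.mem_orthogonalGroup_iff' (Fin 3) ℝ).2 (cayley_orthogonal a))⟩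
  source := {Q | (1 + (R : Matrix (Fin 3) (Fin 3) ℝ)ᵀ * Q).det ≠ 0}
  target := univ
  map_source' _ _ := mem_univ _
  map_target' a _ := by
    have hR := (Matrix.mem_orthogonalGroup_iff' (Fin 3) ℝ).1 R.2
    change (1 + (R : Matrix (Fin 3) (Fin 3) ℝ)ᵀ * (R * cayley a)).det ≠ 0
    rw [← mul_assoc, hR, one_mul, det_one_add_cayley]
    exact mul_ne_zero (by norm_num) (inv_ne_zero (cayley_pos a))
  left_inv' Q hQ := by
    have hR := (Matrix.mem_orthogonalGroup_iff (Fin 3) ℝ).1 R.2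
    have hQ' := (Matrix.mem_orthogonalGroup_iff' (Fin 3) ℝ).1 Q.2
    apply Subtype.ext
    change (R : Matrix (Fin 3) (Fin 3) ℝ) * cayley (cayleyInv _) = Q
    rw [cayley_cayleyInv _ hQ, ← mul_assoc, hR, one_mul]
    rw [Matrix.transpose_mul, Matrix.transpose_transpose, mul_assoc,
      ← mul_assoc (R : Matrix (Fin 3) (Fin 3) ℝ), hR, one_mul, hQ']
  right_inv' a _ := by
    have hR := (Matrix.mem_orthogonalGroup_iff' (Fin 3) ℝ).1 R.2
    change cayleyInv ((R : Matrix (Fin 3) (Fin 3) ℝ)ᵀ * (R * cayley a)) = a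
    rw [← mul_assoc, hR, one_mul, cayleyInv_cayley]
  open_source := by
    refine isOpen_ne_fun ?_ continuous_const
    fun_prop
  open_target := isOpen_univ
  continuousOn_toFun := by
    intro Q hQ
    have hd : ContinuousAt (fun Q : O3 ↦ (1 + (R : Matrix (Fin 3) (Fin 3) ℝ)ᵀ * Q).det⁻¹) Q :=
      ContinuousAt.inv₀ (by fun_prop) hQ
    refine ContinuousAt.continuousWithinAt ?_
    refine ContinuousAt.smul (continuousAt_const.mul hd) (Continuous.continuousAt ?_)
    fun_prop
  continuousOn_invFun := by
    refine Continuous.continuousOn (Continuous.subtype_mk ?_ _)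
    refine continuous_const.mul (continuous_matrix fun i j ↦ (contDiff_cayley i j).continuous)

instance : ChartedSpace E3 O3 where
  atlas := range chartO3
  chartAt := chartO3
  mem_chart_source R := by
    have hR := (Matrix.mem_orthogonalGroup_iff' (Fin 3) ℝ).1 R.2
    change (1 + (R : Matrix (Fin 3) (Fin 3) ℝ)ᵀ * R).det ≠ 0
    rw [hR, ← two_smul ℝ (1 : Matrix (Fin 3) (Fin 3) ℝ), Matrix.det_smul, Matrix.det_one]
    norm_num
  chart_mem_atlas R := mem_range_self R

instance : IsManifold 𝓘(ℝ, E3) ∞ O3 := by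
  refine isManifold_of_contDiffOn _ _ _ ?_
  rintro _ _ ⟨R, rfl⟩ ⟨R', rfl⟩
  refine (contDiffOn_cayleyInv
    (F := fun a ↦ (R' : Matrix (Fin 3) (Fin 3) ℝ)ᵀ * (R * cayley a)) ?_ ?_)
  · intro i j
    simp only [Matrix.mul_apply]
    have := contDiff_cayley
    fun_prop
  · intro a ha
    exact ha.1.2

/-- The orthonormal frame bundle of `E3`: pairs of a base point and an orthonormal frame. -/
abbrev F3 : Type := E3 × O3

/-- The model with corners of `F3` (the one without boundary). -/
abbrev modelF3 : ModelWithCorners ℝ (E3 × E3) (ModelProd E3 E3) := 𝓘(ℝ, E3).prod 𝓘(ℝ, E3)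

/-- The `i`-th member of a frame. -/
def frameVec (i : Fin 3) (x : F3) : E3 :=
  WithLp.toLp 2 fun j ↦ (x.2 : Matrix (Fin 3) (Fin 3) ℝ) j i

/-- The canonical forms `ωⁱ = ⟨eᵢ, dρ⟩`, so that `dρ = eᵢ ωⁱ`, where `ρ` is the base point. -/
def omega (i : Fin 3) : OneForm modelF3 F3 := fun x ↦
  (innerSL ℝ (frameVec i x)).comp (mfderiv modelF3 𝓘(ℝ, E3) (Prod.fst : F3 → E3) x)

/-- The connection forms `ωⁱⱼ = ⟨eᵢ, deⱼ⟩`, so that `deⱼ = eᵢ ωⁱⱼ`. -/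
def omegaConn (i j : Fin 3) : OneForm modelF3 F3 := fun x ↦
  (innerSL ℝ (frameVec i x)).comp (mfderiv modelF3 𝓘(ℝ, E3) (frameVec j) x)

end FrameBundle

/-! ### Riemannian surfaces and the isometric embedding system -/

section Surface

/-- The model space of surfaces. -/
abbrev E2 : Type := EuclideanSpace ℝ (Fin 2)

variable {M : Type*} [TopologicalSpace M] [ChartedSpace E2 M] [IsManifold 𝓘(ℝ, E2) ∞ M]

variable (M) in
/-- Smooth Riemannian metrics on the surface `M`. -/
abbrev Metric : Type _ :=
  ContMDiffRiemannianMetric 𝓘(ℝ, E2) ∞ E2 (fun p : M ↦ TangentSpace 𝓘(ℝ, E2) p)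

/-- A smooth `g`-orthonormal frame field `(v₁, v₂)` on the set `U`, that is, a section over `U` of the
orthonormal frame bundle of `M`. -/
structure OrthonormalFrame (g : Metric M) (U : Set M) where
  /-- The two vector fields. -/
  vec : Fin 2 → ∀ p : M, TangentSpace 𝓘(ℝ, E2) p
  smooth : ∀ i, ContMDiffOn 𝓘(ℝ, E2) 𝓘(ℝ, E2).tangent ∞
    (fun p ↦ (⟨p, vec i p⟩ : TangentBundle 𝓘(ℝ, E2) M)) U
  orthonormal : ∀ p ∈ U, ∀ i j, g.inner p (vec i p) (vec j p) = if i = j then 1 else 0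

namespace OrthonormalFrame

variable {g : Metric M} {U : Set M} (v : OrthonormalFrame g U)

/-- The dual coframe `η¹, η²`. -/
def eta (i : Fin 2) : OneForm 𝓘(ℝ, E2) M := fun p ↦ g.inner p (v.vec i p)

/-- The connection form `η¹₂`, determined on `U` by `dη¹ = -η¹₂ ∧ η²` and `dη² = η¹₂ ∧ η¹`. -/
def etaConn : OneForm 𝓘(ℝ, E2) M := fun p ↦
  -(extD (v.eta 0) p (v.vec 0 p) (v.vec 1 p)) • v.eta 0 p
    - (extD (v.eta 1) p (v.vec 0 p) (v.vec 1 p)) • v.eta 1 p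

/-- The Gauss curvature `K`, determined on `U` by `dη¹₂ = K η¹ ∧ η²`. -/
def gaussCurvature (p : M) : ℝ := extD v.etaConn p (v.vec 0 p) (v.vec 1 p)

theorem eq_smul_wedge {p : M} (hp : p ∈ U) (τ : Bicovector 𝓘(ℝ, E2) p) (h : ∀ X, τ X X = 0) :
    τ = τ (v.vec 0 p) (v.vec 1 p) • wedge (v.eta 0 p) (v.eta 1 p) := by
  have o := v.orthonormal p hp
  have li : LinearIndependent ℝ (fun i ↦ v.vec i p) := by
    rw [Fintype.linearIndependent_iff]
    intro c hc i
    have := congrArg (g.inner p (v.vec i p)) hc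
    fin_cases i <;> simpa [Fin.sum_univ_two, o] using this
  have card : Fintype.card (Fin 2) = Module.finrank ℝ (TangentSpace 𝓘(ℝ, E2) p) := by
    change _ = Module.finrank ℝ E2
    simp
  let b := basisOfLinearIndependentOfCardEqFinrank li card
  have hb : ∀ i, b i = v.vec i p := fun i ↦ by simp [b]
  have anti : ∀ X Y, τ Y X = -τ X Y := fun X Y ↦ by
    have := h (X + Y)
    simp only [map_add, LinearMap.add_apply, h] at this
    linarith
  refine b.ext fun i ↦ b.ext fun j ↦ ?_
  rw [hb, hb]
  fin_cases i <;> fin_cases j <;> simp [wedge_apply, eta, o, h]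
  exact anti _ _

theorem extD_eq {p : M} (hp : p ∈ U) (α : OneForm 𝓘(ℝ, E2) M) :
    extD α p = extD α p (v.vec 0 p) (v.vec 1 p) • wedge (v.eta 0 p) (v.eta 1 p) :=
  v.eq_smul_wedge hp _ fun X ↦ by rw [extD_apply, sub_self]

/-- The structure equations of the frame field. -/
theorem structure_equations {p : M} (hp : p ∈ U) :
    extD (v.eta 0) p = -wedge (v.etaConn p) (v.eta 1 p) ∧
    extD (v.eta 1) p = wedge (v.etaConn p) (v.eta 0 p) ∧
    extD v.etaConn p = v.gaussCurvature p • wedge (v.eta 0 p) (v.eta 1 p) := by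
  have o := v.orthonormal p hp
  refine ⟨?_, ?_, v.extD_eq hp _⟩
  · rw [v.extD_eq hp, v.eq_smul_wedge hp (-wedge _ _)
      fun X ↦ by simp only [LinearMap.neg_apply, wedge_apply]; ring]
    congr 1
    simp [wedge_apply, etaConn, eta, o]
  · rw [v.extD_eq hp, v.eq_smul_wedge hp (wedge (v.etaConn p) _)
      fun X ↦ by simp only [wedge_apply]; ring]
    congr 1
    simp [wedge_apply, etaConn, eta, o]

/-- The function `q = (-K)^{-3/4}`. -/
def q (p : M) : ℝ := (-v.gaussCurvature p) ^ (-(3 / 4) : ℝ)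

/-- The forms `ηⁱⱼ`: `η¹₂` as above, `η²₁ = -η¹₂` and `η¹₁ = η²₂ = 0`. -/
def etaMatrix (i j : Fin 2) : OneForm 𝓘(ℝ, E2) M :=
  !![0, v.etaConn; -v.etaConn, 0] i j

/-- The first covariant derivatives of a function `u`, determined on `U` by `du = uᵢ ηⁱ`. -/
def covDeriv (u : M → ℝ) (i : Fin 2) (p : M) : ℝ :=
  mfderiv 𝓘(ℝ, E2) 𝓘(ℝ, ℝ) u p (v.vec i p)

/-- The second covariant derivatives of a function `u`, determined on `U` by
`duᵢ = uⱼ ηʲᵢ + uᵢⱼ ηʲ` (summation over `j`). -/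
def covDerivTwo (u : M → ℝ) (i j : Fin 2) (p : M) : ℝ :=
  v.covDeriv (v.covDeriv u i) j p
    - ∑ l, v.covDeriv u l p * v.etaMatrix l i p (v.vec j p)

/-- The differential equations `q₁₁ = q₂₂ = -3 q^{-1/3}`, `q₁₂ = q₂₁ = 0` on `U`. -/
def SatisfiesQEquations : Prop := ∀ p ∈ U,
  v.covDerivTwo v.q 0 0 p = -3 * v.q p ^ (-(1 / 3) : ℝ) ∧
  v.covDerivTwo v.q 1 1 p = -3 * v.q p ^ (-(1 / 3) : ℝ) ∧
  v.covDerivTwo v.q 0 1 p = 0 ∧ v.covDerivTwo v.q 1 0 p = 0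

/-- The 1-forms `θ₀ = ω³`, `θ₁ = ω¹ - η¹`, `θ₂ = ω² - η²`, `θ₃ = ω¹₂ - η¹₂`, for the coframe of the
frame field `v`. -/
def theta : Fin 4 → OneForm (𝓘(ℝ, E2).prod modelF3) (M × F3) :=
  ![pullback Prod.snd (omega 2),
    pullback Prod.snd (omega 0) - pullback Prod.fst (v.eta 0),
    pullback Prod.snd (omega 1) - pullback Prod.fst (v.eta 1),
    pullback Prod.snd (omegaConn 0 1) - pullback Prod.fst v.etaConn]

/-- The isometric embedding system on `U × F3`. -/
def embeddingSystem : Pfaffian (𝓘(ℝ, E2).prod modelF3) (M × F3) := fun x ↦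
  Submodule.span ℝ (range fun i ↦ v.theta i x)

/-- The isometric embedding system, as an exterior differential system on `U × F3`, is Darboux
integrable. -/
def IsDarbouxIntegrable : Prop :=
  IsDarbouxIntegrableOn v.embeddingSystem (U ×ˢ (univ : Set F3))

end OrthonormalFrame

/-- The metric `g` is Darboux integrable: about each point there is an orthonormal frame field whose
isometric embedding system is Darboux integrable. -/
def IsDarbouxIntegrableMetric (g : Metric M) : Prop :=
  ∀ p : M, ∃ U : Set M, IsOpen U ∧ p ∈ U ∧ ∃ v : OrthonormalFrame g U, v.IsDarbouxIntegrable

/-- The Gauss curvature of `g` is negative. -/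
def IsNegativelyCurved (g : Metric M) : Prop :=
  ∀ U : Set M, IsOpen U → ∀ v : OrthonormalFrame g U, ∀ p ∈ U, v.gaussCurvature p < 0

end Surface

end IsoEmbedding

end

/-!
The isometric embedding system of a frame field `v` is rewritten in the coframe
`θ₀, …, θ₃, ω³₁, ω³₂, η¹, η²` of `U × F3` (`coframe`), where all exterior derivatives are explicit
(`extD_coframe`). Modulo the `θᵢ`, the 2-forms `dθ₀` and `dθ₃` span the same space as
`(ω³₁ - s η²) ∧ (ω³₂ + s η¹)` for the two square roots `s` of `-K`. So the system is decomposable,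
with singular systems the two characteristic systems
`V_s = span {θ₀, …, θ₃, ω³₁ - s η², ω³₂ + s η¹}`. Up to order these are the only possible singular
systems, because a decomposable 2-form in the ideal is a multiple of one of the two 2-forms above
modulo the `θᵢ` (`eq_charSystem_of_isDecompositionOn`). The choice of the root is locally constant
(`eventually_eq_charSystem`). Hence only the condition that `V_s` and `V_{-s}` form a Darboux pair
matters.

Let `ds = 2 s aᵢ ηⁱ`, and let `c` be the symmetric tensor with `aᵢⱼ = s² δᵢⱼ + aᵢ aⱼ - 2 s cᵢⱼ`
(`RootData`). The derived flag of `V_s` is contained in an explicit one of ranks 6, 5, 3, the last of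
which is spanned by forms `ζ₀, ζ₁, ζ₂` (`derived_charSystem_le`, `derived_derCoeff_le`). In
consequence the final derived systems of `V_s` and `V_{-s}` always meet only in zero, and the Darboux
pair condition comes down to `V_{-s} + V_s^∞ = T*`. That forces two combinations `ζ₁ + w ζ₀` and
`ζ₂ + z ζ₀` to be closed modulo the `ζ`, at each point; eliminating `w` and `z` gives `s c = -a aᵀ`
(`isDegenerateAt_of_sup_eq_top`). Conversely, if `s c = -a aᵀ`, then the forms
`s (ω³₁ - s η²) + a₁ θ₃` and `s (ω³₂ + s η¹) + a₂ θ₃` span a completely integrable subsystem of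
`V_s`, and this is large enough for the Darboux pair condition (`extD_lam_mem`,
`charSystem_sup_derivedFinal`). With `s = q^{-2/3}`, the condition `s c = -a aᵀ` is
`qᵢⱼ = -3 q^{-1/3} δᵢⱼ` (`isDegenerateAt_rootData_iff`).

For the statement about the metric, the equations say that the Hessian of `q` is `-3 q^{-1/3} g`.
They are therefore invariant under changes of frame (`Rotation.satisfiesQEquations`), and orthonormal
frame fields exist about each point by Gram–Schmidt orthonormalization
(`OrthonormalFrame.exists_local`).

The exterior derivative is computed from the fact that a smooth 1-form is locally a finite sum of
terms `f dg` (`SmoothOneFormOn.exists_eq_sum`). The derived flags are bounded from above at a point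
by expanding a section in a smooth coframe (`exists_of_mem_derived`), and from below by subsystems
which satisfy the Frobenius condition (`span_le_derivedFinal`).
-/

open Set Bundle Manifold
open scoped ContDiff Matrix Topology

set_option linter.unusedSectionVars false

noncomputable section

namespace IsoEmbedding

/-! ### The exterior derivative of 1-forms -/

section Calculus

variable {E : Type*} [NormedAddCommGroup E] [NormedSpace ℝ E]
  {H : Type*} [TopologicalSpace H] {I : ModelWithCorners ℝ E H}
  {N : Type*} [TopologicalSpace N] [ChartedSpace H N]

variable (I) in
/-- The differential of a real function, as a 1-form. -/
def differential (f : N → ℝ) : OneForm I N := fun x ↦ mfderiv I 𝓘(ℝ, ℝ) f x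

/-- Differentiability of a 1-form at a point, read off in the preferred chart. -/
def DifferentiableFormAt (α : OneForm I N) (x : N) : Prop :=
  DifferentiableAt ℝ (coordForm α x) (extChartAt I x x)

theorem wedge_add_right {x : N} (a b b' : Covector I x) :
    wedge a (b + b') = wedge a b + wedge a b' := by
  ext X Y; simp only [wedge_apply, LinearMap.add_apply, add_apply]; ring

theorem wedge_swap {x : N} (a b : Covector I x) : wedge a b = (-1 : ℝ) • wedge b a := by
  ext X Y; simp only [wedge_apply, LinearMap.smul_apply, smul_eq_mul]; ring

/-- A member of a space of bilinear forms may be cancelled. It is proved without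
`Submodule.add_mem_iff_right`: the additive monoid underlying the group structure of `Bicovector` is
not unified with the one of its module structure. -/
theorem mem_of_add_mem {x : N} {S : Submodule ℝ (Bicovector I x)} {a b : Bicovector I x}
    (ha : a ∈ S) (h : a + b ∈ S) : b ∈ S := by
  have := S.add_mem h (S.smul_mem (-1) ha)
  convert this using 1
  module

theorem wedge_mem_idealTwo_left {x : N} {V : Submodule ℝ (Covector I x)} {a : Covector I x}
    (ha : a ∈ V) (b : Covector I x) : wedge a b ∈ idealTwo V :=
  Submodule.subset_span ⟨a, ha, b, rfl⟩

theorem wedge_mem_idealTwo_right {x : N} {V : Submodule ℝ (Covector I x)} {b : Covector I x}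
    (a : Covector I x) (hb : b ∈ V) : wedge a b ∈ idealTwo V := by
  rw [wedge_swap]
  exact Submodule.smul_mem _ _ (wedge_mem_idealTwo_left hb a)

variable [I.Boundaryless] [IsManifold I ∞ N]

instance instIsManifoldOne : IsManifold I 1 N := IsManifold.of_le (n := ∞) (by simp)

/-- The derivative at `x`, in the preferred chart at `x`, of the function `Y ↦ α(Y)` in the direction
`X`, for a constant coordinate vector field `Y`. -/
def formDeriv (α : OneForm I N) (x : N) (X Y : TangentSpace I x) : ℝ :=
  (fderiv ℝ (coordForm α x) (extChartAt I x x) : E →L[ℝ] E →L[ℝ] ℝ) X Y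

theorem extD_apply_formDeriv (α : OneForm I N) (x : N) (X Y : TangentSpace I x) :
    extD α x X Y = formDeriv α x X Y - formDeriv α x Y X := by
  rw [extD_apply, I.range_eq_univ, fderivWithin_univ, mfderiv_extChartAt_self]
  rfl

theorem tendsto_extChartAt_symm (x : N) :
    Filter.Tendsto (extChartAt I x).symm (𝓝 (extChartAt I x x)) (𝓝 x) := by
  have := (continuousAt_extChartAt_symm (I := I) x).tendsto
  rwa [extChartAt_to_inv] at this

theorem coordForm_self (α : OneForm I N) (x : N) :
    coordForm α x (extChartAt I x x) = α x := by
  rw [coordForm, mfderivWithin_range_extChartAt_symm, extChartAt_to_inv]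
  rfl

theorem coordForm_congr {α β : OneForm I N} {x : N} (h : ∀ᶠ y in 𝓝 x, α y = β y) :
    coordForm α x =ᶠ[𝓝 (extChartAt I x x)] coordForm β x := by
  filter_upwards [tendsto_extChartAt_symm (I := I) x h] with y hy
  have hy : α ((extChartAt I x).symm y) = β ((extChartAt I x).symm y) := hy
  rw [coordForm, coordForm, hy]

theorem extD_congr {α β : OneForm I N} {x : N} (h : ∀ᶠ y in 𝓝 x, α y = β y) :
    extD α x = extD β x := by
  have e (X Y : TangentSpace I x) : formDeriv α x X Y = formDeriv β x X Y := by
    rw [formDeriv, formDeriv, (coordForm_congr h).fderiv_eq]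
  refine LinearMap.ext₂ fun X Y ↦ ?_
  rw [extD_apply_formDeriv, extD_apply_formDeriv, e, e]

theorem coordForm_smul (f : N → ℝ) (α : OneForm I N) (x : N) :
    coordForm (fun y ↦ f y • α y) x =
      fun y ↦ f ((extChartAt I x).symm y) • coordForm α x y := by
  ext y v; rfl

theorem extD_sub {α β : OneForm I N} {x : N} (hα : DifferentiableFormAt α x)
    (hβ : DifferentiableFormAt β x) (X Y : TangentSpace I x) :
    extD (α - β) x X Y = extD α x X Y - extD β x X Y := by
  have hc : coordForm (α - β) x = coordForm α x - coordForm β x := by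
    ext y v; rfl
  have e (X Y : TangentSpace I x) :
      formDeriv (α - β) x X Y = formDeriv α x X Y - formDeriv β x X Y := by
    rw [formDeriv, hc, fderiv_sub hα hβ]
    rfl
  rw [extD_apply_formDeriv, extD_apply_formDeriv, extD_apply_formDeriv, e, e]
  ring

theorem hasFDerivAt_comp_symm {f : N → ℝ} {x : N} (hf : MDifferentiableAt I 𝓘(ℝ, ℝ) f x) :
    HasFDerivAt (f ∘ (extChartAt I x).symm) (differential I f x : E →L[ℝ] ℝ) (extChartAt I x x) := by
  have h := hf.hasMFDerivAt.2
  rw [I.range_eq_univ] at h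
  exact hasFDerivWithinAt_univ.1 h

theorem DifferentiableFormAt.smul {f : N → ℝ} {α : OneForm I N} {x : N}
    (hf : MDifferentiableAt I 𝓘(ℝ, ℝ) f x) (hα : DifferentiableFormAt α x) :
    DifferentiableFormAt (fun y ↦ f y • α y) x := by
  rw [DifferentiableFormAt, coordForm_smul]
  exact DifferentiableAt.smul (hasFDerivAt_comp_symm hf).differentiableAt hα

theorem extD_smul {f : N → ℝ} {α : OneForm I N} {x : N}
    (hf : MDifferentiableAt I 𝓘(ℝ, ℝ) f x) (hα : DifferentiableFormAt α x) :
    extD (fun y ↦ f y • α y) x = wedge (differential I f x) (α x) + f x • extD α x := by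
  have e (X Y : TangentSpace I x) : formDeriv (fun y ↦ f y • α y) x X Y =
      f x * formDeriv α x X Y + differential I f x X * α x Y := by
    have h1 := hasFDerivAt_comp_symm hf
    have h2 : HasFDerivAt (coordForm α x) _ _ := DifferentiableAt.hasFDerivAt hα
    have h3 := (h1.smul h2).fderiv
    rw [formDeriv, coordForm_smul]
    refine (congrArg (fun L : E →L[ℝ] E →L[ℝ] ℝ ↦ L X Y) h3).trans ?_
    rw [coordForm_self, Function.comp, extChartAt_to_inv]
    rfl
  refine LinearMap.ext₂ fun X Y ↦ ?_
  rw [LinearMap.add_apply, LinearMap.add_apply, LinearMap.smul_apply, LinearMap.smul_apply,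
    wedge_apply, extD_apply_formDeriv, extD_apply_formDeriv, e, e, smul_eq_mul]
  ring

theorem coordForm_differential {f : N → ℝ} {W : Set N} (hW : IsOpen W)
    (hf : ContMDiffOn I 𝓘(ℝ, ℝ) ∞ f W) {x : N} (hx : x ∈ W) :
    coordForm (differential I f) x =ᶠ[𝓝 (extChartAt I x x)]
      fderiv ℝ (f ∘ (extChartAt I x).symm) := by
  filter_upwards [tendsto_extChartAt_symm (I := I) x (hW.mem_nhds hx),
    extChartAt_target_mem_nhds (I := I) x] with y hy hy'
  have h1 : MDifferentiableAt I 𝓘(ℝ, ℝ) f ((extChartAt I x).symm y) :=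
    ((hf _ hy).contMDiffAt (hW.mem_nhds hy)).mdifferentiableAt (by simp)
  have h2 : MDifferentiableWithinAt 𝓘(ℝ, E) I (extChartAt I x).symm (range I) y :=
    mdifferentiableWithinAt_extChartAt_symm hy'
  rw [I.range_eq_univ, mdifferentiableWithinAt_univ] at h2
  rw [coordForm, I.range_eq_univ, mfderivWithin_univ, differential, ← mfderiv_eq_fderiv]
  exact (mfderiv_comp y h1 h2).symm

theorem contDiffAt_comp_symm {f : N → ℝ} {x : N} (hf : ContMDiffAt I 𝓘(ℝ, ℝ) ∞ f x) :
    ContDiffAt ℝ ∞ (f ∘ (extChartAt I x).symm) (extChartAt I x x) := by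
  have h := contMDiffAt_iff.1 hf
  rw [I.range_eq_univ] at h
  exact contDiffWithinAt_univ.1 h.2

theorem contDiffAt_coordForm_differential {f : N → ℝ} {W : Set N} (hW : IsOpen W)
    (hf : ContMDiffOn I 𝓘(ℝ, ℝ) ∞ f W) {x : N} (hx : x ∈ W) :
    ContDiffAt ℝ ∞ (coordForm (differential I f) x) (extChartAt I x x) :=
  ((contDiffAt_comp_symm ((hf x hx).contMDiffAt (hW.mem_nhds hx))).fderiv_right
    (by simp)).congr_of_eventuallyEq (coordForm_differential hW hf hx)

theorem differentiableFormAt_differential {f : N → ℝ} {W : Set N} (hW : IsOpen W)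
    (hf : ContMDiffOn I 𝓘(ℝ, ℝ) ∞ f W) {x : N} (hx : x ∈ W) :
    DifferentiableFormAt (differential I f) x :=
  (contDiffAt_coordForm_differential hW hf hx).differentiableAt (by simp)

/-- `d(df) = 0`. -/
theorem extD_differential {f : N → ℝ} {W : Set N} (hW : IsOpen W)
    (hf : ContMDiffOn I 𝓘(ℝ, ℝ) ∞ f W) {x : N} (hx : x ∈ W) :
    extD (differential I f) x = 0 := by
  have h := (contDiffAt_comp_symm ((hf x hx).contMDiffAt (hW.mem_nhds hx))).isSymmSndFDerivAt
    (by rw [minSmoothness_of_isRCLikeNormedField]; exact WithTop.coe_le_coe.2 le_top)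
  have e (X Y : TangentSpace I x) :
      formDeriv (differential I f) x X Y = formDeriv (differential I f) x Y X := by
    rw [formDeriv, formDeriv, (coordForm_differential hW hf hx).fderiv_eq]
    exact h X Y
  refine LinearMap.ext₂ fun X Y ↦ ?_
  rw [extD_apply_formDeriv, e, sub_self]
  rfl

theorem mdifferentiableAt_mul {f g : N → ℝ} {x : N} (hf : MDifferentiableAt I 𝓘(ℝ, ℝ) f x)
    (hg : MDifferentiableAt I 𝓘(ℝ, ℝ) g x) : MDifferentiableAt I 𝓘(ℝ, ℝ) (fun y ↦ f y * g y) x :=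
  hf.mul hg

theorem mdifferentiableAt_add {f g : N → ℝ} {x : N} (hf : MDifferentiableAt I 𝓘(ℝ, ℝ) f x)
    (hg : MDifferentiableAt I 𝓘(ℝ, ℝ) g x) : MDifferentiableAt I 𝓘(ℝ, ℝ) (fun y ↦ f y + g y) x :=
  hf.add hg

theorem differential_add {f g : N → ℝ} {x : N} (hf : MDifferentiableAt I 𝓘(ℝ, ℝ) f x)
    (hg : MDifferentiableAt I 𝓘(ℝ, ℝ) g x) :
    differential I (fun y ↦ f y + g y) x = differential I f x + differential I g x :=
  (hf.hasMFDerivAt.add hg.hasMFDerivAt).mfderiv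

theorem differential_mul {f g : N → ℝ} {x : N} (hf : MDifferentiableAt I 𝓘(ℝ, ℝ) f x)
    (hg : MDifferentiableAt I 𝓘(ℝ, ℝ) g x) :
    differential I (fun y ↦ f y * g y) x = f x • differential I g x + g x • differential I f x :=
  (hf.hasMFDerivAt.mul hg.hasMFDerivAt).mfderiv

theorem differential_const (c : ℝ) (x : N) : differential I (fun _ : N ↦ c) x = 0 :=
  (hasMFDerivAt_const c x).mfderiv

theorem differential_congr {f g : N → ℝ} {x : N} (h : f =ᶠ[𝓝 x] g) :
    differential I f x = differential I g x :=
  h.mfderiv_eq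

/-- The chain rule for a function of one real variable. -/
theorem differential_real_comp {f : N → ℝ} {F : ℝ → ℝ} {F' : ℝ} {x : N}
    (hf : MDifferentiableAt I 𝓘(ℝ, ℝ) f x) (hF : HasDerivAt F F' (f x)) :
    differential I (fun y ↦ F (f y)) x = F' • differential I f x := by
  have h := (hF.hasFDerivAt.hasMFDerivAt.comp x hf.hasMFDerivAt).mfderiv
  refine h.trans ?_
  ext X
  exact mul_comm (differential I f x X) F'

end Calculus

/-! ### Smooth 1-forms -/

section Smooth

variable {E : Type*} [NormedAddCommGroup E] [NormedSpace ℝ E]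
  {H : Type*} [TopologicalSpace H] {I : ModelWithCorners ℝ E H}
  {N : Type*} [TopologicalSpace N] [ChartedSpace H N] [I.Boundaryless] [IsManifold I ∞ N]

theorem SmoothOneFormOn.sub {α β : OneForm I N} {W : Set N} (hα : SmoothOneFormOn α W)
    (hβ : SmoothOneFormOn β W) : SmoothOneFormOn (α - β) W :=
  ContMDiffOn.sub_section hα hβ

theorem SmoothOneFormOn.smul {f : N → ℝ} {α : OneForm I N} {W : Set N}
    (hf : ContMDiffOn I 𝓘(ℝ, ℝ) ∞ f W) (hα : SmoothOneFormOn α W) :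
    SmoothOneFormOn (fun y ↦ f y • α y) W :=
  ContMDiffOn.smul_section hf hα

theorem SmoothOneFormOn.mono {α : OneForm I N} {W W' : Set N} (hα : SmoothOneFormOn α W)
    (h : W' ⊆ W) : SmoothOneFormOn α W' :=
  ContMDiffOn.mono hα h

theorem SmoothOneFormOn.congr {α β : OneForm I N} {W : Set N} (hα : SmoothOneFormOn α W)
    (h : ∀ y ∈ W, β y = α y) : SmoothOneFormOn β W :=
  ContMDiffOn.congr hα fun y hy ↦ by rw [h y hy]

theorem SmoothOneFormOn.sum {ι : Type*} [Fintype ι] {α : ι → OneForm I N} {W : Set N}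
    (hα : ∀ i, SmoothOneFormOn (α i) W) : SmoothOneFormOn (fun y ↦ ∑ i, α i y) W :=
  ContMDiffOn.sum_section fun i _ ↦ hα i

theorem smoothOneFormOn_differential {f : N → ℝ} {W : Set N} (hW : IsOpen W)
    (hf : ContMDiffOn I 𝓘(ℝ, ℝ) ∞ f W) : SmoothOneFormOn (differential I f) W := by
  intro x hx
  have h := ((hf x hx).contMDiffAt (hW.mem_nhds hx)).mfderiv_const (m := ∞) (by simp)
  refine ContMDiffAt.contMDiffWithinAt ?_
  rw [contMDiffAt_hom_bundle]
  refine ⟨contMDiffAt_id, h.congr_of_eventuallyEq (Filter.Eventually.of_forall fun y ↦ ?_)⟩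
  ext v
  simp [inTangentCoordinates, ContinuousLinearMap.inCoordinates, differential]
  rfl

/-- A smooth 1-form may be evaluated on a smooth vector field. -/
theorem SmoothOneFormOn.apply {α : OneForm I N} {W : Set N} (hα : SmoothOneFormOn α W)
    {v : ∀ x : N, TangentSpace I x}
    (hv : ContMDiffOn I I.tangent ∞ (fun x ↦ (⟨x, v x⟩ : TangentBundle I N)) W) :
    ContMDiffOn I 𝓘(ℝ, ℝ) ∞ (fun x ↦ α x (v x)) W := by
  intro x hx
  have h := ContMDiffOn.clm_bundle_apply (n := ∞) (F₁ := E) (F₂ := ℝ) (IM := I)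
    (E₁ := fun x : N ↦ TangentSpace I x) (E₂ := Bundle.Trivial N ℝ) (b := fun m ↦ m) (ϕ := α)
    (v := v) hα hv x hx
  exact (contMDiffWithinAt_totalSpace.1 h).2

theorem mdifferentiableAt_of_contMDiffOn {f : N → ℝ} {W : Set N} (hW : IsOpen W)
    (hf : ContMDiffOn I 𝓘(ℝ, ℝ) ∞ f W) {x : N} (hx : x ∈ W) : MDifferentiableAt I 𝓘(ℝ, ℝ) f x :=
  ((hf x hx).contMDiffAt (hW.mem_nhds hx)).mdifferentiableAt (by simp)

variable [FiniteDimensional ℝ E]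

/-- Locally, a smooth 1-form is a finite sum of terms `f dg`. -/
theorem SmoothOneFormOn.exists_eq_sum {α : OneForm I N} {W : Set N} (hW : IsOpen W)
    (hα : SmoothOneFormOn α W) {x : N} (hx : x ∈ W) :
    ∃ W' ⊆ W, IsOpen W' ∧ x ∈ W' ∧ ∃ (n : ℕ) (f g : Fin n → N → ℝ),
      (∀ i, ContMDiffOn I 𝓘(ℝ, ℝ) ∞ (f i) W') ∧ (∀ i, ContMDiffOn I 𝓘(ℝ, ℝ) ∞ (g i) W') ∧
      ∀ y ∈ W', α y = ∑ i, f i y • differential I (g i) y := by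
  let e := trivializationAt E (TangentSpace I) x
  let b := Module.finBasis ℝ E
  let v (i) (y : N) : TangentSpace I y := e.symmL ℝ y (b i)
  have hv (i) : ContMDiffOn I I.tangent ∞ (fun y ↦ (⟨y, v i y⟩ : TangentBundle I N))
      e.baseSet := by
    have := ContMDiffOn.clm_bundle_apply (n := ∞) (b := id) (E₁ := Bundle.Trivial N E)
      (e.contMDiffOn_symmL (IB := I) (n := ∞) (𝕜 := ℝ))
      (v := fun _ ↦ b i) (IM := I) (fun y hy ↦ by
        rw [contMDiffWithinAt_totalSpace]
        exact ⟨contMDiffWithinAt_id, contMDiffWithinAt_const⟩)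
    exact this
  let c (i) : E →L[ℝ] ℝ := LinearMap.toContinuousLinearMap (b.coord i)
  -- The functions `g` are the coordinates of the chart at `x`, and the functions `f` are the values
  -- of the form on the coordinate vector fields `v`.
  refine ⟨W ∩ e.baseSet, inter_subset_left, hW.inter e.open_baseSet,
    ⟨hx, mem_baseSet_trivializationAt E _ x⟩, _, fun i y ↦ α y (v i y),
    fun i y ↦ c i (extChartAt I x y),
    fun i ↦ (hα.mono inter_subset_left).apply ((hv i).mono inter_subset_right), fun i ↦ ?_, ?_⟩
  · refine ((c i).contMDiff.comp_contMDiffOn (contMDiffOn_extChartAt (n := ∞))).mono ?_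
    exact inter_subset_right
  · rintro y ⟨-, hy⟩
    have hy' : y ∈ (chartAt H x).source := hy
    have hd (i) : differential I (fun y ↦ c i (extChartAt I x y)) y =
        (c i).comp (e.continuousLinearMapAt ℝ y) := by
      have h1 : MDifferentiableAt 𝓘(ℝ, E) 𝓘(ℝ, ℝ) (c i) (extChartAt I x y) :=
        (c i).differentiableAt.mdifferentiableAt
      have h2 := mfderiv_comp y h1 (mdifferentiableAt_extChartAt hy')
      rw [TangentBundle.continuousLinearMapAt_trivializationAt hy']
      refine h2.trans ?_
      rw [mfderiv_eq_fderiv, (c i).fderiv]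
      rfl
    ext X
    have hX : X = ∑ i, b.coord i (e.continuousLinearMapAt ℝ y X) • v i y := by
      have := e.symmL_continuousLinearMapAt (R := ℝ) hy X
      conv_lhs => rw [← this, ← b.sum_repr (e.continuousLinearMapAt ℝ y X)]
      rw [map_sum]
      exact Finset.sum_congr rfl fun i _ ↦ map_smul _ _ _
    conv_lhs => rw [hX]
    rw [map_sum, sum_apply]
    refine Finset.sum_congr rfl fun i _ ↦ ?_
    rw [hd, map_smul, smul_apply, smul_eq_mul, smul_eq_mul, mul_comm]
    rfl

end Smooth

/-! ### Coefficients with respect to a coframe, derived systems -/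

section LinearAlgebra

variable {G F ι : Type*} [NormedAddCommGroup G] [NormedSpace ℝ G] [NormedAddCommGroup F]
  [NormedSpace ℝ F] [FiniteDimensional ℝ F] [Fintype ι]

/-- Coefficients with respect to vectors which depend smoothly on a parameter, and are linearly
independent at one value of it, are given near that value by a smooth function. -/
theorem exists_contDiffAt_coefficients {a : G → F} {v : ι → G → F} {p : G}
    (ha : ContDiffAt ℝ ∞ a p) (hv : ∀ i, ContDiffAt ℝ ∞ (v i) p)
    (hli : LinearIndependent ℝ fun i ↦ v i p) :
    ∃ C : G → ι → ℝ, ContDiffAt ℝ ∞ C p ∧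
      ∀ᶠ z in 𝓝 p, ∀ d : ι → ℝ, a z = ∑ i, d i • v i z → C z = d := by
  -- `A z` sends coefficients to the combination of the `v i z`, and `L` is a left inverse of `A p`;
  -- near `p` the endomorphism `L ∘ A z` is therefore invertible, with a smooth inverse.
  let A (z : G) : (ι → ℝ) →L[ℝ] F :=
    ∑ i, (ContinuousLinearMap.proj (R := ℝ) (φ := fun _ : ι ↦ ℝ) i).smulRight (v i z)
  have hA (z d) : A z d = ∑ i, d i • v i z := by
    simp [A]
  have hinj : LinearMap.ker (A p : (ι → ℝ) →ₗ[ℝ] F) = ⊥ := by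
    rw [LinearMap.ker_eq_bot']
    intro d hd
    funext i
    exact Fintype.linearIndependent_iff.1 hli d ((hA p d).symm.trans hd) i
  obtain ⟨L', hL'⟩ := LinearMap.exists_leftInverse_of_injective _ hinj
  let L : F →L[ℝ] (ι → ℝ) := LinearMap.toContinuousLinearMap L'
  let B (z : G) : (ι → ℝ) →L[ℝ] (ι → ℝ) := L.comp (A z)
  have hB0 : B p = 1 := by
    ext1 d
    exact LinearMap.congr_fun hL' d
  have hAc : ContDiffAt ℝ ∞ A p := by
    refine ContDiffAt.sum fun i _ ↦ ?_
    exact ((ContinuousLinearMap.smulRightL ℝ (ι → ℝ) F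
      (ContinuousLinearMap.proj i)).contDiff.contDiffAt).comp _ (hv i)
  have hBc : ContDiffAt ℝ ∞ B p := contDiffAt_const.clm_comp hAc
  have hBi : ContDiffAt ℝ ∞ (fun z ↦ Ring.inverse (B z)) p := by
    refine ContDiffAt.comp (g := Ring.inverse) _ ?_ hBc
    rw [hB0]
    exact contDiffAt_ringInverse ℝ (1 : ((ι → ℝ) →L[ℝ] (ι → ℝ))ˣ)
  refine ⟨fun z ↦ Ring.inverse (B z) (L (a z)),
    hBi.clm_apply (contDiffAt_const.clm_apply ha), ?_⟩
  have hu : ∀ᶠ z in 𝓝 p, IsUnit (B z) :=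
    hBc.continuousAt.eventually (by rw [hB0]; exact Units.isOpen.mem_nhds isUnit_one)
  filter_upwards [hu] with z hz d hd
  rw [hd, ← hA]
  change (Ring.inverse (B z) * B z) d = d
  rw [Ring.inverse_mul_cancel _ hz]
  rfl

end LinearAlgebra

section Coefficients

variable {E : Type*} [NormedAddCommGroup E] [NormedSpace ℝ E]
  {H : Type*} [TopologicalSpace H] {I : ModelWithCorners ℝ E H}
  {N : Type*} [TopologicalSpace N] [ChartedSpace H N] [I.Boundaryless] [IsManifold I ∞ N]
  {ι : Type*} [Fintype ι]

theorem coordForm_sum (α : ι → OneForm I N) (x : N) :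
    coordForm (fun y ↦ ∑ i, α i y) x = fun z ↦ ∑ i, coordForm (α i) x z := by
  funext z
  exact ContinuousLinearMap.finsetSum_comp _ _

theorem extD_sum {α : ι → OneForm I N} {x : N} (hα : ∀ i, DifferentiableFormAt (α i) x) :
    extD (fun y ↦ ∑ i, α i y) x = ∑ i, extD (α i) x := by
  have e (X Y : TangentSpace I x) :
      formDeriv (fun y ↦ ∑ i, α i y) x X Y = ∑ i, formDeriv (α i) x X Y := by
    rw [formDeriv, coordForm_sum, fderiv_fun_sum fun i _ ↦ hα i]
    refine (congrArg (fun L : E →L[ℝ] ℝ ↦ L Y) (sum_apply _ _ _)).trans ?_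
    exact sum_apply _ _ _
  refine LinearMap.ext₂ fun X Y ↦ ?_
  simp only [LinearMap.sum_apply, extD_apply_formDeriv, e, Finset.sum_sub_distrib]

variable [FiniteDimensional ℝ E]

theorem SmoothOneFormOn.contDiffAt_coordForm {α : OneForm I N} {W : Set N} (hW : IsOpen W)
    (hα : SmoothOneFormOn α W) {x : N} (hx : x ∈ W) :
    ContDiffAt ℝ ∞ (coordForm α x) (extChartAt I x x) := by
  obtain ⟨W', -, hW', hx', n, f, g, hf, hg, h⟩ := hα.exists_eq_sum hW hx
  refine ContDiffAt.congr_of_eventuallyEq ?_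
    (coordForm_congr (Filter.mem_of_superset (hW'.mem_nhds hx') h))
  rw [coordForm_sum]
  refine ContDiffAt.sum fun i _ ↦ ?_
  rw [coordForm_smul]
  exact (contDiffAt_comp_symm ((hf i x hx').contMDiffAt (hW'.mem_nhds hx'))).smul
    (contDiffAt_coordForm_differential hW' (hg i) hx')

theorem SmoothOneFormOn.differentiableFormAt {α : OneForm I N} {W : Set N} (hW : IsOpen W)
    (hα : SmoothOneFormOn α W) {x : N} (hx : x ∈ W) : DifferentiableFormAt α x :=
  (hα.contDiffAt_coordForm hW hx).differentiableAt (by simp)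

theorem extD_of_eq_sum {α : OneForm I N} {W : Set N} (hW : IsOpen W) {x : N} (hx : x ∈ W)
    {f g : ι → N → ℝ} (hf : ∀ i, MDifferentiableAt I 𝓘(ℝ, ℝ) (f i) x)
    (hg : ∀ i, ContMDiffOn I 𝓘(ℝ, ℝ) ∞ (g i) W)
    (h : ∀ y ∈ W, α y = ∑ i, f i y • differential I (g i) y) :
    extD α x = ∑ i, wedge (differential I (f i) x) (differential I (g i) x) := by
  have hd (i) := differentiableFormAt_differential hW (hg i) hx
  rw [extD_congr (Filter.mem_of_superset (hW.mem_nhds hx) h),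
    extD_sum fun i ↦ (hd i).smul (hf i)]
  refine Finset.sum_congr rfl fun i _ ↦ ?_
  rw [extD_smul (hf i) (hd i), extD_differential hW (hg i) hx, smul_zero, add_zero]

theorem extD_sum_smul {c : ι → N → ℝ} {ζ : ι → OneForm I N} {x : N}
    (hc : ∀ i, MDifferentiableAt I 𝓘(ℝ, ℝ) (c i) x) (hζ : ∀ i, DifferentiableFormAt (ζ i) x) :
    extD (fun y ↦ ∑ i, c i y • ζ i y) x =
      ∑ i, (wedge (differential I (c i) x) (ζ i x) + c i x • extD (ζ i) x) := by
  rw [extD_sum fun i ↦ (hζ i).smul (hc i)]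
  exact Finset.sum_congr rfl fun i _ ↦ extD_smul (hc i) (hζ i)

/-- The coefficients of a smooth 1-form with respect to smooth, pointwise independent 1-forms
which span it are smooth. -/
theorem exists_coefficients {α : OneForm I N} {ζ : ι → OneForm I N} {W : Set N} (hW : IsOpen W)
    (hα : SmoothOneFormOn α W) (hζ : ∀ i, SmoothOneFormOn (ζ i) W) {x : N} (hx : x ∈ W)
    (hli : LinearIndependent ℝ fun i ↦ ζ i x)
    (hmem : ∀ y ∈ W, α y ∈ Submodule.span ℝ (range fun i ↦ ζ i y)) :
    ∃ c : ι → N → ℝ, (∀ i, ContMDiffAt I 𝓘(ℝ, ℝ) ∞ (c i) x) ∧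
      ∀ᶠ y in 𝓝 x, α y = ∑ i, c i y • ζ i y := by
  have hli' : LinearIndependent ℝ fun i ↦ coordForm (ζ i) x (extChartAt I x x) := by
    simpa only [coordForm_self] using! hli
  obtain ⟨C, hC, hC'⟩ := exists_contDiffAt_coefficients (hα.contDiffAt_coordForm hW hx)
    (fun i ↦ (hζ i).contDiffAt_coordForm hW hx) hli'
  refine ⟨fun i y ↦ C (extChartAt I x y) i, fun i ↦ ?_, ?_⟩
  · have h1 : ContDiffAt ℝ ∞ (fun z ↦ C z i) (extChartAt I x x) := contDiffAt_pi.1 hC i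
    exact h1.contMDiffAt.comp x contMDiffAt_extChartAt
  · filter_upwards [(continuousAt_extChartAt (I := I) x).eventually hC', hW.mem_nhds hx,
      extChartAt_source_mem_nhds (I := I) x] with y hy hyW hys
    obtain ⟨d, hd⟩ := (Submodule.mem_span_range_iff_exists_fun ℝ).1 (hmem y hyW)
    rw [hy d, hd]
    have hd' : α ((extChartAt I x).symm (extChartAt I x y)) =
        ∑ i, d i • ζ i ((extChartAt I x).symm (extChartAt I x y)) := by
      rw [(extChartAt I x).left_inv hys, hd]
    rw [coordForm, hd']
    exact ContinuousLinearMap.finsetSum_comp _ _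

/-- If smooth, pointwise independent 1-forms `ζᵢ` span a Pfaffian system containing `V`, then a
covector `∑ cᵢ ζᵢ(x)` in the derived system of `V` satisfies `∑ cᵢ dζᵢ(x) ≡ 0 mod ζ`. -/
theorem exists_of_mem_derived {V : Pfaffian I N} {ζ : ι → OneForm I N} {W : Set N} (hW : IsOpen W)
    (hζ : ∀ i, SmoothOneFormOn (ζ i) W) {x : N} (hx : x ∈ W)
    (hli : LinearIndependent ℝ fun i ↦ ζ i x)
    (hV : ∀ y ∈ W, V y ≤ Submodule.span ℝ (range fun i ↦ ζ i y)) {a : Covector I x}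
    (ha : a ∈ derived V x) :
    ∃ c : ι → ℝ, a = ∑ i, c i • ζ i x ∧
      ∑ i, c i • extD (ζ i) x ∈ idealTwo (Submodule.span ℝ (range fun i ↦ ζ i x)) := by
  induction ha using Submodule.span_induction with
  | mem a ha =>
    obtain ⟨W', hW', hx', α, ⟨hα, hαV⟩, hd, rfl⟩ := ha
    obtain ⟨c, hc, hαc⟩ := exists_coefficients (hW.inter hW') (hα.mono inter_subset_right)
      (fun i ↦ (hζ i).mono inter_subset_left) ⟨hx, hx'⟩ hli
      (fun y hy ↦ hV y hy.1 (hαV y hy.2))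
    refine ⟨fun i ↦ c i x, hαc.self_of_nhds, ?_⟩
    have h1 := extD_sum_smul (ζ := ζ) (fun i ↦ (hc i).mdifferentiableAt (by simp))
      (fun i ↦ (hζ i).differentiableFormAt hW hx)
    rw [← extD_congr hαc, Finset.sum_add_distrib] at h1
    have h2 : ∑ i, wedge (differential I (c i) x) (ζ i x) ∈
        idealTwo (Submodule.span ℝ (range fun i ↦ ζ i x)) :=
      Submodule.sum_mem _ fun i _ ↦ wedge_mem_idealTwo_right _
        (Submodule.subset_span (mem_range_self i))
    refine mem_of_add_mem h2 ?_
    rw [← h1]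
    refine Submodule.span_mono ?_ (hd x hx')
    rintro _ ⟨a, ha, b, rfl⟩
    exact ⟨a, hV x hx ha, b, rfl⟩
  | zero => exact ⟨0, by simp, by simp⟩
  | add a b _ _ ha hb =>
    obtain ⟨c, rfl, hc⟩ := ha
    obtain ⟨c', rfl, hc'⟩ := hb
    refine ⟨c + c', by simp [add_smul, Finset.sum_add_distrib], ?_⟩
    have := Submodule.add_mem _ hc hc'
    simpa [add_smul, Finset.sum_add_distrib] using this
  | smul r a _ ha =>
    obtain ⟨c, rfl, hc⟩ := ha
    refine ⟨r • c, by simp [Finset.smul_sum, smul_smul], ?_⟩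
    have := Submodule.smul_mem _ r hc
    simpa [Finset.smul_sum, smul_smul] using this

theorem derived_le (V : Pfaffian I N) (x : N) : derived V x ≤ V x := by
  refine Submodule.span_le.2 ?_
  rintro _ ⟨W, -, hx, α, hα, -, rfl⟩
  exact hα.2 x hx

theorem derivedFlag_succ (V : Pfaffian I N) (n : ℕ) :
    derivedFlag V (n + 1) = derived (derivedFlag V n) :=
  Function.iterate_succ_apply' _ _ _

theorem idealTwo_mono {x : N} {V V' : Submodule ℝ (Covector I x)} (h : V ≤ V') :
    idealTwo V ≤ idealTwo V' := by
  refine Submodule.span_mono ?_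
  rintro _ ⟨a, ha, b, rfl⟩
  exact ⟨a, h ha, b, rfl⟩

/-- A completely integrable subsystem of `V` with smooth generators is contained in every member of
the derived flag of `V`. -/
theorem span_le_derivedFinal {V : Pfaffian I N} {ζ : ι → OneForm I N} {W : Set N} (hW : IsOpen W)
    (hζ : ∀ i, SmoothOneFormOn (ζ i) W)
    (hV : ∀ y ∈ W, Submodule.span ℝ (range fun i ↦ ζ i y) ≤ V y)
    (hd : ∀ y ∈ W, ∀ i, extD (ζ i) y ∈ idealTwo (Submodule.span ℝ (range fun i ↦ ζ i y)))
    {x : N} (hx : x ∈ W) :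
    Submodule.span ℝ (range fun i ↦ ζ i x) ≤ derivedFinal V x := by
  have key (n : ℕ) : ∀ y ∈ W, Submodule.span ℝ (range fun i ↦ ζ i y) ≤ derivedFlag V n y := by
    induction n with
    | zero => exact hV
    | succ n ih =>
      intro y hy
      rw [derivedFlag_succ, Submodule.span_le]
      rintro _ ⟨i, rfl⟩
      exact Submodule.subset_span ⟨W, hW, hy, ζ i,
        ⟨hζ i, fun z hz ↦ ih z hz (Submodule.subset_span (mem_range_self i))⟩,
        fun z hz ↦ idealTwo_mono (ih z hz) (hd z hz i), rfl⟩
  exact le_iInf fun n ↦ key n x hx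

/-- The degree two part of the differential ideal generated by smooth, pointwise independent
1-forms. -/
theorem differentialIdealTwo_eq {V : Pfaffian I N} {ζ : ι → OneForm I N} {W : Set N}
    (hW : IsOpen W) (hζ : ∀ i, SmoothOneFormOn (ζ i) W) {x : N} (hx : x ∈ W)
    (hli : LinearIndependent ℝ fun i ↦ ζ i x)
    (hV : ∀ y ∈ W, V y = Submodule.span ℝ (range fun i ↦ ζ i y)) :
    differentialIdealTwo V x =
      idealTwo (V x) ⊔ Submodule.span ℝ (range fun i ↦ extD (ζ i) x) := by
  refine le_antisymm (sup_le le_sup_left (Submodule.span_le.2 ?_))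
    (sup_le le_sup_left (Submodule.span_le.2 ?_))
  · rintro _ ⟨W', hW', hx', α, ⟨hα, hαV⟩, rfl⟩
    obtain ⟨c, hc, hαc⟩ := exists_coefficients (hW.inter hW') (hα.mono inter_subset_right)
      (fun i ↦ (hζ i).mono inter_subset_left) ⟨hx, hx'⟩ hli
      (fun y hy ↦ hV y hy.1 ▸ hαV y hy.2)
    have h1 := extD_sum_smul (ζ := ζ) (fun i ↦ (hc i).mdifferentiableAt (by simp))
      (fun i ↦ (hζ i).differentiableFormAt hW hx)
    rw [SetLike.mem_coe, extD_congr hαc, h1]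
    refine Submodule.sum_mem _ fun i _ ↦ Submodule.add_mem _ (Submodule.mem_sup_left ?_)
      (Submodule.smul_mem _ _ (Submodule.mem_sup_right (Submodule.subset_span (mem_range_self i))))
    rw [hV x hx]
    exact wedge_mem_idealTwo_right _ (Submodule.subset_span (mem_range_self i))
  · rintro _ ⟨i, rfl⟩
    refine Submodule.mem_sup_right (Submodule.subset_span ⟨W, hW, hx, ζ i, ⟨hζ i, ?_⟩, rfl⟩)
    intro y hy
    rw [hV y hy]
    exact Submodule.subset_span (mem_range_self i)

theorem derived_le_derived {V V' : Pfaffian I N} {W : Set N} (hW : IsOpen W)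
    (h : ∀ y ∈ W, V y ≤ V' y) {x : N} (hx : x ∈ W) : derived V x ≤ derived V' x := by
  refine Submodule.span_mono ?_
  rintro _ ⟨W', hW', hx', α, ⟨hα, hαV⟩, hd, rfl⟩
  exact ⟨W ∩ W', hW.inter hW', ⟨hx, hx'⟩, α,
    ⟨hα.mono inter_subset_right, fun y hy ↦ h y hy.1 (hαV y hy.2)⟩,
    fun y hy ↦ idealTwo_mono (h y hy.1) (hd y hy.2), rfl⟩

theorem derivedFlag_le_derivedFlag {V V' : Pfaffian I N} {W : Set N} (hW : IsOpen W)
    (h : ∀ y ∈ W, V y ≤ V' y) (n : ℕ) : ∀ x ∈ W, derivedFlag V n x ≤ derivedFlag V' n x := by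
  induction n with
  | zero => exact h
  | succ n ih =>
    intro x hx
    rw [derivedFlag_succ, derivedFlag_succ]
    exact derived_le_derived hW ih hx

end Coefficients

/-! ### Pullbacks -/

section Pullback

variable {E : Type*} [NormedAddCommGroup E] [NormedSpace ℝ E]
  {H : Type*} [TopologicalSpace H] {I : ModelWithCorners ℝ E H}
  {N : Type*} [TopologicalSpace N] [ChartedSpace H N] [I.Boundaryless] [IsManifold I ∞ N]
  {E' : Type*} [NormedAddCommGroup E'] [NormedSpace ℝ E'] [FiniteDimensional ℝ E']
  {H' : Type*} [TopologicalSpace H'] {I' : ModelWithCorners ℝ E' H'}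
  {N' : Type*} [TopologicalSpace N'] [ChartedSpace H' N'] [I'.Boundaryless] [IsManifold I' ∞ N']

theorem differential_comp {φ : N → N'} {f : N' → ℝ} {x : N} (hφ : MDifferentiableAt I I' φ x)
    (hf : MDifferentiableAt I' 𝓘(ℝ, ℝ) f (φ x)) :
    differential I (f ∘ φ) x = (differential I' f (φ x)).comp (mfderiv I I' φ x) :=
  mfderiv_comp x hf hφ

theorem pullback_apply (φ : N → N') (α : OneForm I' N') (x : N) (X : TangentSpace I x) :
    pullback (I := I) φ α x X = α (φ x) (mfderiv I I' φ x X) := rfl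

/-- Locally, `α = ∑ fᵢ dgᵢ` and `φ*α = ∑ (fᵢ ∘ φ) d(gᵢ ∘ φ)`. -/
theorem pullback_exists_eq_sum {φ : N → N'} (hφ : ContMDiff I I' ∞ φ) {α : OneForm I' N'}
    {W : Set N'} (hW : IsOpen W) (hα : SmoothOneFormOn α W) {x : N} (hx : φ x ∈ W) :
    ∃ W' ⊆ W, IsOpen W' ∧ φ x ∈ W' ∧ ∃ (n : ℕ) (f g : Fin n → N' → ℝ),
      (∀ i, ContMDiffOn I' 𝓘(ℝ, ℝ) ∞ (f i) W') ∧ (∀ i, ContMDiffOn I' 𝓘(ℝ, ℝ) ∞ (g i) W') ∧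
      (∀ y ∈ W', α y = ∑ i, f i y • differential I' (g i) y) ∧
      ∀ y ∈ φ ⁻¹' W', pullback (I := I) φ α y = ∑ i, (f i ∘ φ) y • differential I (g i ∘ φ) y := by
  obtain ⟨W', hWW, hW', hx', n, f, g, hf, hg, h⟩ := hα.exists_eq_sum hW hx
  refine ⟨W', hWW, hW', hx', n, f, g, hf, hg, h, fun y hy ↦ ?_⟩
  ext X
  rw [pullback_apply, h _ hy, sum_apply, sum_apply]
  refine Finset.sum_congr rfl fun i _ ↦ ?_
  rw [differential_comp ((hφ y).mdifferentiableAt (by simp))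
    (mdifferentiableAt_of_contMDiffOn hW' (hg i) hy)]
  rfl

theorem SmoothOneFormOn.pullback {φ : N → N'} (hφ : ContMDiff I I' ∞ φ) {α : OneForm I' N'}
    {W : Set N'} (hW : IsOpen W) (hα : SmoothOneFormOn α W) :
    SmoothOneFormOn (pullback (I := I) φ α) (φ ⁻¹' W) := by
  intro x hx
  obtain ⟨W', -, hW', hx', n, f, g, hf, hg, -, h⟩ := pullback_exists_eq_sum hφ hW hα hx
  have ho := hW'.preimage hφ.continuous
  have hm : MapsTo φ (φ ⁻¹' W') W' := fun _ h ↦ h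
  have h1 : SmoothOneFormOn (IsoEmbedding.pullback (I := I) φ α) (φ ⁻¹' W') :=
    (SmoothOneFormOn.sum fun i ↦ SmoothOneFormOn.smul ((hf i).comp hφ.contMDiffOn hm)
      (smoothOneFormOn_differential ho ((hg i).comp hφ.contMDiffOn hm))).congr h
  exact ((h1 x hx').contMDiffAt (ho.mem_nhds hx')).contMDiffWithinAt

variable [FiniteDimensional ℝ E]

/-- The exterior derivative commutes with pullbacks. -/
theorem extD_pullback {φ : N → N'} (hφ : ContMDiff I I' ∞ φ) {α : OneForm I' N'}
    {W : Set N'} (hW : IsOpen W) (hα : SmoothOneFormOn α W) {x : N} (hx : φ x ∈ W)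
    (X Y : TangentSpace I x) :
    extD (pullback (I := I) φ α) x X Y =
      extD α (φ x) (mfderiv I I' φ x X) (mfderiv I I' φ x Y) := by
  obtain ⟨W', -, hW', hx', n, f, g, hf, hg, h, h'⟩ := pullback_exists_eq_sum hφ hW hα hx
  have ho := hW'.preimage hφ.continuous
  have hm : MapsTo φ (φ ⁻¹' W') W' := fun _ h ↦ h
  have hφx := (hφ x).mdifferentiableAt (n := ∞) (by simp)
  rw [extD_of_eq_sum hW' hx' (fun i ↦ mdifferentiableAt_of_contMDiffOn hW' (hf i) hx') hg h,
    extD_of_eq_sum ho hx' (fun i ↦ mdifferentiableAt_of_contMDiffOn ho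
      ((hf i).comp hφ.contMDiffOn hm) hx') (fun i ↦ (hg i).comp hφ.contMDiffOn hm) h']
  simp only [LinearMap.sum_apply, wedge_apply]
  refine Finset.sum_congr rfl fun i _ ↦ ?_
  rw [differential_comp hφx (mdifferentiableAt_of_contMDiffOn hW' (hg i) hx'),
    differential_comp hφx (mdifferentiableAt_of_contMDiffOn hW' (hf i) hx')]
  rfl

end Pullback

/-! ### The structure equations of the orthonormal frame bundle -/

section FrameBundle

instance : IsManifold modelF3 ∞ F3 := inferInstance
instance : modelF3.Boundaryless := inferInstance

theorem contMDiff_entry (i j : Fin 3) :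
    ContMDiff 𝓘(ℝ, E3) 𝓘(ℝ, ℝ) ∞ fun Q : O3 ↦ (Q : Matrix (Fin 3) (Fin 3) ℝ) i j := by
  intro R
  rw [contMDiffAt_iff]
  refine ⟨(Continuous.matrix_elem continuous_subtype_val i j).continuousAt, ContDiffAt.contDiffWithinAt ?_⟩
  have h : ContDiff ℝ ∞ fun a : E3 ↦ ((R : Matrix (Fin 3) (Fin 3) ℝ) * cayley a) i j := by
    simp only [Matrix.mul_apply]
    have := contDiff_cayley
    fun_prop
  exact h.contDiffAt

/-- The chart of `O3` centred at `R` is the inverse of `a ↦ R * cayley a`, so that the differential of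
a matrix entry at `R` is a derivative at the origin. -/
theorem hasFDerivAt_entry (R : O3) (i j : Fin 3) :
    HasFDerivAt (fun a : E3 ↦ ((R : Matrix (Fin 3) (Fin 3) ℝ) * cayley a) i j)
      (differential 𝓘(ℝ, E3) (fun Q : O3 ↦ (Q : Matrix (Fin 3) (Fin 3) ℝ) i j) R : E3 →L[ℝ] ℝ)
      (0 : E3) := by
  have h := hasFDerivAt_comp_symm ((contMDiff_entry i j R).mdifferentiableAt (by simp))
  have h0 : extChartAt 𝓘(ℝ, E3) R R = (0 : E3) := by
    have hR := (Matrix.mem_orthogonalGroup_iff' (Fin 3) ℝ).1 R.2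
    change cayleyInv ((R : Matrix (Fin 3) (Fin 3) ℝ)ᵀ * R) = 0
    rw [hR]
    simp [cayleyInv]
  rw [h0] at h
  exact h

/-- The derivative at the origin of the entries of `P - Pᵀ`, where `P` is the Cayley transform. -/
theorem fderiv_four_mul_div (k : Fin 3) (X : E3) :
    fderiv ℝ (fun a : E3 ↦ (1 + (a 0 ^ 2 + a 1 ^ 2 + a 2 ^ 2))⁻¹ * (4 * a k)) 0 X = 4 * X k := by
  have hp (k : Fin 3) : HasFDerivAt (fun a : E3 ↦ a k) (EuclideanSpace.proj k : E3 →L[ℝ] ℝ) 0 :=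
    (EuclideanSpace.proj k : E3 →L[ℝ] ℝ).hasFDerivAt
  have h1 := ((((hp 0).pow 2).add ((hp 1).pow 2)).add ((hp 2).pow 2)).const_add 1
  have h2 := (hasFDerivAt_inv (x := (1 : ℝ)) one_ne_zero)
  have h3 : HasFDerivAt (fun a : E3 ↦ (1 + (a 0 ^ 2 + a 1 ^ 2 + a 2 ^ 2))⁻¹) (0 : E3 →L[ℝ] ℝ) 0 := by
    refine (HasFDerivAt.comp (g := fun y : ℝ ↦ y⁻¹) (0 : E3) (by simpa using h2) h1).congr_fderiv ?_
    ext X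
    simp
  have h4 := h3.mul ((hp k).const_mul 4)
  refine (congrArg (fun L : E3 →L[ℝ] ℝ ↦ L X) h4.fderiv).trans ?_
  simp

/-- The parametrization `a ↦ R * cayley a` is an immersion at the origin. -/
theorem eq_zero_of_fderiv_mul_cayley (R : O3) (D : Fin 3 → Fin 3 → E3 →L[ℝ] ℝ)
    (hD : ∀ i j, HasFDerivAt (fun a : E3 ↦ ((R : Matrix (Fin 3) (Fin 3) ℝ) * cayley a) i j)
      (D i j) 0) (X : E3) (h : ∀ i j, D i j X = 0) : X = 0 := by
  have hR := (Matrix.mem_orthogonalGroup_iff' (Fin 3) ℝ).1 R.2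
  have hc (i j : Fin 3) : HasFDerivAt (fun a : E3 ↦ cayley a i j)
      (∑ l, (R : Matrix (Fin 3) (Fin 3) ℝ) l i • D l j) 0 := by
    have := HasFDerivAt.fun_sum (u := Finset.univ) fun l _ ↦
      (hD l j).const_mul ((R : Matrix (Fin 3) (Fin 3) ℝ) l i)
    refine this.congr_of_eventuallyEq (Filter.Eventually.of_forall fun a ↦ ?_)
    have e : (R : Matrix (Fin 3) (Fin 3) ℝ)ᵀ * (R * cayley a) = cayley a := by
      rw [← mul_assoc, hR, one_mul]
    exact (congrFun (congrFun e i) j).symm.trans (Matrix.mul_apply ..)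
  have hz (i j : Fin 3) : fderiv ℝ (fun a : E3 ↦ cayley a i j) 0 X = 0 := by
    rw [(hc i j).fderiv]
    simp [h]
  have key (i j k : Fin 3) (e : ∀ a : E3, cayley a i j - cayley a j i =
      (1 + (a 0 ^ 2 + a 1 ^ 2 + a 2 ^ 2))⁻¹ * (4 * a k)) : X k = 0 := by
    have h1 := fderiv_four_mul_div k X
    rw [← funext e, fderiv_fun_sub (hc i j).differentiableAt (hc j i).differentiableAt,
      sub_apply, hz, hz] at h1
    linarith
  ext k
  fin_cases k
  · exact key 2 1 0 fun a ↦ by simp [cayley]; ring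
  · exact key 0 2 1 fun a ↦ by simp [cayley]; ring
  · exact key 1 0 2 fun a ↦ by simp [cayley]; ring

/-- A tangent vector of `O3` on which the differentials of all matrix entries vanish is zero. -/
theorem eq_zero_of_differential_entry (R : O3) (X : TangentSpace 𝓘(ℝ, E3) R)
    (h : ∀ i j, differential 𝓘(ℝ, E3)
      (fun Q : O3 ↦ (Q : Matrix (Fin 3) (Fin 3) ℝ) i j) R X = 0) : X = 0 :=
  eq_zero_of_fderiv_mul_cayley R _ (hasFDerivAt_entry R) X h

/-- The `a`-th coordinate of the base point of a frame. -/
def basePointCoord (a : Fin 3) (x : F3) : ℝ := x.1 a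

/-- The `a`-th coordinate of the `i`-th member of a frame. -/
def frameCoord (i a : Fin 3) (x : F3) : ℝ := (x.2 : Matrix (Fin 3) (Fin 3) ℝ) a i

theorem contMDiff_basePointCoord (a : Fin 3) :
    ContMDiff modelF3 𝓘(ℝ, ℝ) ∞ (basePointCoord a) :=
  (EuclideanSpace.proj a : E3 →L[ℝ] ℝ).contMDiff.comp contMDiff_fst

theorem contMDiff_frameCoord (i a : Fin 3) : ContMDiff modelF3 𝓘(ℝ, ℝ) ∞ (frameCoord i a) :=
  (contMDiff_entry a i).comp contMDiff_snd

theorem contMDiff_frameVec (i : Fin 3) : ContMDiff modelF3 𝓘(ℝ, E3) ∞ (frameVec i) := by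
  have h : ContMDiff modelF3 𝓘(ℝ, Fin 3 → ℝ) ∞ fun x a ↦ frameCoord i a x :=
    contMDiff_pi_space.2 fun a ↦ contMDiff_frameCoord i a
  exact ((EuclideanSpace.equiv (Fin 3) ℝ).symm : (Fin 3 → ℝ) →L[ℝ] E3).contMDiff.comp h

theorem innerSL_apply_eq_sum (u w : E3) : innerSL ℝ u w = ∑ a, u a * w a := by
  simp [PiLp.inner_apply, mul_comm]

theorem omega_apply (i : Fin 3) (x : F3) (X : TangentSpace modelF3 x) :
    omega i x X = ∑ a, frameCoord i a x * differential modelF3 (basePointCoord a) x X := by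
  have h (a : Fin 3) : differential modelF3 (basePointCoord a) x X =
      EuclideanSpace.proj (𝕜 := ℝ) a (mfderiv modelF3 𝓘(ℝ, E3) (Prod.fst : F3 → E3) x X) := by
    have := mfderiv_comp (I' := 𝓘(ℝ, E3)) (I'' := 𝓘(ℝ, ℝ)) x
      (EuclideanSpace.proj (𝕜 := ℝ) a : E3 →L[ℝ] ℝ).differentiableAt.mdifferentiableAt
      ((contMDiff_fst (n := ∞) (I := 𝓘(ℝ, E3)) (J := 𝓘(ℝ, E3)) (M := E3) (N := O3) x).mdifferentiableAt
        (by simp))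
    rw [mfderiv_eq_fderiv, ContinuousLinearMap.fderiv] at this
    exact congrArg (fun L ↦ L X) this
  simp only [h]
  exact innerSL_apply_eq_sum _ _

theorem omegaConn_apply (i j : Fin 3) (x : F3) (X : TangentSpace modelF3 x) :
    omegaConn i j x X = ∑ a, frameCoord i a x * differential modelF3 (frameCoord j a) x X := by
  have h (a : Fin 3) : differential modelF3 (frameCoord j a) x X =
      EuclideanSpace.proj (𝕜 := ℝ) a (mfderiv modelF3 𝓘(ℝ, E3) (frameVec j) x X) := by
    have := mfderiv_comp (I' := 𝓘(ℝ, E3)) (I'' := 𝓘(ℝ, ℝ)) x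
      (EuclideanSpace.proj (𝕜 := ℝ) a : E3 →L[ℝ] ℝ).differentiableAt.mdifferentiableAt
      ((contMDiff_frameVec j x).mdifferentiableAt (by simp))
    rw [mfderiv_eq_fderiv, ContinuousLinearMap.fderiv] at this
    exact congrArg (fun L ↦ L X) this
  simp only [h]
  exact innerSL_apply_eq_sum _ _

end FrameBundle

section FrameBundle

theorem sum_frameCoord_mul (i j : Fin 3) (x : F3) :
    ∑ a, frameCoord i a x * frameCoord j a x = if i = j then 1 else 0 := by
  have h := congrFun (congrFun ((Matrix.mem_orthogonalGroup_iff' (Fin 3) ℝ).1 x.2.2) i) j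
  rw [Matrix.mul_apply, Matrix.one_apply] at h
  exact h

/-- The rows of an orthogonal matrix are orthonormal as well. -/
theorem sum_frameCoord_mul' (a b : Fin 3) (x : F3) :
    ∑ i, frameCoord i a x * frameCoord i b x = if a = b then 1 else 0 := by
  have h := congrFun (congrFun ((Matrix.mem_orthogonalGroup_iff (Fin 3) ℝ).1 x.2.2) a) b
  rw [Matrix.mul_apply, Matrix.one_apply] at h
  exact h

theorem eq_sum_frameCoord_mul (x : F3) (u : Fin 3 → ℝ) (a : Fin 3) :
    u a = ∑ i, frameCoord i a x * ∑ b, frameCoord i b x * u b := by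
  simp_rw [Finset.mul_sum, ← mul_assoc]
  rw [Finset.sum_comm]
  simp_rw [← Finset.sum_mul, sum_frameCoord_mul']
  simp

theorem sum_mul_eq_sum_frameCoord (x : F3) (u w : Fin 3 → ℝ) :
    ∑ a, u a * w a = ∑ i, (∑ b, frameCoord i b x * u b) * ∑ b, frameCoord i b x * w b := by
  calc ∑ a, u a * w a = ∑ a, ∑ i, (frameCoord i a x * ∑ b, frameCoord i b x * u b) * w a := by
        refine Finset.sum_congr rfl fun a _ ↦ ?_
        rw [← Finset.sum_mul, ← eq_sum_frameCoord_mul]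
    _ = _ := by
        rw [Finset.sum_comm]
        refine Finset.sum_congr rfl fun i _ ↦ ?_
        rw [Finset.mul_sum]
        exact Finset.sum_congr rfl fun a _ ↦ by ring

theorem omega_eq_sum (i : Fin 3) (x : F3) :
    omega i x = ∑ a, frameCoord i a x • differential modelF3 (basePointCoord a) x := by
  ext X
  rw [omega_apply, sum_apply]
  rfl

theorem omegaConn_eq_sum (i j : Fin 3) (x : F3) :
    omegaConn i j x = ∑ a, frameCoord i a x • differential modelF3 (frameCoord j a) x := by
  ext X
  rw [omegaConn_apply, sum_apply]
  rfl

theorem smoothOneFormOn_omega (i : Fin 3) : SmoothOneFormOn (omega i) univ :=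
  (SmoothOneFormOn.sum fun a ↦ SmoothOneFormOn.smul (contMDiff_frameCoord i a).contMDiffOn
    (smoothOneFormOn_differential isOpen_univ (contMDiff_basePointCoord a).contMDiffOn)).congr
    fun x _ ↦ omega_eq_sum i x

theorem smoothOneFormOn_omegaConn (i j : Fin 3) : SmoothOneFormOn (omegaConn i j) univ :=
  (SmoothOneFormOn.sum fun a ↦ SmoothOneFormOn.smul (contMDiff_frameCoord i a).contMDiffOn
    (smoothOneFormOn_differential isOpen_univ (contMDiff_frameCoord j a).contMDiffOn)).congr
    fun x _ ↦ omegaConn_eq_sum i j x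

/-- `dωⁱ = -ωⁱⱼ ∧ ωʲ`, in the form `dωⁱ = ωʲᵢ ∧ ωʲ`. -/
theorem extD_omega (i : Fin 3) (x : F3) (X Y : TangentSpace modelF3 x) :
    extD (omega i) x X Y =
      ∑ j, (omegaConn j i x X * omega j x Y - omegaConn j i x Y * omega j x X) := by
  rw [extD_of_eq_sum isOpen_univ (mem_univ x)
    (fun a ↦ (contMDiff_frameCoord i a x).mdifferentiableAt (by simp))
    (fun a ↦ (contMDiff_basePointCoord a).contMDiffOn) fun y _ ↦ omega_eq_sum i y]
  simp only [LinearMap.sum_apply, wedge_apply, Finset.sum_sub_distrib, omegaConn_apply, omega_apply]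
  exact congrArg₂ (· - ·) (sum_mul_eq_sum_frameCoord x _ _) (sum_mul_eq_sum_frameCoord x _ _)

/-- `dωⁱⱼ = -ωⁱₖ ∧ ωᵏⱼ`, in the form `dωⁱⱼ = ωᵏᵢ ∧ ωᵏⱼ`. -/
theorem extD_omegaConn (i j : Fin 3) (x : F3) (X Y : TangentSpace modelF3 x) :
    extD (omegaConn i j) x X Y =
      ∑ k, (omegaConn k i x X * omegaConn k j x Y - omegaConn k i x Y * omegaConn k j x X) := by
  rw [extD_of_eq_sum isOpen_univ (mem_univ x)
    (fun a ↦ (contMDiff_frameCoord i a x).mdifferentiableAt (by simp))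
    (fun a ↦ (contMDiff_frameCoord j a).contMDiffOn) fun y _ ↦ omegaConn_eq_sum i j y]
  simp only [LinearMap.sum_apply, wedge_apply, Finset.sum_sub_distrib, omegaConn_apply]
  exact congrArg₂ (· - ·) (sum_mul_eq_sum_frameCoord x _ _) (sum_mul_eq_sum_frameCoord x _ _)

theorem omegaConn_antisymm (i j : Fin 3) (x : F3) (X : TangentSpace modelF3 x) :
    omegaConn i j x X = -omegaConn j i x X := by
  have hd (k a) : MDifferentiableAt modelF3 𝓘(ℝ, ℝ) (frameCoord k a) x :=
    (contMDiff_frameCoord k a x).mdifferentiableAt (by simp)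
  have h : differential modelF3 (fun y ↦ frameCoord i 0 y * frameCoord j 0 y
      + frameCoord i 1 y * frameCoord j 1 y + frameCoord i 2 y * frameCoord j 2 y) x = 0 := by
    rw [← differential_const (if i = j then 1 else 0 : ℝ) x]
    refine congrArg (fun f ↦ differential modelF3 f x) (funext fun y ↦ ?_)
    rw [← sum_frameCoord_mul i j y, Fin.sum_univ_three]
  have hm (a) := mdifferentiableAt_mul (hd i a) (hd j a)
  rw [differential_add (mdifferentiableAt_add (hm 0) (hm 1)) (hm 2), differential_add (hm 0) (hm 1),
    differential_mul (hd _ _) (hd _ _), differential_mul (hd _ _) (hd _ _),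
    differential_mul (hd _ _) (hd _ _)] at h
  have h' := congrArg (fun L ↦ L X) h
  simp only [add_apply, smul_apply, smul_eq_mul, zero_apply] at h'
  rw [omegaConn_apply, omegaConn_apply, Fin.sum_univ_three, Fin.sum_univ_three]
  linear_combination h'

/-- The canonical and connection forms span the cotangent spaces of the frame bundle. -/
theorem eq_zero_of_omega (x : F3) (X : TangentSpace modelF3 x) (h : ∀ i, omega i x X = 0)
    (h' : ∀ i j, omegaConn i j x X = 0) : X = 0 := by
  have h1 (a : Fin 3) : differential modelF3 (basePointCoord a) x X = 0 := by
    rw [eq_sum_frameCoord_mul x (fun a ↦ differential modelF3 (basePointCoord a) x X)]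
    simp_rw [← omega_apply, h, mul_zero, Finset.sum_const_zero]
  have h2 (i a : Fin 3) : differential modelF3 (frameCoord i a) x X = 0 := by
    rw [eq_sum_frameCoord_mul x (fun a ↦ differential modelF3 (frameCoord i a) x X)]
    simp_rw [← omegaConn_apply, h', mul_zero, Finset.sum_const_zero]
  have e1 (a : Fin 3) : differential modelF3 (basePointCoord a) x =
      (EuclideanSpace.proj (𝕜 := ℝ) a : E3 →L[ℝ] ℝ).comp (ContinuousLinearMap.fst ℝ E3 E3) := by
    have := mfderiv_comp (I' := 𝓘(ℝ, E3)) (I'' := 𝓘(ℝ, ℝ)) x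
      (EuclideanSpace.proj (𝕜 := ℝ) a : E3 →L[ℝ] ℝ).differentiableAt.mdifferentiableAt
      (mdifferentiableAt_fst (I := 𝓘(ℝ, E3)) (I' := 𝓘(ℝ, E3)) (M := E3) (M' := O3))
    rw [mfderiv_eq_fderiv, ContinuousLinearMap.fderiv, mfderiv_fst] at this
    exact this
  have e2 (i a : Fin 3) : differential modelF3 (frameCoord i a) x =
      (differential 𝓘(ℝ, E3) (fun Q : O3 ↦ (Q : Matrix (Fin 3) (Fin 3) ℝ) a i) x.2).comp
        (ContinuousLinearMap.snd ℝ E3 E3) := by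
    have := mfderiv_comp (I' := 𝓘(ℝ, E3)) (I'' := 𝓘(ℝ, ℝ)) x
      ((contMDiff_entry a i x.2).mdifferentiableAt (by simp))
      (mdifferentiableAt_snd (I := 𝓘(ℝ, E3)) (I' := 𝓘(ℝ, E3)) (M := E3) (M' := O3))
    rw [mfderiv_snd] at this
    exact this
  have h3 : (X : E3 × E3).1 = 0 := by
    ext a
    have := h1 a
    rw [e1] at this
    exact this
  have h4 : (X : E3 × E3).2 = 0 := by
    refine eq_zero_of_differential_entry x.2 _ fun a i ↦ ?_
    have := h2 i a
    rw [e2] at this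
    exact this
  exact Prod.ext h3 h4

end FrameBundle

/-! ### Frame calculus on a surface -/

section VectorFields

variable {E : Type*} [NormedAddCommGroup E] [NormedSpace ℝ E] [FiniteDimensional ℝ E]
  {H : Type*} [TopologicalSpace H] {I : ModelWithCorners ℝ E H}
  {N : Type*} [TopologicalSpace N] [ChartedSpace H N] [I.Boundaryless] [IsManifold I ∞ N]

theorem contMDiffOn_extD_apply {α : OneForm I N} {W : Set N} (hW : IsOpen W)
    (hα : SmoothOneFormOn α W) {X Y : ∀ x : N, TangentSpace I x}
    (hX : ContMDiffOn I I.tangent ∞ (fun x ↦ (⟨x, X x⟩ : TangentBundle I N)) W)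
    (hY : ContMDiffOn I I.tangent ∞ (fun x ↦ (⟨x, Y x⟩ : TangentBundle I N)) W) :
    ContMDiffOn I 𝓘(ℝ, ℝ) ∞ (fun x ↦ extD α x (X x) (Y x)) W := by
  intro x hx
  obtain ⟨W', hWW, hW', hx', n, f, g, hf, hg, h⟩ := hα.exists_eq_sum hW hx
  have hd {u : N → ℝ} (hu : ContMDiffOn I 𝓘(ℝ, ℝ) ∞ u W') {Z : ∀ x : N, TangentSpace I x}
      (hZ : ContMDiffOn I I.tangent ∞ (fun x ↦ (⟨x, Z x⟩ : TangentBundle I N)) W) :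
      ContMDiffOn I 𝓘(ℝ, ℝ) ∞ (fun y ↦ differential I u y (Z y)) W' :=
    (smoothOneFormOn_differential hW' hu).apply (hZ.mono hWW)
  have h1 : ContMDiffOn I 𝓘(ℝ, ℝ) ∞ (fun y ↦ ∑ i,
      (differential I (f i) y (X y) * differential I (g i) y (Y y)
        - differential I (f i) y (Y y) * differential I (g i) y (X y))) W' :=
    contMDiffOn_finsetSum fun i _ ↦ ((hd (hf i) hX).mul (hd (hg i) hY)).sub
      ((hd (hf i) hY).mul (hd (hg i) hX))
  have h2 : ContMDiffOn I 𝓘(ℝ, ℝ) ∞ (fun x ↦ extD α x (X x) (Y x)) W' := by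
    refine h1.congr fun y hy ↦ ?_
    rw [extD_of_eq_sum hW' hy (fun i ↦ mdifferentiableAt_of_contMDiffOn hW' (hf i) hy) hg h]
    simp only [LinearMap.sum_apply, wedge_apply]
  exact ((h2 x hx').contMDiffAt (hW'.mem_nhds hx')).contMDiffWithinAt

end VectorFields

section Surface

variable {M : Type*} [TopologicalSpace M] [ChartedSpace E2 M] [IsManifold 𝓘(ℝ, E2) ∞ M]

theorem contMDiffOn_metric (g : Metric M) {U : Set M} {X Y : ∀ p : M, TangentSpace 𝓘(ℝ, E2) p}
    (hX : ContMDiffOn 𝓘(ℝ, E2) 𝓘(ℝ, E2).tangent ∞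
      (fun p ↦ (⟨p, X p⟩ : TangentBundle 𝓘(ℝ, E2) M)) U)
    (hY : ContMDiffOn 𝓘(ℝ, E2) 𝓘(ℝ, E2).tangent ∞
      (fun p ↦ (⟨p, Y p⟩ : TangentBundle 𝓘(ℝ, E2) M)) U) :
    ContMDiffOn 𝓘(ℝ, E2) 𝓘(ℝ, ℝ) ∞ (fun p ↦ g.inner p (X p) (Y p)) U := by
  intro x hx
  have h := ContMDiffOn.clm_bundle_apply₂ (n := ∞) (F₁ := E2) (F₂ := E2) (F₃ := ℝ)
    (E₁ := fun x : M ↦ TangentSpace 𝓘(ℝ, E2) x) (E₂ := fun x : M ↦ TangentSpace 𝓘(ℝ, E2) x)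
    (E₃ := Bundle.Trivial M ℝ) (b := fun m ↦ m) (v := X) (w := Y) g.contMDiff.contMDiffOn hX hY x hx
  exact (contMDiffWithinAt_totalSpace.1 h).2

namespace OrthonormalFrame

variable {g : Metric M} {U : Set M} (v : OrthonormalFrame g U)

theorem smooth_eta (i : Fin 2) : SmoothOneFormOn (v.eta i) U :=
  ContMDiffOn.clm_bundle_apply (n := ∞) (F₁ := E2) (F₂ := E2 →L[ℝ] ℝ) (IM := 𝓘(ℝ, E2))
    (E₁ := fun x : M ↦ TangentSpace 𝓘(ℝ, E2) x)
    (E₂ := fun x : M ↦ TangentSpace 𝓘(ℝ, E2) x →L[ℝ] Bundle.Trivial M ℝ x)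
    (b := fun m ↦ m) (ϕ := g.inner) (v := v.vec i) g.contMDiff.contMDiffOn (v.smooth i)

theorem smooth_etaConn (hU : IsOpen U) : SmoothOneFormOn v.etaConn U := by
  have h (i) := contMDiffOn_extD_apply hU (v.smooth_eta i) (v.smooth 0) (v.smooth 1)
  exact SmoothOneFormOn.sub (SmoothOneFormOn.smul (ContMDiffOn.neg (h 0)) (v.smooth_eta 0))
    (SmoothOneFormOn.smul (h 1) (v.smooth_eta 1))

theorem contMDiffOn_gaussCurvature (hU : IsOpen U) :
    ContMDiffOn 𝓘(ℝ, E2) 𝓘(ℝ, ℝ) ∞ v.gaussCurvature U :=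
  contMDiffOn_extD_apply hU (v.smooth_etaConn hU) (v.smooth 0) (v.smooth 1)

theorem contMDiffOn_covDeriv (hU : IsOpen U) {u : M → ℝ} (hu : ContMDiffOn 𝓘(ℝ, E2) 𝓘(ℝ, ℝ) ∞ u U)
    (i : Fin 2) : ContMDiffOn 𝓘(ℝ, E2) 𝓘(ℝ, ℝ) ∞ (v.covDeriv u i) U :=
  (smoothOneFormOn_differential hU hu).apply (v.smooth i)

theorem contMDiffOn_covDerivTwo (hU : IsOpen U) {u : M → ℝ}
    (hu : ContMDiffOn 𝓘(ℝ, E2) 𝓘(ℝ, ℝ) ∞ u U) (i j : Fin 2) :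
    ContMDiffOn 𝓘(ℝ, E2) 𝓘(ℝ, ℝ) ∞ (v.covDerivTwo u i j) U := by
  have h (l i j : Fin 2) : ContMDiffOn 𝓘(ℝ, E2) 𝓘(ℝ, ℝ) ∞
      (fun p ↦ v.etaMatrix l i p (v.vec j p)) U := by
    have h0 := (v.smooth_etaConn hU).apply (v.smooth j)
    fin_cases l <;> fin_cases i
    · exact contMDiffOn_const (c := (0 : ℝ))
    · exact h0
    · exact h0.neg
    · exact contMDiffOn_const (c := (0 : ℝ))
  exact (v.contMDiffOn_covDeriv hU (v.contMDiffOn_covDeriv hU hu i) j).sub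
    (contMDiffOn_finsetSum fun l _ ↦ (v.contMDiffOn_covDeriv hU hu l).mul (h l i j))

theorem contMDiffOn_q (hU : IsOpen U) (hK : ∀ p ∈ U, v.gaussCurvature p < 0) :
    ContMDiffOn 𝓘(ℝ, E2) 𝓘(ℝ, ℝ) ∞ v.q U := by
  intro p hp
  have h : ContDiffAt ℝ ∞ (fun t : ℝ ↦ (-t) ^ (-(3 / 4) : ℝ)) (v.gaussCurvature p) :=
    contDiffAt_id.neg.rpow_const_of_ne (by simpa using (hK p hp).ne)
  exact h.contMDiffAt.comp_contMDiffWithinAt p (v.contMDiffOn_gaussCurvature hU p hp)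

variable {v}

theorem eta_vec {p : M} (hp : p ∈ U) (i j : Fin 2) :
    v.eta i p (v.vec j p) = if i = j then 1 else 0 := v.orthonormal p hp i j

theorem eq_sum_vec {p : M} (hp : p ∈ U) (X : TangentSpace 𝓘(ℝ, E2) p) :
    X = v.eta 0 p X • v.vec 0 p + v.eta 1 p X • v.vec 1 p := by
  have li : LinearIndependent ℝ (fun i ↦ v.vec i p) := by
    rw [Fintype.linearIndependent_iff]
    intro c hc i
    have := congrArg (v.eta i p) hc
    fin_cases i <;> simpa [Fin.sum_univ_two, eta_vec hp] using this
  have card : Fintype.card (Fin 2) = Module.finrank ℝ (TangentSpace 𝓘(ℝ, E2) p) := by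
    change _ = Module.finrank ℝ E2
    simp
  have : FiniteDimensional ℝ (TangentSpace 𝓘(ℝ, E2) p) := inferInstanceAs (FiniteDimensional ℝ E2)
  obtain ⟨c, hc⟩ := (Submodule.mem_span_range_iff_exists_fun ℝ).1
    (li.span_eq_top_of_card_eq_finrank' card ▸ Submodule.mem_top (x := X))
  rw [← hc, Fin.sum_univ_two]
  simp [eta_vec hp]

theorem covector_eq {p : M} (hp : p ∈ U) (α : Covector 𝓘(ℝ, E2) p) (X : TangentSpace 𝓘(ℝ, E2) p) :
    α X = α (v.vec 0 p) * v.eta 0 p X + α (v.vec 1 p) * v.eta 1 p X := by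
  conv_lhs => rw [eq_sum_vec (v := v) hp X]
  simp only [map_add, map_smul, smul_eq_mul]
  ring

theorem eq_zero_of_eta {p : M} (hp : p ∈ U) {X : TangentSpace 𝓘(ℝ, E2) p}
    (h0 : v.eta 0 p X = 0) (h1 : v.eta 1 p X = 0) : X = 0 := by
  rw [eq_sum_vec (v := v) hp X, h0, h1, zero_smul, zero_smul, add_zero]

theorem differential_apply {p : M} (hp : p ∈ U) (u : M → ℝ) (X : TangentSpace 𝓘(ℝ, E2) p) :
    differential 𝓘(ℝ, E2) u p X =
      v.covDeriv u 0 p * v.eta 0 p X + v.covDeriv u 1 p * v.eta 1 p X :=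
  covector_eq hp _ X

theorem differential_covDeriv_zero {p : M} (hp : p ∈ U) (u : M → ℝ) (X : TangentSpace 𝓘(ℝ, E2) p) :
    differential 𝓘(ℝ, E2) (v.covDeriv u 0) p X = -v.covDeriv u 1 p * v.etaConn p X +
      (v.covDerivTwo u 0 0 p * v.eta 0 p X + v.covDerivTwo u 0 1 p * v.eta 1 p X) := by
  rw [differential_apply hp, covector_eq (v := v) hp (v.etaConn p)]
  simp [covDerivTwo, etaMatrix]
  ring

theorem differential_covDeriv_one {p : M} (hp : p ∈ U) (u : M → ℝ) (X : TangentSpace 𝓘(ℝ, E2) p) :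
    differential 𝓘(ℝ, E2) (v.covDeriv u 1) p X = v.covDeriv u 0 p * v.etaConn p X +
      (v.covDerivTwo u 1 0 p * v.eta 0 p X + v.covDerivTwo u 1 1 p * v.eta 1 p X) := by
  rw [differential_apply hp, covector_eq (v := v) hp (v.etaConn p)]
  simp [covDerivTwo, etaMatrix]
  ring

/-- The second covariant derivatives of a function are symmetric. -/
theorem covDerivTwo_symm (hU : IsOpen U) {p : M} (hp : p ∈ U) {u : M → ℝ}
    (hu : ContMDiffOn 𝓘(ℝ, E2) 𝓘(ℝ, ℝ) ∞ u U) : v.covDerivTwo u 0 1 p = v.covDerivTwo u 1 0 p := by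
  have h1 := extD_differential hU hu hp
  have h2 : ∀ᶠ y in 𝓝 p, differential 𝓘(ℝ, E2) u y = ∑ i, v.covDeriv u i y • v.eta i y := by
    filter_upwards [hU.mem_nhds hp] with y hy
    ext X
    rw [differential_apply (v := v) hy, Fin.sum_univ_two]
    rfl
  rw [extD_congr h2, extD_sum_smul
    (fun i ↦ mdifferentiableAt_of_contMDiffOn hU (v.contMDiffOn_covDeriv hU hu i) hp)
    fun i ↦ (v.smooth_eta i).differentiableFormAt hU hp] at h1
  obtain ⟨s0, s1, -⟩ := v.structure_equations hp
  rw [Fin.sum_univ_two, s0, s1] at h1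
  have h3 := congrArg (fun τ ↦ τ (v.vec 0 p) (v.vec 1 p)) h1
  simp only [LinearMap.add_apply, LinearMap.smul_apply, LinearMap.neg_apply, wedge_apply,
    LinearMap.zero_apply, smul_eq_mul, differential_covDeriv_zero hp,
    differential_covDeriv_one hp, eta_vec hp] at h3
  simp at h3
  linarith

end OrthonormalFrame

end Surface

/-! ### The coframe of the product of the surface and the frame bundle -/

section Coframe

variable {M : Type*} [TopologicalSpace M] [ChartedSpace E2 M] [IsManifold 𝓘(ℝ, E2) ∞ M]

/-- The model with corners of the product of a surface and the frame bundle. -/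
abbrev modelN : ModelWithCorners ℝ (E2 × (E3 × E3)) (ModelProd E2 (ModelProd E3 E3)) :=
  𝓘(ℝ, E2).prod modelF3

namespace OrthonormalFrame

variable {g : Metric M} {U : Set M} (v : OrthonormalFrame g U)

/-- The domain `U × F3` of the isometric embedding system. -/
abbrev domain (_v : OrthonormalFrame g U) : Set (M × F3) := U ×ˢ univ

theorem isOpen_domain (hU : IsOpen U) : IsOpen v.domain := hU.prod isOpen_univ

/-- The coframe `θ₀, θ₁, θ₂, θ₃, ω³₁, ω³₂, η¹, η²` of `U × F3`. -/
def coframe : Fin 8 → OneForm modelN (M × F3) :=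
  ![v.theta 0, v.theta 1, v.theta 2, v.theta 3, pullback Prod.snd (omegaConn 2 0),
    pullback Prod.snd (omegaConn 2 1), pullback Prod.fst (v.eta 0), pullback Prod.fst (v.eta 1)]

/-- The pullback of the connection form of the frame field `v`. -/
def etaConnN : OneForm modelN (M × F3) := pullback Prod.fst v.etaConn

theorem contMDiff_fst_N : ContMDiff modelN 𝓘(ℝ, E2) ∞ (Prod.fst : M × F3 → M) := contMDiff_fst

theorem contMDiff_snd_N : ContMDiff modelN modelF3 ∞ (Prod.snd : M × F3 → F3) := contMDiff_snd

theorem smooth_pullback_fst (hU : IsOpen U) {α : OneForm 𝓘(ℝ, E2) M} (hα : SmoothOneFormOn α U) :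
    SmoothOneFormOn (pullback Prod.fst α : OneForm modelN (M × F3)) v.domain :=
  (hα.pullback contMDiff_fst_N hU).mono fun _ hx ↦ hx.1

theorem smooth_pullback_snd {α : OneForm modelF3 F3} (hα : SmoothOneFormOn α univ) :
    SmoothOneFormOn (pullback Prod.snd α : OneForm modelN (M × F3)) v.domain :=
  (hα.pullback contMDiff_snd_N isOpen_univ).mono fun _ _ ↦ mem_univ _

theorem smooth_coframe (hU : IsOpen U) (k : Fin 8) : SmoothOneFormOn (v.coframe k) v.domain := by
  have ho (i) := v.smooth_pullback_snd (smoothOneFormOn_omega i)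
  have hc (i j) := v.smooth_pullback_snd (smoothOneFormOn_omegaConn i j)
  have he (i) := v.smooth_pullback_fst hU (v.smooth_eta i)
  have hn := v.smooth_pullback_fst hU (v.smooth_etaConn hU)
  fin_cases k
  · exact ho 2
  · exact (ho 0).sub (he 0)
  · exact (ho 1).sub (he 1)
  · exact (hc 0 1).sub hn
  · exact hc 2 0
  · exact hc 2 1
  · exact he 0
  · exact he 1

variable {v}

theorem extD_pullback_snd {α : OneForm modelF3 F3} (hα : SmoothOneFormOn α univ) (x : M × F3)
    (X Y : TangentSpace modelN x) :
    extD (pullback Prod.snd α : OneForm modelN (M × F3)) x X Y =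
      extD α x.2 (mfderiv modelN modelF3 Prod.snd x X) (mfderiv modelN modelF3 Prod.snd x Y) :=
  extD_pullback contMDiff_snd_N isOpen_univ hα (mem_univ _) X Y

theorem extD_pullback_fst (hU : IsOpen U) {α : OneForm 𝓘(ℝ, E2) M} (hα : SmoothOneFormOn α U)
    {x : M × F3} (hx : x.1 ∈ U) (X Y : TangentSpace modelN x) :
    extD (pullback Prod.fst α : OneForm modelN (M × F3)) x X Y =
      extD α x.1 (mfderiv modelN 𝓘(ℝ, E2) Prod.fst x X)
        (mfderiv modelN 𝓘(ℝ, E2) Prod.fst x Y) :=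
  extD_pullback contMDiff_fst_N hU hα hx X Y

/-- The exterior derivatives of the members of the coframe, evaluated on two vectors with
coordinates `ξ`, `ζ`, on which the connection form takes the values `h`, `k`; `K` is the Gauss
curvature. -/
def structureFunction (K : ℝ) (ξ ζ : Fin 8 → ℝ) (h k : ℝ) : Fin 8 → ℝ :=
  ![-(ξ 4 * (ζ 1 + ζ 6) - ζ 4 * (ξ 1 + ξ 6)) - (ξ 5 * (ζ 2 + ζ 7) - ζ 5 * (ξ 2 + ξ 7)),
    -((ξ 3 + h) * (ζ 2 + ζ 7) - (ζ 3 + k) * (ξ 2 + ξ 7)) + (ξ 4 * ζ 0 - ζ 4 * ξ 0)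
      + (h * ζ 7 - k * ξ 7),
    ((ξ 3 + h) * (ζ 1 + ζ 6) - (ζ 3 + k) * (ξ 1 + ξ 6)) + (ξ 5 * ζ 0 - ζ 5 * ξ 0)
      - (h * ζ 6 - k * ξ 6),
    (ξ 4 * ζ 5 - ζ 4 * ξ 5) - K * (ξ 6 * ζ 7 - ζ 6 * ξ 7),
    ξ 5 * (ζ 3 + k) - ζ 5 * (ξ 3 + h),
    -(ξ 4 * (ζ 3 + k) - ζ 4 * (ξ 3 + h)),
    -(h * ζ 7 - k * ξ 7),
    h * ζ 6 - k * ξ 6]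

/-- The structure equations of the coframe. -/
theorem extD_coframe (hU : IsOpen U) {x : M × F3} (hx : x ∈ v.domain) (i : Fin 8)
    (X Y : TangentSpace modelN x) :
    extD (v.coframe i) x X Y = structureFunction (v.gaussCurvature x.1)
      (fun k ↦ v.coframe k x X) (fun k ↦ v.coframe k x Y) (v.etaConnN x X) (v.etaConnN x Y) i := by
  have hx1 : x.1 ∈ U := hx.1
  have hD := v.isOpen_domain hU
  have ho (i) := (v.smooth_pullback_snd (smoothOneFormOn_omega i)).differentiableFormAt hD hx
  have hc (i j) := (v.smooth_pullback_snd (smoothOneFormOn_omegaConn i j)).differentiableFormAt hD hx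
  have he (i) := (v.smooth_pullback_fst hU (v.smooth_eta i)).differentiableFormAt hD hx
  have hn := (v.smooth_pullback_fst hU (v.smooth_etaConn hU)).differentiableFormAt hD hx
  obtain ⟨s0, s1, s2⟩ := v.structure_equations hx1
  have eo (i : Fin 3) (Z : TangentSpace modelN x) :
      omega i x.2 (mfderiv modelN modelF3 Prod.snd x Z) =
        ![v.coframe 1 x Z + v.coframe 6 x Z, v.coframe 2 x Z + v.coframe 7 x Z,
          v.coframe 0 x Z] i := by
    fin_cases i
    · exact (sub_add_cancel _ _).symm
    · exact (sub_add_cancel _ _).symm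
    · rfl
  have e01 (Z : TangentSpace modelN x) :
      omegaConn 0 1 x.2 (mfderiv modelN modelF3 Prod.snd x Z) =
        v.coframe 3 x Z + v.etaConnN x Z := (sub_add_cancel _ _).symm
  have e20 (Z : TangentSpace modelN x) :
      omegaConn 2 0 x.2 (mfderiv modelN modelF3 Prod.snd x Z) = v.coframe 4 x Z := rfl
  have e21 (Z : TangentSpace modelN x) :
      omegaConn 2 1 x.2 (mfderiv modelN modelF3 Prod.snd x Z) = v.coframe 5 x Z := rfl
  have e10 (Z : TangentSpace modelN x) := omegaConn_antisymm 1 0 x.2 (mfderiv modelN modelF3 Prod.snd x Z)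
  have e02 (Z : TangentSpace modelN x) := omegaConn_antisymm 0 2 x.2 (mfderiv modelN modelF3 Prod.snd x Z)
  have e12 (Z : TangentSpace modelN x) := omegaConn_antisymm 1 2 x.2 (mfderiv modelN modelF3 Prod.snd x Z)
  have eii (i : Fin 3) (Z : TangentSpace modelN x) :
      omegaConn i i x.2 (mfderiv modelN modelF3 Prod.snd x Z) = 0 := by
    have := omegaConn_antisymm i i x.2 (mfderiv modelN modelF3 Prod.snd x Z)
    linarith
  simp only [e01, e20, e21] at e10 e02 e12
  have do_ (i : Fin 3) := extD_pullback_snd (smoothOneFormOn_omega i) x X Y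
  have dc (i j : Fin 3) := extD_pullback_snd (smoothOneFormOn_omegaConn i j) x X Y
  have de (i : Fin 2) := extD_pullback_fst hU (v.smooth_eta i) hx1 X Y
  have dn := extD_pullback_fst hU (v.smooth_etaConn hU) hx1 X Y
  have de0 : extD (pullback Prod.fst (v.eta 0) : OneForm modelN (M × F3)) x X Y =
      -(v.etaConnN x X * v.coframe 7 x Y - v.etaConnN x Y * v.coframe 7 x X) := by
    rw [de, s0]; rfl
  have de1 : extD (pullback Prod.fst (v.eta 1) : OneForm modelN (M × F3)) x X Y =
      v.etaConnN x X * v.coframe 6 x Y - v.etaConnN x Y * v.coframe 6 x X := by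
    rw [de, s1]; rfl
  have dn' : extD (pullback Prod.fst v.etaConn : OneForm modelN (M × F3)) x X Y =
      v.gaussCurvature x.1 * (v.coframe 6 x X * v.coframe 7 x Y - v.coframe 6 x Y * v.coframe 7 x X) := by
    rw [dn, s2]; rfl
  simp only [extD_omega, extD_omegaConn, Fin.sum_univ_three, eo] at do_ dc
  fin_cases i
  · refine (do_ 2).trans ?_
    simp [-mfderiv_snd, structureFunction, e02, e12, eii]
    ring
  · refine (extD_sub (ho 0) (he 0) X Y).trans ?_
    rw [do_, de0]
    simp [-mfderiv_snd, structureFunction, e10, e20, eii]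
    ring
  · refine (extD_sub (ho 1) (he 1) X Y).trans ?_
    rw [do_, de1]
    simp [-mfderiv_snd, structureFunction, e01, e21, eii]
  · refine (extD_sub (hc 0 1) hn X Y).trans ?_
    rw [dc, dn']
    simp [-mfderiv_snd, structureFunction, eii, e01, e20, e21, e10]
  · refine (dc 2 0).trans ?_
    simp [-mfderiv_snd, structureFunction, e02, e12, e10, eii]
    ring
  · refine (dc 2 1).trans ?_
    simp [-mfderiv_snd, structureFunction, e02, e12, e01, eii]
    ring
  · exact de0
  · exact de1

theorem eq_zero_of_coframe {x : M × F3} (hx : x ∈ v.domain) {X : TangentSpace modelN x}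
    (h : ∀ k, v.coframe k x X = 0) : X = 0 := by
  have hx1 : x.1 ∈ U := hx.1
  have h1 : mfderiv modelN 𝓘(ℝ, E2) Prod.fst x X = 0 := eq_zero_of_eta (v := v) hx1 (h 6) (h 7)
  have hn : v.etaConnN x X = 0 := by
    have : v.etaConnN x X = v.etaConn x.1 (mfderiv modelN 𝓘(ℝ, E2) Prod.fst x X) := rfl
    rw [this, h1, map_zero]
  have h2 : mfderiv modelN modelF3 Prod.snd x X = 0 := by
    have e01 : omegaConn 0 1 x.2 (mfderiv modelN modelF3 Prod.snd x X) = 0 := by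
      have : omegaConn 0 1 x.2 (mfderiv modelN modelF3 Prod.snd x X) =
        v.coframe 3 x X + v.etaConnN x X := (sub_add_cancel _ _).symm
      rw [this, h, hn, add_zero]
    have e20 : omegaConn 2 0 x.2 (mfderiv modelN modelF3 Prod.snd x X) = 0 := h 4
    have e21 : omegaConn 2 1 x.2 (mfderiv modelN modelF3 Prod.snd x X) = 0 := h 5
    have ha (i j) := omegaConn_antisymm i j x.2 (mfderiv modelN modelF3 Prod.snd x X)
    refine eq_zero_of_omega x.2 _ (fun i ↦ ?_) fun i j ↦ ?_
    · fin_cases i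
      · have : omega 0 x.2 (mfderiv modelN modelF3 Prod.snd x X) =
          v.coframe 1 x X + v.coframe 6 x X := (sub_add_cancel _ _).symm
        exact this.trans (by rw [h, h, add_zero])
      · have : omega 1 x.2 (mfderiv modelN modelF3 Prod.snd x X) =
          v.coframe 2 x X + v.coframe 7 x X := (sub_add_cancel _ _).symm
        exact this.trans (by rw [h, h, add_zero])
      · exact h 0
    · fin_cases i <;> fin_cases j
      · have := ha 0 0; simp only [Fin.zero_eta]; linarith
      · exact e01
      · exact (ha 0 2).trans (by rw [e20, neg_zero])
      · exact (ha 1 0).trans (by rw [e01, neg_zero])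
      · have := ha 1 1; simp only [Fin.mk_one]; linarith
      · exact (ha 1 2).trans (by rw [e21, neg_zero])
      · exact e20
      · exact e21
      · have := ha 2 2; simp only [Fin.reduceFinMk]; linarith
  rw [mfderiv_fst] at h1
  rw [mfderiv_snd] at h2
  exact Prod.ext h1 h2

/-- There is a tangent vector with any prescribed values of the members of the coframe. -/
theorem exists_vector {x : M × F3} (hx : x ∈ v.domain) (ξ : Fin 8 → ℝ) :
    ∃ X : TangentSpace modelN x, ∀ k, v.coframe k x X = ξ k := by
  let L : TangentSpace modelN x →ₗ[ℝ] (Fin 8 → ℝ) := LinearMap.pi fun k ↦ (v.coframe k x).toLinearMap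
  have hinj : Function.Injective L := by
    rw [← LinearMap.ker_eq_bot, LinearMap.ker_eq_bot']
    exact fun X hX ↦ eq_zero_of_coframe hx fun k ↦ congrFun hX k
  have hfin : Module.finrank ℝ (TangentSpace modelN x) = Module.finrank ℝ (Fin 8 → ℝ) := by
    change Module.finrank ℝ (E2 × (E3 × E3)) = _
    simp
  have : FiniteDimensional ℝ (TangentSpace modelN x) :=
    inferInstanceAs (FiniteDimensional ℝ (E2 × (E3 × E3)))
  obtain ⟨X, hX⟩ := (LinearMap.injective_iff_surjective_of_finrank_eq_finrank hfin).1 hinj ξ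
  exact ⟨X, fun k ↦ congrFun hX k⟩

end OrthonormalFrame

end Coframe

/-! ### Annihilators of spaces of covectors -/

section Annihilators

variable {E : Type*} [NormedAddCommGroup E] [NormedSpace ℝ E]
  {H : Type*} [TopologicalSpace H] {I : ModelWithCorners ℝ E H}
  {N : Type*} [TopologicalSpace N] [ChartedSpace H N]
  {ι : Type*} [Fintype ι] [DecidableEq ι]

theorem apply_eq_zero_of_mem_idealTwo {x : N} {V : Submodule ℝ (Covector I x)}
    {τ : Bicovector I x} (hτ : τ ∈ idealTwo V) {X Y : TangentSpace I x} (hX : ∀ a ∈ V, a X = 0)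
    (hY : ∀ a ∈ V, a Y = 0) : τ X Y = 0 := by
  induction hτ using Submodule.span_induction with
  | mem τ h =>
    obtain ⟨a, ha, b, rfl⟩ := h
    rw [wedge_apply, hX a ha, hY a ha]
    ring
  | zero => rfl
  | add τ τ' _ _ h h' => rw [LinearMap.add_apply, LinearMap.add_apply, h, h', add_zero]
  | smul c τ _ h => rw [LinearMap.smul_apply, LinearMap.smul_apply, h, smul_zero]

theorem eq_zero_of_mem_span_range {x : N} {lam : ι → Covector I x} {X : TangentSpace I x}
    (h : ∀ i, lam i X = 0) : ∀ a ∈ Submodule.span ℝ (range lam), a X = 0 := by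
  intro a ha
  obtain ⟨c, rfl⟩ := (Submodule.mem_span_range_iff_exists_fun ℝ).1 ha
  rw [_root_.sum_apply]
  exact Finset.sum_eq_zero fun i _ ↦ by
    rw [_root_.smul_apply, h, smul_zero]

theorem exists_dual_vectors {x : N} {lam : ι → Covector I x} (h : LinearIndependent ℝ lam) :
    ∃ e : ι → TangentSpace I x, ∀ i j, lam i (e j) = if i = j then 1 else 0 := by
  have key (j : ι) : ∃ X : TangentSpace I x, ∀ i, lam i X = if i = j then 1 else 0 := by
    by_contra! hc
    have h1 : ((lam j : Covector I x) : TangentSpace I x →ₗ[ℝ] ℝ) ∈ Submodule.span ℝ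
        (range fun i : {i // i ≠ j} ↦ (lam i : TangentSpace I x →ₗ[ℝ] ℝ)) := by
      refine mem_span_of_iInf_ker_le_ker fun X hX ↦ ?_
      rw [Submodule.mem_iInf] at hX
      by_contra h0
      rw [LinearMap.mem_ker] at h0
      obtain ⟨i, hi⟩ := hc ((lam j X)⁻¹ • X)
      apply hi
      rw [map_smul, smul_eq_mul]
      by_cases hij : i = j
      · subst hij
        rw [if_pos rfl]
        exact inv_mul_cancel₀ h0
      · rw [if_neg hij]
        have : lam i X = 0 := hX ⟨i, hij⟩
        rw [this, mul_zero]
    obtain ⟨c, hc⟩ := (Submodule.mem_span_range_iff_exists_fun ℝ).1 h1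
    refine (linearIndependent_iff_notMem_span.1 h) j ?_
    have h2 : lam j = ∑ i : {i // i ≠ j}, c i • lam i := by
      ext X
      have := LinearMap.congr_fun hc X
      rw [_root_.sum_apply]
      simpa using! this.symm
    rw [h2]
    refine Submodule.sum_mem _ fun i _ ↦ Submodule.smul_mem _ _ (Submodule.subset_span ?_)
    exact ⟨i, ⟨mem_univ _, i.2⟩, rfl⟩
  choose e he using key
  exact ⟨e, fun i j ↦ he j i⟩

/-- An alternating form which vanishes on the annihilator of the covectors `lam i` lies in the
ideal generated by them. -/
theorem mem_idealTwo_of_forall [FiniteDimensional ℝ E] {x : N} {lam : ι → Covector I x}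
    (hli : LinearIndependent ℝ lam)
    {τ : Bicovector I x} (halt : ∀ X, τ X X = 0)
    (h : ∀ X Y : TangentSpace I x, (∀ i, lam i X = 0) → (∀ i, lam i Y = 0) → τ X Y = 0) :
    τ ∈ idealTwo (Submodule.span ℝ (range lam)) := by
  obtain ⟨e, he⟩ := exists_dual_vectors hli
  have anti : ∀ X Y, τ Y X = -τ X Y := fun X Y ↦ by
    have := halt (X + Y)
    simp only [map_add, LinearMap.add_apply, halt] at this
    linarith
  let β (i : ι) : Covector I x := (LinearMap.toContinuousLinearMap (E := E) (τ (e i)) : E →L[ℝ] ℝ)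
  have hβ (i) (X : TangentSpace I x) : β i X = τ (e i) X := rfl
  -- The contraction of `τ` with `e i` contains each term in `lam i ∧ lam j` twice, once for `i` and
  -- once for `j`; hence the factor `1 / 2`.
  have hτ : τ = ∑ i, wedge (lam i) (β i - (1 / 2 : ℝ) • ∑ j, τ (e i) (e j) • lam j) := by
    ext X Y
    have hp (X : TangentSpace I x) (i : ι) : lam i (X - ∑ j, lam j X • e j) = 0 := by
      rw [map_sub, map_sum]
      simp [he]
    have h1 := h _ _ (hp X) (hp Y)
    simp only [map_sub, LinearMap.sub_apply, map_sum, LinearMap.sum_apply, map_smul,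
      LinearMap.smul_apply, smul_eq_mul] at h1
    have h2 : ∀ i, (β i - (1 / 2 : ℝ) • ∑ j, τ (e i) (e j) • lam j) Y =
        τ (e i) Y - 1 / 2 * ∑ j, τ (e i) (e j) * lam j Y := by
      intro i
      refine congrArg₂ (· - ·) (hβ i Y) ?_
      simp
    have h2' : ∀ i, (β i - (1 / 2 : ℝ) • ∑ j, τ (e i) (e j) • lam j) X =
        τ (e i) X - 1 / 2 * ∑ j, τ (e i) (e j) * lam j X := by
      intro i
      refine congrArg₂ (· - ·) (hβ i X) ?_
      simp
    rw [LinearMap.sum_apply, LinearMap.sum_apply]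
    simp only [wedge_apply, h2, h2']
    have h3 : ∑ i, lam i Y * ∑ j, τ (e i) (e j) * lam j X =
        -∑ i, lam i X * ∑ j, τ (e i) (e j) * lam j Y := by
      simp only [Finset.mul_sum]
      rw [Finset.sum_comm, ← Finset.sum_neg_distrib]
      refine Finset.sum_congr rfl fun i _ ↦ ?_
      rw [← Finset.sum_neg_distrib]
      refine Finset.sum_congr rfl fun j _ ↦ ?_
      rw [anti (e i) (e j)]
      ring
    have h4 : ∑ i, lam i Y * τ X (e i) = -∑ i, lam i Y * τ (e i) X := by
      rw [← Finset.sum_neg_distrib]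
      exact Finset.sum_congr rfl fun i _ ↦ by rw [anti (e i) X]; ring
    have h5 : ∑ i, lam i Y * ∑ j, lam j X * τ (e j) (e i) =
        ∑ i, lam i X * ∑ j, τ (e i) (e j) * lam j Y := by
      simp only [Finset.mul_sum]
      rw [Finset.sum_comm]
      exact Finset.sum_congr rfl fun i _ ↦ Finset.sum_congr rfl fun j _ ↦ by ring
    simp only [mul_sub, Finset.sum_sub_distrib, ← mul_assoc, mul_comm _ (1 / 2 : ℝ)] at h1 h3 h4 h5 ⊢
    simp only [mul_assoc, ← Finset.mul_sum] at h1 h3 h4 h5 ⊢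
    linarith
  rw [hτ]
  exact Submodule.sum_mem _ fun i _ ↦ wedge_mem_idealTwo_left
    (Submodule.subset_span (mem_range_self i)) _

end Annihilators

/-! ### Combinations of the coframe with coefficients on the surface -/

section Combinations

variable {M : Type*} [TopologicalSpace M] [ChartedSpace E2 M] [IsManifold 𝓘(ℝ, E2) ∞ M]

namespace OrthonormalFrame

variable {g : Metric M} {U : Set M} (v : OrthonormalFrame g U)

/-- The combination of the members of the coframe with coefficients which are functions on `U`. -/
def comb (c : Fin 8 → M → ℝ) : OneForm modelN (M × F3) := fun x ↦ ∑ k, c k x.1 • v.coframe k x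

theorem smooth_comb (hU : IsOpen U) {c : Fin 8 → M → ℝ}
    (hc : ∀ k, ContMDiffOn 𝓘(ℝ, E2) 𝓘(ℝ, ℝ) ∞ (c k) U) : SmoothOneFormOn (v.comb c) v.domain :=
  SmoothOneFormOn.sum fun k ↦ (v.smooth_coframe hU k).smul
    ((hc k).comp (contMDiff_fst_N.contMDiffOn (s := v.domain)) fun _ hx ↦ hx.1)

variable {v}

theorem comb_apply (c : Fin 8 → M → ℝ) (x : M × F3) (X : TangentSpace modelN x) :
    v.comb c x X = ∑ k, c k x.1 * v.coframe k x X := by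
  rw [comb, _root_.sum_apply]
  rfl

/-- The value on two vectors with coordinates `ξ`, `ζ` of the exterior derivative of a combination
with coefficients `c`, whose derivatives in the directions of the frame are `c'`; the numbers `n`
are the components of the connection form and `K` is the Gauss curvature. -/
def combDeriv (K : ℝ) (n : Fin 2 → ℝ) (c : Fin 8 → ℝ) (c' : Fin 8 → Fin 2 → ℝ) (ξ ζ : Fin 8 → ℝ) :
    ℝ :=
  ∑ k, ((c' k 0 * ξ 6 + c' k 1 * ξ 7) * ζ k - (c' k 0 * ζ 6 + c' k 1 * ζ 7) * ξ k +
    c k * structureFunction K ξ ζ (n 0 * ξ 6 + n 1 * ξ 7) (n 0 * ζ 6 + n 1 * ζ 7) k)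

theorem extD_comb (hU : IsOpen U) {c : Fin 8 → M → ℝ}
    (hc : ∀ k, ContMDiffOn 𝓘(ℝ, E2) 𝓘(ℝ, ℝ) ∞ (c k) U) {x : M × F3} (hx : x ∈ v.domain)
    (X Y : TangentSpace modelN x) :
    extD (v.comb c) x X Y = combDeriv (v.gaussCurvature x.1)
      (fun i ↦ v.etaConn x.1 (v.vec i x.1)) (fun k ↦ c k x.1) (fun k i ↦ v.covDeriv (c k) i x.1)
      (fun k ↦ v.coframe k x X) (fun k ↦ v.coframe k x Y) := by
  have hx1 : x.1 ∈ U := hx.1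
  have hm (k) := mdifferentiableAt_of_contMDiffOn hU (hc k) hx1
  have hf : MDifferentiableAt modelN 𝓘(ℝ, E2) (Prod.fst : M × F3 → M) x :=
    contMDiff_fst_N.mdifferentiableAt (by simp)
  have hm' (k) : MDifferentiableAt modelN 𝓘(ℝ, ℝ) (fun y : M × F3 ↦ c k y.1) x :=
    (hm k).comp x hf
  have h1 : extD (v.comb c) x = _ := extD_sum_smul hm' fun k ↦
    (v.smooth_coframe hU k).differentiableFormAt (v.isOpen_domain hU) hx
  have hn (Z : TangentSpace modelN x) : v.etaConnN x Z =
      v.etaConn x.1 (v.vec 0 x.1) * v.coframe 6 x Z +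
        v.etaConn x.1 (v.vec 1 x.1) * v.coframe 7 x Z :=
    covector_eq (v := v) hx1 (v.etaConn x.1) (mfderiv modelN 𝓘(ℝ, E2) Prod.fst x Z)
  have hd (k) (Z : TangentSpace modelN x) : differential modelN (fun y : M × F3 ↦ c k y.1) x Z =
      v.covDeriv (c k) 0 x.1 * v.coframe 6 x Z + v.covDeriv (c k) 1 x.1 * v.coframe 7 x Z := by
    have h2 : differential modelN (fun y : M × F3 ↦ c k y.1) x Z =
        differential 𝓘(ℝ, E2) (c k) x.1 (mfderiv modelN 𝓘(ℝ, E2) Prod.fst x Z) := by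
      have := mfderiv_comp (I := modelN) (I' := 𝓘(ℝ, E2)) (I'' := 𝓘(ℝ, ℝ)) x (hm k) hf
      exact DFunLike.congr_fun this Z
    rw [h2]
    exact differential_apply (v := v) hx1 (c k) _
  rw [h1, LinearMap.sum_apply, LinearMap.sum_apply, combDeriv]
  refine Finset.sum_congr rfl fun k _ ↦ ?_
  rw [LinearMap.add_apply, LinearMap.add_apply, LinearMap.smul_apply, LinearMap.smul_apply,
    wedge_apply, hd, hd, extD_coframe hU hx, hn, hn, smul_eq_mul]

theorem linearIndependent_coframe {x : M × F3} (hx : x ∈ v.domain) :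
    LinearIndependent ℝ fun k ↦ v.coframe k x := by
  rw [Fintype.linearIndependent_iff]
  intro c hc i
  obtain ⟨X, hX⟩ := exists_vector hx (Pi.single i 1)
  have h := DFunLike.congr_fun hc X
  rw [_root_.sum_apply] at h
  simpa [hX, Pi.single_apply] using! h

theorem span_coframe {x : M × F3} (hx : x ∈ v.domain) (a : Covector modelN x) :
    ∃ c : Fin 8 → ℝ, ∀ X, a X = ∑ k, c k * v.coframe k x X := by
  choose e he using fun i ↦ exists_vector hx (Pi.single i 1)
  refine ⟨fun k ↦ a (e k), fun X ↦ ?_⟩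
  have : X = ∑ k, v.coframe k x X • e k := by
    refine sub_eq_zero.1 (eq_zero_of_coframe hx fun k ↦ ?_)
    rw [map_sub, map_sum]
    simp [he, Pi.single_apply]
  conv_lhs => rw [this]
  rw [map_sum]
  simp [mul_comm]

end OrthonormalFrame

end Combinations

/-! ### The derived flag of a characteristic system -/

section Adapted

variable {M : Type*} [TopologicalSpace M] [ChartedSpace E2 M] [IsManifold 𝓘(ℝ, E2) ∞ M]

namespace OrthonormalFrame

variable {g : Metric M} {U : Set M} {v : OrthonormalFrame g U}

/-- A smooth square root `s` of `-K`, with the components `a` of `ds / (2s)` and the functions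
`c = (c₁₁, c₁₂, c₂₂)` by which the covariant derivatives of `a` are
`aᵢⱼ = s² δᵢⱼ + aᵢ aⱼ - 2 s cᵢⱼ`. -/
structure RootData (v : OrthonormalFrame g U) where
  /-- The square root of `-K`. -/
  s : M → ℝ
  /-- The components of `ds / (2s)`. -/
  a : Fin 2 → M → ℝ
  /-- The components of the symmetric tensor `c`. -/
  c : Fin 3 → M → ℝ
  smooth_s : ContMDiffOn 𝓘(ℝ, E2) 𝓘(ℝ, ℝ) ∞ s U
  smooth_a : ∀ i, ContMDiffOn 𝓘(ℝ, E2) 𝓘(ℝ, ℝ) ∞ (a i) U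
  smooth_c : ∀ i, ContMDiffOn 𝓘(ℝ, E2) 𝓘(ℝ, ℝ) ∞ (c i) U
  s_ne_zero : ∀ p ∈ U, s p ≠ 0
  gaussCurvature_eq : ∀ p ∈ U, v.gaussCurvature p = -s p ^ 2
  covDeriv_s : ∀ p ∈ U, ∀ i, v.covDeriv s i p = 2 * s p * a i p
  covDeriv_a_zero_zero : ∀ p ∈ U, v.covDeriv (a 0) 0 p =
    -a 1 p * v.etaConn p (v.vec 0 p) + (s p ^ 2 + a 0 p ^ 2 - 2 * s p * c 0 p)
  covDeriv_a_zero_one : ∀ p ∈ U, v.covDeriv (a 0) 1 p =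
    -a 1 p * v.etaConn p (v.vec 1 p) + (a 0 p * a 1 p - 2 * s p * c 1 p)
  covDeriv_a_one_zero : ∀ p ∈ U, v.covDeriv (a 1) 0 p =
    a 0 p * v.etaConn p (v.vec 0 p) + (a 0 p * a 1 p - 2 * s p * c 1 p)
  covDeriv_a_one_one : ∀ p ∈ U, v.covDeriv (a 1) 1 p =
    a 0 p * v.etaConn p (v.vec 1 p) + (s p ^ 2 + a 1 p ^ 2 - 2 * s p * c 2 p)

theorem covDeriv_neg (u : M → ℝ) (i : Fin 2) (p : M) :
    v.covDeriv (-u) i p = -v.covDeriv u i p := by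
  rw [covDeriv, mfderiv_neg]
  rfl

@[simp]
theorem covDeriv_zero (i : Fin 2) (p : M) : v.covDeriv 0 i p = 0 := by
  have : mfderiv 𝓘(ℝ, E2) 𝓘(ℝ, ℝ) (0 : M → ℝ) p = 0 := mfderiv_const
  rw [covDeriv, this]
  rfl

@[simp]
theorem covDeriv_one (i : Fin 2) (p : M) : v.covDeriv 1 i p = 0 := by
  have : mfderiv 𝓘(ℝ, E2) 𝓘(ℝ, ℝ) (1 : M → ℝ) p = 0 := mfderiv_const
  rw [covDeriv, this]
  rfl

theorem covDeriv_mul {u w : M → ℝ} {p : M} (hu : MDifferentiableAt 𝓘(ℝ, E2) 𝓘(ℝ, ℝ) u p)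
    (hw : MDifferentiableAt 𝓘(ℝ, E2) 𝓘(ℝ, ℝ) w p) (i : Fin 2) :
    v.covDeriv (u * w) i p = u p * v.covDeriv w i p + w p * v.covDeriv u i p := by
  have := DFunLike.congr_fun (differential_mul hu hw) (v.vec i p)
  exact this

namespace RootData

variable (D : RootData v)

/-- The data of the square root `-s`. -/
def neg : RootData v where
  s := -D.s
  a := D.a
  c i := -D.c i
  smooth_s := D.smooth_s.neg
  smooth_a := D.smooth_a
  smooth_c i := (D.smooth_c i).neg
  s_ne_zero p hp := neg_ne_zero.2 (D.s_ne_zero p hp)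
  gaussCurvature_eq p hp := by rw [D.gaussCurvature_eq p hp, Pi.neg_apply, neg_sq]
  covDeriv_s p hp i := by rw [covDeriv_neg, D.covDeriv_s p hp, Pi.neg_apply]; ring
  covDeriv_a_zero_zero p hp := by
    rw [D.covDeriv_a_zero_zero p hp, Pi.neg_apply, Pi.neg_apply]; ring
  covDeriv_a_zero_one p hp := by
    rw [D.covDeriv_a_zero_one p hp, Pi.neg_apply, Pi.neg_apply]; ring
  covDeriv_a_one_zero p hp := by
    rw [D.covDeriv_a_one_zero p hp, Pi.neg_apply, Pi.neg_apply]; ring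
  covDeriv_a_one_one p hp := by
    rw [D.covDeriv_a_one_one p hp, Pi.neg_apply, Pi.neg_apply]; ring

/-- The coefficients of `θ₀, θ₁, θ₂, θ₃, ω³₁ - s η², ω³₂ + s η¹`, which span a characteristic
system. -/
def charCoeff : Fin 6 → Fin 8 → M → ℝ :=
  ![![1, 0, 0, 0, 0, 0, 0, 0], ![0, 1, 0, 0, 0, 0, 0, 0], ![0, 0, 1, 0, 0, 0, 0, 0],
    ![0, 0, 0, 1, 0, 0, 0, 0], ![0, 0, 0, 0, 1, 0, 0, -D.s], ![0, 0, 0, 0, 0, 1, D.s, 0]]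

/-- The coefficients of the forms `ζ₀, ζ₁, ζ₂`, which span the second derived system. -/
def zetaCoeff : Fin 3 → Fin 8 → M → ℝ :=
  ![![-D.s, D.a 1, -D.a 0, 1, 0, 0, 0, 0], ![D.a 0, D.c 1, -D.c 0, 0, 1, 0, 0, -D.s],
    ![D.a 1, D.c 2, -D.c 1, 0, 0, 1, D.s, 0]]

/-- The coefficients of the forms `ζ₀, ζ₁, ζ₂, θ₁, θ₂`, which span the first derived system. -/
def derCoeff : Fin 5 → Fin 8 → M → ℝ :=
  ![D.zetaCoeff 0, D.zetaCoeff 1, D.zetaCoeff 2, ![0, 1, 0, 0, 0, 0, 0, 0],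
    ![0, 0, 1, 0, 0, 0, 0, 0]]

/-- The coefficients of the forms `s (ω³₁ - s η²) + a₁ θ₃` and `s (ω³₂ + s η¹) + a₂ θ₃`, which
span a completely integrable subsystem of a characteristic system when `s c = -a aᵀ`. -/
def lamCoeff : Fin 2 → Fin 8 → M → ℝ :=
  ![![0, 0, 0, D.a 0, D.s, 0, 0, -(D.s * D.s)], ![0, 0, 0, D.a 1, 0, D.s, D.s * D.s, 0]]

theorem smooth_charCoeff (i k) : ContMDiffOn 𝓘(ℝ, E2) 𝓘(ℝ, ℝ) ∞ (D.charCoeff i k) U := by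
  have h0 : ContMDiffOn 𝓘(ℝ, E2) 𝓘(ℝ, ℝ) ∞ (0 : M → ℝ) U := contMDiffOn_const
  have h1 : ContMDiffOn 𝓘(ℝ, E2) 𝓘(ℝ, ℝ) ∞ (1 : M → ℝ) U := contMDiffOn_const
  have hs := D.smooth_s
  have hs' := D.smooth_s.neg
  fin_cases i <;> fin_cases k <;> assumption

theorem smooth_zetaCoeff (i k) : ContMDiffOn 𝓘(ℝ, E2) 𝓘(ℝ, ℝ) ∞ (D.zetaCoeff i k) U := by
  have h0 : ContMDiffOn 𝓘(ℝ, E2) 𝓘(ℝ, ℝ) ∞ (0 : M → ℝ) U := contMDiffOn_const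
  have h1 : ContMDiffOn 𝓘(ℝ, E2) 𝓘(ℝ, ℝ) ∞ (1 : M → ℝ) U := contMDiffOn_const
  have hs := D.smooth_s
  have hs' := D.smooth_s.neg
  have ha0 := D.smooth_a 0
  have ha1 := D.smooth_a 1
  have ha0' := (D.smooth_a 0).neg
  have hc0' := (D.smooth_c 0).neg
  have hc1' := (D.smooth_c 1).neg
  have hc1 := D.smooth_c 1
  have hc2 := D.smooth_c 2
  fin_cases i <;> fin_cases k <;> assumption

theorem smooth_derCoeff (i k) : ContMDiffOn 𝓘(ℝ, E2) 𝓘(ℝ, ℝ) ∞ (D.derCoeff i k) U := by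
  have h0 : ContMDiffOn 𝓘(ℝ, E2) 𝓘(ℝ, ℝ) ∞ (0 : M → ℝ) U := contMDiffOn_const
  have h1 : ContMDiffOn 𝓘(ℝ, E2) 𝓘(ℝ, ℝ) ∞ (1 : M → ℝ) U := contMDiffOn_const
  fin_cases i
  · exact D.smooth_zetaCoeff 0 k
  · exact D.smooth_zetaCoeff 1 k
  · exact D.smooth_zetaCoeff 2 k
  · fin_cases k <;> assumption
  · fin_cases k <;> assumption

theorem smooth_lamCoeff (i k) : ContMDiffOn 𝓘(ℝ, E2) 𝓘(ℝ, ℝ) ∞ (D.lamCoeff i k) U := by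
  have h0 : ContMDiffOn 𝓘(ℝ, E2) 𝓘(ℝ, ℝ) ∞ (0 : M → ℝ) U := contMDiffOn_const
  have hs := D.smooth_s
  have hss := D.smooth_s.mul D.smooth_s
  have hss' := (D.smooth_s.mul D.smooth_s).neg
  have ha0 := D.smooth_a 0
  have ha1 := D.smooth_a 1
  fin_cases i <;> fin_cases k <;> assumption

end RootData

theorem linearIndependent_comb {ι : Type*} [Fintype ι] {c : ι → Fin 8 → M → ℝ} {x : M × F3}
    (hx : x ∈ v.domain) (h : ∀ e : ι → ℝ, (∀ k, ∑ i, e i * c i k x.1 = 0) → ∀ i, e i = 0) :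
    LinearIndependent ℝ fun i ↦ v.comb (c i) x := by
  rw [Fintype.linearIndependent_iff]
  intro e he
  refine h e fun k ↦ ?_
  obtain ⟨X, hX⟩ := exists_vector hx (Pi.single k 1)
  have h' := DFunLike.congr_fun he X
  rw [_root_.sum_apply] at h'
  simpa [comb_apply, hX, Pi.single_apply] using! h'

theorem mem_span_comb {ι : Type*} [Fintype ι] {c : ι → Fin 8 → M → ℝ} {x : M × F3}
    {a : Covector modelN x} (e : ι → ℝ)
    (h : ∀ X, a X = ∑ i, e i * v.comb (c i) x X) :
    a ∈ Submodule.span ℝ (range fun i ↦ v.comb (c i) x) := by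
  refine (Submodule.mem_span_range_iff_exists_fun ℝ).2 ⟨e, ?_⟩
  ext X
  rw [h, _root_.sum_apply]
  rfl

/-- The Pfaffian system spanned by combinations of the coframe. -/
def combSpan (v : OrthonormalFrame g U) {ι : Type*} (c : ι → Fin 8 → M → ℝ) :
    Pfaffian modelN (M × F3) :=
  fun x ↦ Submodule.span ℝ (range fun i ↦ v.comb (c i) x)

theorem apply_eq_of_eq_sum {ι : Type*} [Fintype ι] {c : ι → Fin 8 → M → ℝ} {x : M × F3}
    {a : Covector modelN x} {e : ι → ℝ} (h : a = ∑ i, e i • v.comb (c i) x)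
    (X : TangentSpace modelN x) : a X = ∑ i, e i * v.comb (c i) x X := by
  rw [h, _root_.sum_apply]
  rfl

/-- The pointwise upper bound for a derived system, with the congruence modulo the generators tested on
vectors which annihilate them, given by their coordinates `ξ`, `ζ` in the coframe. -/
theorem exists_of_mem_derived_comb {ι : Type*} [Fintype ι] [DecidableEq ι] (hU : IsOpen U)
    {c : ι → Fin 8 → M → ℝ} (hc : ∀ i k, ContMDiffOn 𝓘(ℝ, E2) 𝓘(ℝ, ℝ) ∞ (c i k) U) {x : M × F3}
    (hx : x ∈ v.domain) (hli : LinearIndependent ℝ fun i ↦ v.comb (c i) x)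
    {V : Pfaffian modelN (M × F3)} (hV : ∀ y ∈ v.domain, V y ≤ v.combSpan c y)
    {α : Covector modelN x} (hα : α ∈ derived V x) :
    ∃ e : ι → ℝ, α = ∑ i, e i • v.comb (c i) x ∧
      ∀ ξ ζ : Fin 8 → ℝ, (∀ i, ∑ k, c i k x.1 * ξ k = 0) → (∀ i, ∑ k, c i k x.1 * ζ k = 0) →
        ∑ i, e i * combDeriv (v.gaussCurvature x.1) (fun i ↦ v.etaConn x.1 (v.vec i x.1))
          (fun k ↦ c i k x.1) (fun k j ↦ v.covDeriv (c i k) j x.1) ξ ζ = 0 := by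
  obtain ⟨e, he, h⟩ := exists_of_mem_derived (v.isOpen_domain hU)
    (fun i ↦ v.smooth_comb hU (hc i)) hx hli hV hα
  refine ⟨e, he, fun ξ ζ hξ hζ ↦ ?_⟩
  obtain ⟨X, hX⟩ := exists_vector hx ξ
  obtain ⟨Y, hY⟩ := exists_vector hx ζ
  have h1 := apply_eq_zero_of_mem_idealTwo h (X := X) (Y := Y)
    (eq_zero_of_mem_span_range fun i ↦ by simp only [comb_apply, hX, hξ])
    (eq_zero_of_mem_span_range fun i ↦ by simp only [comb_apply, hY, hζ])
  simpa only [LinearMap.sum_apply, LinearMap.smul_apply, smul_eq_mul, extD_comb hU (hc _) hx, hX,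
    hY] using h1

namespace RootData

variable (D : RootData v)

/-- A characteristic system of the isometric embedding system. -/
def charSystem : Pfaffian modelN (M × F3) := v.combSpan D.charCoeff

variable {D} {x : M × F3}

theorem linearIndependent_charCoeff (hx : x ∈ v.domain) :
    LinearIndependent ℝ fun i ↦ v.comb (D.charCoeff i) x := by
  refine linearIndependent_comb hx fun e he i ↦ ?_
  have h (k) := he k
  simp only [Fin.sum_univ_six] at h
  have h0 := h 0; have h1 := h 1; have h2 := h 2; have h3 := h 3; have h4 := h 4; have h5 := h 5
  simp [charCoeff] at h0 h1 h2 h3 h4 h5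
  fin_cases i <;> assumption

theorem linearIndependent_derCoeff (hx : x ∈ v.domain) :
    LinearIndependent ℝ fun i ↦ v.comb (D.derCoeff i) x := by
  refine linearIndependent_comb hx fun e he i ↦ ?_
  have h (k) := he k
  simp only [Fin.sum_univ_five] at h
  have h1 := h 1; have h2 := h 2; have h3 := h 3; have h4 := h 4; have h5 := h 5
  simp [derCoeff, zetaCoeff] at h3 h4 h5
  simp [derCoeff, zetaCoeff, h3, h4, h5] at h1 h2
  fin_cases i <;> assumption

theorem linearIndependent_zetaCoeff (hx : x ∈ v.domain) :
    LinearIndependent ℝ fun i ↦ v.comb (D.zetaCoeff i) x := by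
  refine linearIndependent_comb hx fun e he i ↦ ?_
  have h (k) := he k
  simp only [Fin.sum_univ_three] at h
  have h3 := h 3; have h4 := h 4; have h5 := h 5
  simp [zetaCoeff] at h3 h4 h5
  fin_cases i <;> assumption

theorem linearIndependent_lamCoeff (hx : x ∈ v.domain) :
    LinearIndependent ℝ fun i ↦ v.comb (D.lamCoeff i) x := by
  refine linearIndependent_comb hx fun e he i ↦ ?_
  have h (k) := he k
  simp only [Fin.sum_univ_two] at h
  have h4 := h 4; have h5 := h 5
  have hs := D.s_ne_zero x.1 hx.1
  simp [lamCoeff, hs] at h4 h5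
  fin_cases i <;> assumption

/-- The derivatives of the generators of a characteristic system are, modulo the system, multiples of
one 2-form, so that the first derived system has corank one. -/
theorem derived_charSystem_le (hU : IsOpen U) (hx : x ∈ v.domain) :
    derived D.charSystem x ≤ v.combSpan D.derCoeff x := by
  intro α hα
  have hs := D.s_ne_zero x.1 hx.1
  obtain ⟨e, he, h⟩ := exists_of_mem_derived_comb hU D.smooth_charCoeff hx
    (linearIndependent_charCoeff hx) (fun y _ ↦ le_rfl) hα
  -- The two vectors span the annihilator of the characteristic system.
  have h1 := h ![0, 0, 0, 0, 0, -D.s x.1, 1, 0] ![0, 0, 0, 0, D.s x.1, 0, 0, 1]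
    (fun i ↦ by rw [Fin.sum_univ_eight]; fin_cases i <;> simp [charCoeff])
    (fun i ↦ by rw [Fin.sum_univ_eight]; fin_cases i <;> simp [charCoeff])
  simp only [Fin.sum_univ_six, combDeriv, Fin.sum_univ_eight] at h1
  simp [charCoeff, structureFunction, covDeriv_neg, D.covDeriv_s x.1 hx.1,
    D.gaussCurvature_eq x.1 hx.1] at h1
  have h2 : e 0 = -D.s x.1 * e 3 + D.a 0 x.1 * e 4 + D.a 1 x.1 * e 5 := by
    apply mul_left_cancel₀ (mul_ne_zero two_ne_zero hs)
    linear_combination h1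
  refine mem_span_comb ![e 3, e 4, e 5,
    e 1 - D.a 1 x.1 * e 3 - D.c 1 x.1 * e 4 - D.c 2 x.1 * e 5,
    e 2 + D.a 0 x.1 * e 3 + D.c 0 x.1 * e 4 + D.c 1 x.1 * e 5] fun X ↦ ?_
  rw [apply_eq_of_eq_sum he]
  simp only [Fin.sum_univ_six, Fin.sum_univ_five, comb_apply, Fin.sum_univ_eight]
  simp [charCoeff, derCoeff, zetaCoeff]
  rw [h2]
  ring

theorem derived_derCoeff_le (hU : IsOpen U) (hx : x ∈ v.domain) :
    derived (v.combSpan D.derCoeff) x ≤ v.combSpan D.zetaCoeff x := by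
  intro α hα
  have hs := D.s_ne_zero x.1 hx.1
  obtain ⟨e, he, h⟩ := exists_of_mem_derived_comb hU D.smooth_derCoeff hx
    (linearIndependent_derCoeff hx) (fun y _ ↦ le_rfl) hα
  have hT : ∀ i, ∑ k, D.derCoeff i k x.1 *
      (![1, 0, 0, D.s x.1, -D.a 0 x.1, -D.a 1 x.1, 0, 0] : Fin 8 → ℝ) k = 0 := fun i ↦ by
    rw [Fin.sum_univ_eight]; fin_cases i <;> simp [derCoeff, zetaCoeff]
  have h0 := h _ ![0, 0, 0, 0, 0, -D.s x.1, 1, 0] hT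
    (fun i ↦ by rw [Fin.sum_univ_eight]; fin_cases i <;> simp [derCoeff, zetaCoeff])
  have h1 := h _ ![0, 0, 0, 0, D.s x.1, 0, 0, 1] hT
    (fun i ↦ by rw [Fin.sum_univ_eight]; fin_cases i <;> simp [derCoeff, zetaCoeff])
  simp only [Fin.sum_univ_five, combDeriv, Fin.sum_univ_eight] at h0 h1
  have hp := hx.1
  simp [derCoeff, zetaCoeff, structureFunction, covDeriv_neg, D.covDeriv_s x.1 hp,
    D.covDeriv_a_zero_zero x.1 hp, D.covDeriv_a_zero_one x.1 hp, D.covDeriv_a_one_zero x.1 hp,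
    D.covDeriv_a_one_one x.1 hp, D.gaussCurvature_eq x.1 hp] at h0 h1
  have h3 : e 3 = 0 := by
    apply mul_left_cancel₀ (mul_ne_zero two_ne_zero hs)
    linear_combination -h1
  have h4 : e 4 = 0 := by
    apply mul_left_cancel₀ (mul_ne_zero two_ne_zero hs)
    linear_combination h0
  refine mem_span_comb ![e 0, e 1, e 2] fun X ↦ ?_
  rw [apply_eq_of_eq_sum he]
  simp [Fin.sum_univ_five, Fin.sum_univ_three, derCoeff, h3, h4]

/-- The system `ζ₀, ζ₁, ζ₂` contains the second derived system, hence its derived system contains the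
third one. -/
theorem derivedFinal_charSystem_le (hU : IsOpen U) (hx : x ∈ v.domain) :
    derivedFinal D.charSystem x ≤ derived (v.combSpan D.zetaCoeff) x := by
  have hW := v.isOpen_domain hU
  refine (iInf_le _ 3).trans ?_
  rw [derivedFlag_succ]
  refine derived_le_derived hW (fun y hy ↦ ?_) hx
  rw [derivedFlag_succ]
  refine le_trans ?_ (derived_derCoeff_le hU hy)
  refine derived_le_derived hW (fun z hz ↦ ?_) hy
  exact derived_charSystem_le hU hz

end RootData

end OrthonormalFrame

end Adapted

/-! ### The degeneracy condition -/

section Integrals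

variable {M : Type*} [TopologicalSpace M] [ChartedSpace E2 M] [IsManifold 𝓘(ℝ, E2) ∞ M]

namespace OrthonormalFrame.RootData

variable {g : Metric M} {U : Set M} {v : OrthonormalFrame g U} {D : RootData v} {x : M × F3}

/-- The condition `s c = -a aᵀ` at a point. -/
def IsDegenerateAt (D : RootData v) (p : M) : Prop :=
  D.s p * D.c 0 p = -D.a 0 p ^ 2 ∧ D.s p * D.c 1 p = -(D.a 0 p * D.a 1 p) ∧
    D.s p * D.c 2 p = -D.a 1 p ^ 2

/-- Under the degeneracy condition the two forms of `lamCoeff` satisfy the Frobenius condition. -/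
theorem extD_lam_mem (hU : IsOpen U) (hx : x ∈ v.domain) (hD : D.IsDegenerateAt x.1) (i : Fin 2) :
    extD (v.comb (D.lamCoeff i)) x ∈
      idealTwo (Submodule.span ℝ (range fun i ↦ v.comb (D.lamCoeff i) x)) := by
  refine mem_idealTwo_of_forall (linearIndependent_lamCoeff hx)
    (fun X ↦ by rw [extD_apply, sub_self]) fun X Y hX hY ↦ ?_
  have hp := hx.1
  have hs := D.s_ne_zero x.1 hp
  have hX0 := hX 0; have hX1 := hX 1; have hY0 := hY 0; have hY1 := hY 1
  rw [extD_comb hU (D.smooth_lamCoeff _) hx]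
  generalize hξ : (fun k ↦ v.coframe k x X) = ξ
  generalize hζ : (fun k ↦ v.coframe k x Y) = ζ
  have hξ' (k) : v.coframe k x X = ξ k := congrFun hξ k
  have hζ' (k) : v.coframe k x Y = ζ k := congrFun hζ k
  simp only [comb_apply, hξ', hζ', Fin.sum_univ_eight] at hX0 hX1 hY0 hY1
  have hm := mdifferentiableAt_of_contMDiffOn hU D.smooth_s hp
  have hss (j) : v.covDeriv (D.s * D.s) j x.1 = 4 * D.s x.1 ^ 2 * D.a j x.1 := by
    rw [covDeriv_mul hm hm, D.covDeriv_s _ hp]; ring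
  simp [lamCoeff] at hX0 hX1 hY0 hY1
  have hX4 : ξ 4 = D.s x.1 * ξ 7 - D.a 0 x.1 * ξ 3 / D.s x.1 := by
    field_simp; linear_combination hX0
  have hX5 : ξ 5 = -D.s x.1 * ξ 6 - D.a 1 x.1 * ξ 3 / D.s x.1 := by
    field_simp; linear_combination hX1
  have hY4 : ζ 4 = D.s x.1 * ζ 7 - D.a 0 x.1 * ζ 3 / D.s x.1 := by
    field_simp; linear_combination hY0
  have hY5 : ζ 5 = -D.s x.1 * ζ 6 - D.a 1 x.1 * ζ 3 / D.s x.1 := by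
    field_simp; linear_combination hY1
  obtain ⟨h0, h1, h2⟩ := hD
  have h0' : D.c 0 x.1 = -D.a 0 x.1 ^ 2 / D.s x.1 := by field_simp; linear_combination h0
  have h1' : D.c 1 x.1 = -(D.a 0 x.1 * D.a 1 x.1) / D.s x.1 := by
    field_simp; linear_combination h1
  have h2' : D.c 2 x.1 = -D.a 1 x.1 ^ 2 / D.s x.1 := by field_simp; linear_combination h2
  simp only [combDeriv, Fin.sum_univ_eight]
  fin_cases i <;>
  · simp [lamCoeff, structureFunction, covDeriv_neg, hss, D.covDeriv_s _ hp,
      D.covDeriv_a_zero_zero _ hp, D.covDeriv_a_zero_one _ hp, D.covDeriv_a_one_zero _ hp,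
      D.covDeriv_a_one_one _ hp, D.gaussCurvature_eq _ hp, hX4, hX5, hY4, hY5, h0', h1', h2']
    field_simp
    ring

/-- The algebraic part of the necessity. With `ζ₁ + w ζ₀` and `ζ₂ + z ζ₀` closed modulo the `ζ`, the
equations `e1`–`e4` are the coefficients of `θ₀ ∧ θ₁` and `θ₀ ∧ θ₂` in their derivatives, and `e5`,
`e6` are combinations of the coefficients of `θᵢ ∧ ηʲ`. -/
theorem degenerate_of_equations {s a b c₀ c₁ c₂ w z : ℝ} (hs : s ≠ 0)
    (e1 : s * b * w + s * c₁ = 0) (e2 : s * a * z + s * c₁ = 0)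
    (e3 : -(2 * s * a * w) + s * (c₂ - c₀) + (a ^ 2 + b ^ 2 - (c₀ * c₂ - c₁ ^ 2)) = 0)
    (e4 : 2 * s * b * z + s * (c₂ - c₀) - (a ^ 2 + b ^ 2 - (c₀ * c₂ - c₁ ^ 2)) = 0)
    (e5 : c₁ * w - (c₀ - s) * z = b) (e6 : (c₂ - s) * w - c₁ * z = -a) :
    s * c₀ = -a ^ 2 ∧ s * c₁ = -(a * b) ∧ s * c₂ = -b ^ 2 := by
  have e1' : c₁ = -(b * w) := by
    apply mul_left_cancel₀ hs; linear_combination e1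
  by_cases h0 : a ^ 2 + b ^ 2 = 0
  · have ha : a = 0 := by nlinarith [sq_nonneg a, sq_nonneg b]
    have hb : b = 0 := by nlinarith [sq_nonneg a, sq_nonneg b]
    subst ha hb
    have hc1 : c₁ = 0 := by rw [e1']; ring
    subst hc1
    have hc : c₂ = c₀ := by
      apply mul_left_cancel₀ hs; linear_combination (e3 + e4) / 2
    subst hc
    have : c₂ = 0 := by
      have : c₂ ^ 2 = 0 := by linear_combination -e3
      exact pow_eq_zero_iff two_ne_zero |>.1 this
    subst this
    simp
  · -- The two vectors `(w, z)` and `(a, b)` are proportional.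
    obtain ⟨t, rfl, rfl⟩ : ∃ t, w = t * a ∧ z = t * b := by
      have hwz : b * w = a * z := by
        apply mul_left_cancel₀ hs; linear_combination e1 - e2
      refine ⟨(a * w + b * z) / (a ^ 2 + b ^ 2), ?_, ?_⟩
      · field_simp; linear_combination b * hwz
      · field_simp; linear_combination -a * hwz
    have hc2 : c₂ = c₀ + t * a ^ 2 - t * b ^ 2 := by
      apply mul_left_cancel₀ hs; linear_combination (e3 + e4) / 2
    obtain ⟨m, hm⟩ : ∃ m, m = c₀ + t * a ^ 2 := ⟨_, rfl⟩
    have hc0 : c₀ = m - t * a ^ 2 := by rw [hm]; ring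
    subst hc0 hc2 e1'
    have ht : 1 + t * (m - s) = 0 := by
      apply (mul_eq_zero.1 _).resolve_left h0
      linear_combination (-b) * e5 + a * e6
    have hm0 : m = 0 := by
      have : m ^ 2 = 0 := by linear_combination (a ^ 2 + b ^ 2) * ht - (e3 - e4) / 2
      exact pow_eq_zero_iff two_ne_zero |>.1 this
    subst hm0
    refine ⟨?_, ?_, ?_⟩
    · linear_combination a ^ 2 * ht
    · linear_combination a * b * ht
    · linear_combination b ^ 2 * ht

/-- Every covector is the sum of one in the system of `-s` and one in the final derived system of
the system of `s` only if `s c = -a aᵀ`. -/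
theorem isDegenerateAt_of_sup_eq_top (hU : IsOpen U) (hx : x ∈ v.domain)
    (h : D.neg.charSystem x ⊔ derivedFinal D.charSystem x = ⊤) : D.IsDegenerateAt x.1 := by
  have hp := hx.1
  have hs := D.s_ne_zero x.1 hp
  -- Each of `ζ₁`, `ζ₂` can be modified by a multiple of `ζ₀` to lie in the third derived system.
  have key (j : Fin 2) : ∃ w : ℝ, ∀ ξ ζ : Fin 8 → ℝ,
      (∀ i, ∑ k, D.zetaCoeff i k x.1 * ξ k = 0) → (∀ i, ∑ k, D.zetaCoeff i k x.1 * ζ k = 0) →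
        ∑ i, (![w, ![1, 0] j, ![0, 1] j] : Fin 3 → ℝ) i *
          combDeriv (v.gaussCurvature x.1) (fun i ↦ v.etaConn x.1 (v.vec i x.1))
          (fun k ↦ D.zetaCoeff i k x.1) (fun k j ↦ v.covDeriv (D.zetaCoeff i k) j x.1) ξ ζ = 0 := by
    obtain ⟨b, hb, α, hα, hsum⟩ := Submodule.mem_sup.1
      (h ▸ Submodule.mem_top (x := (2 : ℝ) • v.coframe (![4, 5] j) x))
    obtain ⟨e, he, hd⟩ := exists_of_mem_derived_comb hU D.smooth_zetaCoeff hx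
      (linearIndependent_zetaCoeff hx) (fun y _ ↦ le_rfl) (derivedFinal_charSystem_le hU hx hα)
    -- The vectors `X`, `Y` span the annihilator of the system of `-s`, so that the component in the
    -- derived system is known on them; this determines its coefficients of `ζ₁` and `ζ₂`.
    obtain ⟨X, hX⟩ := exists_vector hx ![0, 0, 0, 0, 0, D.s x.1, 1, 0]
    obtain ⟨Y, hY⟩ := exists_vector hx ![0, 0, 0, 0, -D.s x.1, 0, 0, 1]
    have hbX : b X = 0 := eq_zero_of_mem_span_range (fun i ↦ by
      rw [comb_apply, Fin.sum_univ_eight]; fin_cases i <;> simp [hX, charCoeff, neg]) b hb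
    have hbY : b Y = 0 := eq_zero_of_mem_span_range (fun i ↦ by
      rw [comb_apply, Fin.sum_univ_eight]; fin_cases i <;> simp [hY, charCoeff, neg]) b hb
    have h1 : b X + α X = 2 * v.coframe (![4, 5] j) x X := DFunLike.congr_fun hsum X
    have h2 : b Y + α Y = 2 * v.coframe (![4, 5] j) x Y := DFunLike.congr_fun hsum Y
    rw [hbX, apply_eq_of_eq_sum he, hX] at h1
    rw [hbY, apply_eq_of_eq_sum he, hY] at h2
    simp [Fin.sum_univ_three, comb_apply, Fin.sum_univ_eight, hX, hY, zetaCoeff] at h1 h2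
    have e1 : e 1 = ![1, 0] j := by
      fin_cases j
      · simp at h2 ⊢
        apply mul_left_cancel₀ hs
        linarith
      · simpa [hs] using h2
    have e2 : e 2 = ![0, 1] j := by
      fin_cases j
      · simpa [hs] using h1
      · simp at h1 ⊢
        apply mul_left_cancel₀ hs
        linarith
    refine ⟨e 0, fun ξ ζ hξ hζ ↦ ?_⟩
    have := hd ξ ζ hξ hζ
    simp only [Fin.sum_univ_three, e1, e2] at this
    simp only [Fin.sum_univ_three]
    exact this
  -- The five vectors which follow form a basis of the annihilator of `ζ₀, ζ₁, ζ₂`.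
  have hT : ∀ i, ∑ k, D.zetaCoeff i k x.1 *
      (![1, 0, 0, D.s x.1, -D.a 0 x.1, -D.a 1 x.1, 0, 0] : Fin 8 → ℝ) k = 0 := fun i ↦ by
    rw [Fin.sum_univ_eight]; fin_cases i <;> simp [zetaCoeff]
  have hP0 : ∀ i, ∑ k, D.zetaCoeff i k x.1 *
      (![0, 0, -1, -D.a 0 x.1, -D.c 0 x.1, -D.c 1 x.1, 0, 0] : Fin 8 → ℝ) k = 0 := fun i ↦ by
    rw [Fin.sum_univ_eight]; fin_cases i <;> simp [zetaCoeff]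
  have hP1 : ∀ i, ∑ k, D.zetaCoeff i k x.1 *
      (![0, 1, 0, -D.a 1 x.1, -D.c 1 x.1, -D.c 2 x.1, 0, 0] : Fin 8 → ℝ) k = 0 := fun i ↦ by
    rw [Fin.sum_univ_eight]; fin_cases i <;> simp [zetaCoeff]
  have hX0 : ∀ i, ∑ k, D.zetaCoeff i k x.1 *
      (![0, 0, 0, 0, 0, -D.s x.1, 1, 0] : Fin 8 → ℝ) k = 0 := fun i ↦ by
    rw [Fin.sum_univ_eight]; fin_cases i <;> simp [zetaCoeff]
  have hX1 : ∀ i, ∑ k, D.zetaCoeff i k x.1 *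
      (![0, 0, 0, 0, D.s x.1, 0, 0, 1] : Fin 8 → ℝ) k = 0 := fun i ↦ by
    rw [Fin.sum_univ_eight]; fin_cases i <;> simp [zetaCoeff]
  obtain ⟨w, hw⟩ := key 0
  obtain ⟨z, hz⟩ := key 1
  have a0 := hw _ _ hT hP0
  have a1 := hw _ _ hT hP1
  have a2 := hz _ _ hT hP0
  have a3 := hz _ _ hT hP1
  have b1 := hw _ _ hX0 hP1
  have b3 := hw _ _ hX1 hP1
  have b0 := hz _ _ hX0 hP0
  have b2 := hz _ _ hX1 hP0
  simp only [Fin.sum_univ_three, combDeriv, Fin.sum_univ_eight] at a0 a1 a2 a3 b0 b1 b2 b3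
  simp [zetaCoeff, structureFunction, covDeriv_neg, D.covDeriv_s x.1 hp,
    D.covDeriv_a_zero_zero x.1 hp, D.covDeriv_a_zero_one x.1 hp, D.covDeriv_a_one_zero x.1 hp,
    D.covDeriv_a_one_one x.1 hp, D.gaussCurvature_eq x.1 hp] at a0 a1 a2 a3 b0 b1 b2 b3
  refine degenerate_of_equations (w := w) (z := z) hs ?_ ?_ ?_ ?_ ?_ ?_
  · linear_combination a0 / 2
  · linear_combination -a3 / 2
  · linear_combination a1
  · linear_combination a2
  · apply mul_left_cancel₀ (mul_ne_zero two_ne_zero hs)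
    linear_combination b0 - b1
  · apply mul_left_cancel₀ (mul_ne_zero two_ne_zero hs)
    linear_combination b2 - b3

end OrthonormalFrame.RootData

end Integrals

/-! ### The decomposition into two singular systems -/

section Sufficiency

/-- Two alternating forms which agree on the annihilator of the covectors `lam i` differ by a member of
the ideal which these generate. -/
theorem mem_of_eq_on_annihilator {E : Type*} [NormedAddCommGroup E] [NormedSpace ℝ E]
    [FiniteDimensional ℝ E] {H : Type*} [TopologicalSpace H] {I : ModelWithCorners ℝ E H}
    {N : Type*} [TopologicalSpace N] [ChartedSpace H N] {ι : Type*} [Fintype ι] [DecidableEq ι]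
    {x : N} {lam : ι → Covector I x} (hli : LinearIndependent ℝ lam)
    {S : Submodule ℝ (Bicovector I x)} (hS : idealTwo (Submodule.span ℝ (range lam)) ≤ S)
    {τ τ' : Bicovector I x} (hτ : ∀ X, τ X X = 0) (hτ' : ∀ X, τ' X X = 0) (hmem : τ' ∈ S)
    (h : ∀ X Y : TangentSpace I x, (∀ i, lam i X = 0) → (∀ i, lam i Y = 0) → τ X Y = τ' X Y) :
    τ ∈ S := by
  have h1 : τ + (-1 : ℝ) • τ' ∈ S := hS <| mem_idealTwo_of_forall hli
    (fun X ↦ by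
      rw [LinearMap.add_apply, LinearMap.add_apply, LinearMap.smul_apply, LinearMap.smul_apply, hτ,
        hτ', smul_zero, add_zero])
    fun X Y hX hY ↦ by
      rw [LinearMap.add_apply, LinearMap.add_apply, LinearMap.smul_apply, LinearMap.smul_apply,
        h X Y hX hY, smul_eq_mul]
      ring
  have h2 := S.add_mem h1 hmem
  convert h2 using 1
  module

theorem extD_alternating {E : Type*} [NormedAddCommGroup E] [NormedSpace ℝ E]
    {H : Type*} [TopologicalSpace H] {I : ModelWithCorners ℝ E H}
    {N : Type*} [TopologicalSpace N] [ChartedSpace H N] (α : OneForm I N) (x : N)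
    (X : TangentSpace I x) : extD α x X X = 0 := by
  rw [extD_apply, sub_self]

theorem wedge_alternating {E : Type*} [NormedAddCommGroup E] [NormedSpace ℝ E]
    {H : Type*} [TopologicalSpace H] {I : ModelWithCorners ℝ E H}
    {N : Type*} [TopologicalSpace N] [ChartedSpace H N] {x : N} (a b : Covector I x)
    (X : TangentSpace I x) : wedge a b X X = 0 := by
  rw [wedge_apply, sub_self]

variable {M : Type*} [TopologicalSpace M] [ChartedSpace E2 M] [IsManifold 𝓘(ℝ, E2) ∞ M]

namespace OrthonormalFrame.RootData

variable {g : Metric M} {U : Set M} {v : OrthonormalFrame g U} (D : RootData v) {x : M × F3}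

/-- The coefficients of the forms `θ₀, …, θ₃`. -/
def thetaCoeff : Fin 4 → Fin 8 → M → ℝ :=
  ![D.charCoeff 0, D.charCoeff 1, D.charCoeff 2, D.charCoeff 3]

/-- The coefficients of the forms `ω³₁ - s η², ω³₂ + s η¹`. -/
def sigmaCoeff : Fin 2 → Fin 8 → M → ℝ := ![D.charCoeff 4, D.charCoeff 5]

/-- The coefficients of the coframe adapted to both characteristic systems. -/
def adaptedCoeff : Fin 4 ⊕ (Fin 2 ⊕ Fin 2) → Fin 8 → M → ℝ :=
  Sum.elim D.thetaCoeff (Sum.elim D.sigmaCoeff D.neg.sigmaCoeff)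

variable {D}

theorem neg_neg : D.neg.neg = D := by
  cases D
  simp [neg]

theorem comb_thetaCoeff (i : Fin 4) (x : M × F3) : v.comb (D.thetaCoeff i) x = v.theta i x := by
  fin_cases i <;> ext X <;> rw [comb_apply, Fin.sum_univ_eight] <;>
    simp [thetaCoeff, charCoeff] <;> rfl

theorem theta_apply (i : Fin 4) (X : TangentSpace modelN x) :
    v.theta i x X = v.coframe (i.castLE (by norm_num)) x X := by
  fin_cases i <;> rfl

theorem smooth_thetaCoeff (i k) : ContMDiffOn 𝓘(ℝ, E2) 𝓘(ℝ, ℝ) ∞ (D.thetaCoeff i k) U := by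
  fin_cases i
  exacts [D.smooth_charCoeff 0 k, D.smooth_charCoeff 1 k, D.smooth_charCoeff 2 k,
    D.smooth_charCoeff 3 k]

theorem smooth_sigmaCoeff (i k) : ContMDiffOn 𝓘(ℝ, E2) 𝓘(ℝ, ℝ) ∞ (D.sigmaCoeff i k) U := by
  fin_cases i
  exacts [D.smooth_charCoeff 4 k, D.smooth_charCoeff 5 k]

theorem comb_sigmaCoeff_zero (X : TangentSpace modelN x) : v.comb (D.sigmaCoeff 0) x X =
    v.coframe 4 x X - D.s x.1 * v.coframe 7 x X := by
  simp [comb_apply, Fin.sum_univ_eight, sigmaCoeff, charCoeff]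
  ring

theorem comb_sigmaCoeff_one (X : TangentSpace modelN x) : v.comb (D.sigmaCoeff 1) x X =
    v.coframe 5 x X + D.s x.1 * v.coframe 6 x X := by
  simp [comb_apply, Fin.sum_univ_eight, sigmaCoeff, charCoeff]

@[simp]
theorem neg_s (p : M) : D.neg.s p = -D.s p := rfl

theorem linearIndependent_adaptedCoeff (hx : x ∈ v.domain) :
    LinearIndependent ℝ fun i ↦ v.comb (D.adaptedCoeff i) x := by
  refine linearIndependent_comb hx fun e he i ↦ ?_
  have hs := D.s_ne_zero x.1 hx.1
  have h (k) := he k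
  simp only [Fintype.sum_sum_type, Fin.sum_univ_four, Fin.sum_univ_two] at h
  have h0 := h 0; have h1 := h 1; have h2 := h 2; have h3 := h 3; have h4 := h 4; have h5 := h 5
  have h6 := h 6; have h7 := h 7
  simp [adaptedCoeff, thetaCoeff, sigmaCoeff, charCoeff] at h0 h1 h2 h3 h4 h5 h6 h7
  have hs2 := mul_ne_zero (two_ne_zero (α := ℝ)) hs
  have hl0 : e (Sum.inr (Sum.inl 0)) = 0 := by
    apply mul_left_cancel₀ hs2; linear_combination D.s x.1 * h4 - h7
  have hl1 : e (Sum.inr (Sum.inl 1)) = 0 := by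
    apply mul_left_cancel₀ hs2; linear_combination D.s x.1 * h5 + h6
  have hr0 : e (Sum.inr (Sum.inr 0)) = 0 := by
    apply mul_left_cancel₀ hs2; linear_combination D.s x.1 * h4 + h7
  have hr1 : e (Sum.inr (Sum.inr 1)) = 0 := by
    apply mul_left_cancel₀ hs2; linear_combination D.s x.1 * h5 - h6
  rcases i with i | i | i <;> fin_cases i <;> assumption

theorem linearIndependent_thetaCoeff (hx : x ∈ v.domain) :
    LinearIndependent ℝ fun i ↦ v.comb (D.thetaCoeff i) x :=
  (linearIndependent_adaptedCoeff (D := D) hx).comp Sum.inl Sum.inl_injective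

theorem span_adaptedCoeff (hx : x ∈ v.domain) :
    Submodule.span ℝ (range fun i ↦ v.comb (D.adaptedCoeff i) x) = ⊤ := by
  refine eq_top_iff.2 fun a _ ↦ ?_
  have hs := D.s_ne_zero x.1 hx.1
  obtain ⟨c, hc⟩ := span_coframe hx a
  refine mem_span_comb (Sum.elim ![c 0, c 1, c 2, c 3] (Sum.elim
    ![c 4 / 2 - c 7 / (2 * D.s x.1), c 5 / 2 + c 6 / (2 * D.s x.1)]
    ![c 4 / 2 + c 7 / (2 * D.s x.1), c 5 / 2 - c 6 / (2 * D.s x.1)])) fun X ↦ ?_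
  rw [hc]
  simp only [Fintype.sum_sum_type, Fin.sum_univ_four, Fin.sum_univ_two, comb_apply,
    Fin.sum_univ_eight]
  simp [adaptedCoeff, thetaCoeff, sigmaCoeff, charCoeff]
  field_simp
  ring

theorem charSystem_eq (x : M × F3) : D.charSystem x = Submodule.span ℝ
    (range (fun i ↦ v.theta i x) ∪ range fun a ↦ v.comb (D.sigmaCoeff a) x) := by
  refine congrArg (Submodule.span ℝ) (Set.ext fun a ↦ ⟨?_, ?_⟩)
  · rintro ⟨i, rfl⟩
    fin_cases i
    · exact Or.inl ⟨0, (comb_thetaCoeff (D := D) 0 x).symm⟩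
    · exact Or.inl ⟨1, (comb_thetaCoeff (D := D) 1 x).symm⟩
    · exact Or.inl ⟨2, (comb_thetaCoeff (D := D) 2 x).symm⟩
    · exact Or.inl ⟨3, (comb_thetaCoeff (D := D) 3 x).symm⟩
    · exact Or.inr ⟨0, rfl⟩
    · exact Or.inr ⟨1, rfl⟩
  · rintro (⟨i, rfl⟩ | ⟨i, rfl⟩)
    · simp only [← comb_thetaCoeff (D := D)]
      fin_cases i
      exacts [⟨0, rfl⟩, ⟨1, rfl⟩, ⟨2, rfl⟩, ⟨3, rfl⟩]
    · fin_cases i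
      exacts [⟨4, rfl⟩, ⟨5, rfl⟩]

theorem embeddingSystem_eq (D : RootData v) (x : M × F3) :
    v.embeddingSystem x = v.combSpan D.thetaCoeff x := by
  simp only [embeddingSystem, combSpan, comb_thetaCoeff]

/-- The 2-form `(ω³₁ - s η²) ∧ (ω³₂ + s η¹)`. -/
def sigmaForm (D : RootData v) : TwoForm modelN (M × F3) := fun x ↦
  wedge (v.comb (D.sigmaCoeff 0) x) (v.comb (D.sigmaCoeff 1) x)

theorem sigmaForm_apply (X Y : TangentSpace modelN x) : D.sigmaForm x X Y =
    (v.coframe 4 x X - D.s x.1 * v.coframe 7 x X) * (v.coframe 5 x Y + D.s x.1 * v.coframe 6 x Y) -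
    (v.coframe 4 x Y - D.s x.1 * v.coframe 7 x Y) *
      (v.coframe 5 x X + D.s x.1 * v.coframe 6 x X) := by
  rw [sigmaForm, wedge_apply, comb_sigmaCoeff_zero, comb_sigmaCoeff_one, comb_sigmaCoeff_zero,
    comb_sigmaCoeff_one]

/-- The isometric embedding system is generated algebraically by the forms `θᵢ` and two
decomposable 2-forms. -/
theorem differentialIdealTwo_embeddingSystem (D : RootData v) (hU : IsOpen U)
    (hx : x ∈ v.domain) : differentialIdealTwo v.embeddingSystem x =
      idealTwo (v.embeddingSystem x) ⊔ Submodule.span ℝ {D.sigmaForm x, D.neg.sigmaForm x} := by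
  have hp := hx.1
  have hs := D.s_ne_zero x.1 hp
  have hli := linearIndependent_thetaCoeff (D := D) hx
  rw [differentialIdealTwo_eq (v.isOpen_domain hU)
    (fun i ↦ v.smooth_comb hU (D.smooth_thetaCoeff i)) hx hli
    fun y _ ↦ embeddingSystem_eq D y, embeddingSystem_eq D]
  have key (i : Fin 4) (X Y : TangentSpace modelN x) (hX : ∀ i, v.comb (D.thetaCoeff i) x X = 0)
      (hY : ∀ i, v.comb (D.thetaCoeff i) x Y = 0) : extD (v.comb (D.thetaCoeff i)) x X Y =
        ![-(v.coframe 4 x X * v.coframe 6 x Y - v.coframe 4 x Y * v.coframe 6 x X) -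
          (v.coframe 5 x X * v.coframe 7 x Y - v.coframe 5 x Y * v.coframe 7 x X), 0, 0,
          (v.coframe 4 x X * v.coframe 5 x Y - v.coframe 4 x Y * v.coframe 5 x X) + D.s x.1 ^ 2 *
          (v.coframe 6 x X * v.coframe 7 x Y - v.coframe 6 x Y * v.coframe 7 x X)] i := by
    have hX0 := hX 0; have hX1 := hX 1; have hX2 := hX 2; have hX3 := hX 3
    have hY0 := hY 0; have hY1 := hY 1; have hY2 := hY 2; have hY3 := hY 3
    simp [comb_apply, Fin.sum_univ_eight, thetaCoeff, charCoeff] at hX0 hX1 hX2 hX3 hY0 hY1 hY2 hY3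
    rw [extD_comb hU (D.smooth_thetaCoeff _) hx]
    simp only [combDeriv, Fin.sum_univ_eight]
    fin_cases i <;> simp [thetaCoeff, charCoeff, structureFunction, hX0, hX1, hX2, hX3, hY0, hY1,
      hY2, hY3, D.gaussCurvature_eq _ hp]
  refine le_antisymm (sup_le le_sup_left (Submodule.span_le.2 ?_))
    (sup_le le_sup_left (Submodule.span_le.2 ?_))
  · rintro _ ⟨i, rfl⟩
    obtain ⟨e, e', he⟩ : ∃ e e' : ℝ, ∀ X Y : TangentSpace modelN x,
        (∀ i, v.comb (D.thetaCoeff i) x X = 0) → (∀ i, v.comb (D.thetaCoeff i) x Y = 0) →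
        extD (v.comb (D.thetaCoeff i)) x X Y =
          (e • D.sigmaForm x + e' • D.neg.sigmaForm x) X Y := by
      -- The forms `dθ₁` and `dθ₂` vanish modulo the `θ`; the other two are combinations of the sum and
      -- the difference of the 2-forms of the roots `s` and `-s`.
      refine ⟨![-1 / (2 * D.s x.1), 0, 0, 1 / 2] i, ![1 / (2 * D.s x.1), 0, 0, 1 / 2] i,
        fun X Y hX hY ↦ ?_⟩
      rw [key i X Y hX hY, LinearMap.add_apply, LinearMap.add_apply, LinearMap.smul_apply,
        LinearMap.smul_apply, LinearMap.smul_apply, LinearMap.smul_apply, sigmaForm_apply,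
        sigmaForm_apply, neg_s]
      fin_cases i <;> simp <;> field_simp <;> ring
    refine mem_of_eq_on_annihilator hli le_sup_left (extD_alternating _ _) (fun X ↦ ?_) ?_ he
    · rw [LinearMap.add_apply, LinearMap.add_apply, LinearMap.smul_apply, LinearMap.smul_apply,
        LinearMap.smul_apply, LinearMap.smul_apply, sigmaForm, sigmaForm, wedge_alternating,
        wedge_alternating, smul_zero, smul_zero, add_zero]
    · exact Submodule.mem_sup_right (Submodule.add_mem _
        (Submodule.smul_mem _ _ (Submodule.subset_span (Or.inl rfl)))
        (Submodule.smul_mem _ _ (Submodule.subset_span (Or.inr rfl))))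
  · have aux (s : ℝ) (τ : Bicovector modelN x) (hτ : ∀ X, τ X X = 0)
        (h : ∀ X Y : TangentSpace modelN x,
        (∀ i, v.comb (D.thetaCoeff i) x X = 0) → (∀ i, v.comb (D.thetaCoeff i) x Y = 0) →
        τ X Y = ((-s) • extD (v.comb (D.thetaCoeff 0)) x + extD (v.comb (D.thetaCoeff 3)) x) X Y) :
        τ ∈ idealTwo (v.combSpan D.thetaCoeff x) ⊔
          Submodule.span ℝ (range fun i ↦ extD (v.comb (D.thetaCoeff i)) x) := by
      refine mem_of_eq_on_annihilator hli le_sup_left hτ (fun X ↦ ?_) ?_ h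
      · rw [LinearMap.add_apply, LinearMap.add_apply, LinearMap.smul_apply, LinearMap.smul_apply,
          extD_alternating, extD_alternating, smul_zero, add_zero]
      · exact Submodule.mem_sup_right (Submodule.add_mem _
          (Submodule.smul_mem _ _ (Submodule.subset_span ⟨0, rfl⟩))
          (Submodule.subset_span ⟨3, rfl⟩))
    rintro _ (rfl | rfl)
    · refine aux (D.s x.1) _ (wedge_alternating _ _) fun X Y hX hY ↦ ?_
      rw [LinearMap.add_apply, LinearMap.add_apply, LinearMap.smul_apply, LinearMap.smul_apply,
        key 0 X Y hX hY, key 3 X Y hX hY, sigmaForm_apply]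
      simp
      ring
    · refine aux (-D.s x.1) _ (wedge_alternating _ _) fun X Y hX hY ↦ ?_
      rw [LinearMap.add_apply, LinearMap.add_apply, LinearMap.smul_apply, LinearMap.smul_apply,
        key 0 X Y hX hY, key 3 X Y hX hY, sigmaForm_apply]
      simp
      ring

/-- The singular system of `s` is Pfaffian: modulo the 1-forms, the derivatives of its generators are
multiples of the decomposable 2-form of the other root, and that of `θ₀` is a nonzero one. -/
theorem differentialIdealTwo_charSystem (D : RootData v) (hU : IsOpen U)
    (hx : x ∈ v.domain) : differentialIdealTwo D.charSystem x =
      idealTwo (D.charSystem x) ⊔ Submodule.span ℝ {D.neg.sigmaForm x} := by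
  have hp := hx.1
  have hs := D.s_ne_zero x.1 hp
  have hli := linearIndependent_charCoeff (D := D) hx
  rw [differentialIdealTwo_eq (V := D.charSystem) (v.isOpen_domain hU)
    (fun i ↦ v.smooth_comb hU (D.smooth_charCoeff i)) hx hli fun y _ ↦ rfl]
  have key (X Y : TangentSpace modelN x) (hX : ∀ i, v.comb (D.charCoeff i) x X = 0)
      (hY : ∀ i, v.comb (D.charCoeff i) x Y = 0) :
      (∀ i, extD (v.comb (D.charCoeff i)) x X Y =
        ![1 / (2 * D.s x.1), 0, 0, 1 / 2, -D.a 0 x.1 / (2 * D.s x.1), -D.a 1 x.1 / (2 * D.s x.1)] i *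
        D.neg.sigmaForm x X Y) := by
    have hX0 := hX 0; have hX1 := hX 1; have hX2 := hX 2; have hX3 := hX 3
    have hY0 := hY 0; have hY1 := hY 1; have hY2 := hY 2; have hY3 := hY 3
    have hX4 := hX 4; have hX5 := hX 5; have hY4 := hY 4; have hY5 := hY 5
    simp [comb_apply, Fin.sum_univ_eight, charCoeff] at hX0 hX1 hX2 hX3 hY0 hY1 hY2 hY3 hX4 hX5
    simp [comb_apply, Fin.sum_univ_eight, charCoeff] at hY4 hY5
    have hX4' : v.coframe 4 x X = D.s x.1 * v.coframe 7 x X := by linear_combination hX4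
    have hX5' : v.coframe 5 x X = -D.s x.1 * v.coframe 6 x X := by linear_combination hX5
    have hY4' : v.coframe 4 x Y = D.s x.1 * v.coframe 7 x Y := by linear_combination hY4
    have hY5' : v.coframe 5 x Y = -D.s x.1 * v.coframe 6 x Y := by linear_combination hY5
    intro i
    rw [extD_comb hU (D.smooth_charCoeff _) hx, sigmaForm_apply]
    simp only [combDeriv, Fin.sum_univ_eight]
    fin_cases i <;> simp [charCoeff, structureFunction, hX0, hX1, hX2, hX3, hY0, hY1,
      hY2, hY3, hX4', hX5', hY4', hY5', D.gaussCurvature_eq _ hp, covDeriv_neg,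
      D.covDeriv_s _ hp] <;> field_simp <;> ring
  refine le_antisymm (sup_le le_sup_left (Submodule.span_le.2 ?_))
    (sup_le le_sup_left (Submodule.span_le.2 ?_))
  · rintro _ ⟨i, rfl⟩
    refine mem_of_eq_on_annihilator hli le_sup_left (extD_alternating _ _)
      (τ' := (![1 / (2 * D.s x.1), 0, 0, 1 / 2, -D.a 0 x.1 / (2 * D.s x.1),
        -D.a 1 x.1 / (2 * D.s x.1)] i : ℝ) • D.neg.sigmaForm x)
      (fun X ↦ ?_) ?_ fun X Y hX hY ↦ (key X Y hX hY i)
    · rw [LinearMap.smul_apply, LinearMap.smul_apply, sigmaForm, wedge_alternating, smul_zero]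
    · exact Submodule.mem_sup_right (Submodule.smul_mem _ _ (Submodule.subset_span rfl))
  · rintro _ rfl
    refine mem_of_eq_on_annihilator hli le_sup_left (wedge_alternating _ _)
      (τ' := (2 * D.s x.1) • extD (v.comb (D.charCoeff 0)) x)
      (fun X ↦ ?_) ?_ fun X Y hX hY ↦ ?_
    · rw [LinearMap.smul_apply, LinearMap.smul_apply, extD_alternating, smul_zero]
    · exact Submodule.mem_sup_right (Submodule.smul_mem _ _ (Submodule.subset_span ⟨0, rfl⟩))
    · rw [LinearMap.smul_apply, LinearMap.smul_apply, key X Y hX hY 0]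
      simp
      field_simp

end OrthonormalFrame.RootData

end Sufficiency

/-! ### The Darboux pair -/

section DarbouxPair

variable {M : Type*} [TopologicalSpace M] [ChartedSpace E2 M] [IsManifold 𝓘(ℝ, E2) ∞ M]

namespace OrthonormalFrame.RootData

variable {g : Metric M} {U : Set M} {v : OrthonormalFrame g U} (D : RootData v) {x : M × F3}

theorem adaptedCoeff_family (x : M × F3) :
    (Sum.elim (fun i ↦ v.theta i x) (Sum.elim (fun a ↦ v.comb (D.sigmaCoeff a) x)
      fun a ↦ v.comb (D.neg.sigmaCoeff a) x)) = fun i ↦ v.comb (D.adaptedCoeff i) x := by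
  funext i
  rcases i with i | i | i
  · exact (comb_thetaCoeff i x).symm
  · rfl
  · rfl

theorem isDecompositionOn (hU : IsOpen U) :
    IsDecompositionOn v.embeddingSystem D.charSystem D.neg.charSystem v.domain := by
  refine ⟨4, 2, 2, 1, 1, v.theta, fun a ↦ v.comb (D.sigmaCoeff a),
    fun a ↦ v.comb (D.neg.sigmaCoeff a), fun _ i j _ ↦ if i = 0 ∧ j = 1 then 1 else 0,
    fun _ i j _ ↦ if i = 0 ∧ j = 1 then 1 else 0, fun _ ↦ D.sigmaForm, fun _ ↦ D.neg.sigmaForm,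
    le_rfl, le_rfl, le_rfl, le_rfl, fun i ↦ ?_, fun a ↦ v.smooth_comb hU (D.smooth_sigmaCoeff a),
    fun a ↦ v.smooth_comb hU (D.neg.smooth_sigmaCoeff a), fun _ _ _ ↦ contMDiffOn_const,
    fun _ _ _ ↦ contMDiffOn_const, fun y hy ↦ ⟨?_, ?_, fun _ ↦ ?_, fun _ ↦ ?_, rfl, ?_,
      D.charSystem_eq y, D.neg.charSystem_eq y, ?_, ?_⟩⟩
  · have := v.smooth_comb hU (D.smooth_thetaCoeff i)
    exact this.congr fun y _ ↦ (comb_thetaCoeff i y).symm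
  · rw [adaptedCoeff_family]
    exact linearIndependent_adaptedCoeff hy
  · rw [adaptedCoeff_family]
    exact span_adaptedCoeff hy
  · simp [Fin.sum_univ_two, sigmaForm]
  · simp [Fin.sum_univ_two, sigmaForm]
  · rw [D.differentialIdealTwo_embeddingSystem hU hy, range_const, range_const]
    rfl
  · rw [D.differentialIdealTwo_charSystem hU hy, range_const]
  · rw [D.neg.differentialIdealTwo_charSystem hU hy, range_const, neg_neg]

variable {D}

theorem isDegenerateAt_neg {p : M} (h : D.IsDegenerateAt p) : D.neg.IsDegenerateAt p := by
  obtain ⟨h0, h1, h2⟩ := h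
  refine ⟨?_, ?_, ?_⟩ <;> simp [neg] <;> assumption

/-- Under the degeneracy condition, the final derived system of the root `-s` contains the two forms of
`lamCoeff`, which complement the system of the root `s`. -/
theorem charSystem_sup_derivedFinal (hU : IsOpen U) (hD : ∀ p ∈ U, D.IsDegenerateAt p)
    (hx : x ∈ v.domain) : D.charSystem x ⊔ derivedFinal D.neg.charSystem x = ⊤ := by
  refine eq_top_iff.2 fun a _ ↦ ?_
  have hs := D.s_ne_zero x.1 hx.1
  have hle : v.combSpan D.neg.lamCoeff x ≤ derivedFinal D.neg.charSystem x := by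
    refine span_le_derivedFinal (v.isOpen_domain hU)
      (fun i ↦ v.smooth_comb hU (D.neg.smooth_lamCoeff i)) (fun y _ ↦ ?_)
      (fun y hy i ↦ extD_lam_mem hU hy (isDegenerateAt_neg (hD _ hy.1)) i) hx
    refine Submodule.span_le.2 ?_
    rintro _ ⟨i, rfl⟩
    refine mem_span_comb (![![0, 0, 0, D.a 0 y.1, -D.s y.1, 0],
      ![0, 0, 0, D.a 1 y.1, 0, -D.s y.1]] i) fun X ↦ ?_
    simp only [comb_apply, Fin.sum_univ_eight, Fin.sum_univ_six]
    fin_cases i <;> simp [charCoeff, lamCoeff, neg] <;> ring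
  obtain ⟨c, hc⟩ := span_coframe hx a
  have h1 : a = (∑ i, (![c 0, c 1, c 2, c 3 + (c 4 / 2 + c 7 / (2 * D.s x.1)) * D.a 0 x.1 / D.s x.1
      + (c 5 / 2 - c 6 / (2 * D.s x.1)) * D.a 1 x.1 / D.s x.1,
      c 4 / 2 - c 7 / (2 * D.s x.1), c 5 / 2 + c 6 / (2 * D.s x.1)] : Fin 6 → ℝ) i •
        v.comb (D.charCoeff i) x) +
      ∑ i, (![-(c 4 / 2 + c 7 / (2 * D.s x.1)) / D.s x.1,
        -(c 5 / 2 - c 6 / (2 * D.s x.1)) / D.s x.1] : Fin 2 → ℝ) i •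
          v.comb (D.neg.lamCoeff i) x := by
    ext X
    refine Eq.trans ?_ (congrArg₂ (· + ·) (apply_eq_of_eq_sum (X := X) rfl).symm
      (apply_eq_of_eq_sum (X := X) rfl).symm)
    rw [hc]
    simp only [comb_apply, Fin.sum_univ_eight, Fin.sum_univ_six, Fin.sum_univ_two]
    simp [charCoeff, lamCoeff, neg]
    field_simp
    ring
  rw [h1]
  refine Submodule.add_mem_sup (Submodule.sum_mem _ fun i _ ↦ Submodule.smul_mem _ _
    (Submodule.subset_span ⟨i, rfl⟩)) (hle (Submodule.sum_mem _ fun i _ ↦ Submodule.smul_mem _ _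
    (Submodule.subset_span ⟨i, rfl⟩)))

theorem charSystem_sup_charSystem (hx : x ∈ v.domain) :
    D.charSystem x ⊔ D.neg.charSystem x = ⊤ := by
  rw [eq_top_iff, ← span_adaptedCoeff (D := D) hx, Submodule.span_le]
  rintro _ ⟨i | i | i, rfl⟩
  · refine Submodule.mem_sup_left ?_
    rw [charSystem_eq]
    exact Submodule.subset_span (Or.inl ⟨i, (comb_thetaCoeff i x).symm⟩)
  · refine Submodule.mem_sup_left ?_
    rw [charSystem_eq]
    exact Submodule.subset_span (Or.inr ⟨i, rfl⟩)
  · refine Submodule.mem_sup_right ?_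
    rw [charSystem_eq]
    exact Submodule.subset_span (Or.inr ⟨i, rfl⟩)

theorem coeff_eq_of_sum_eq {ι κ : Type*} [Fintype ι] [Fintype κ] {c : ι → Fin 8 → M → ℝ}
    {c' : κ → Fin 8 → M → ℝ} {e : ι → ℝ} {e' : κ → ℝ} (hx : x ∈ v.domain)
    (h : ∑ i, e i • v.comb (c i) x = ∑ i, e' i • v.comb (c' i) x) (k : Fin 8) :
    ∑ i, e i * c i k x.1 = ∑ i, e' i * c' i k x.1 := by
  obtain ⟨X, hX⟩ := exists_vector hx (Pi.single k 1)
  have h1 := (apply_eq_of_eq_sum h X).symm.trans (apply_eq_of_eq_sum rfl X)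
  simpa [comb_apply, hX, Pi.single_apply] using h1.symm

theorem charSystem_inf_charSystem_le (hx : x ∈ v.domain) :
    D.charSystem x ⊓ D.neg.charSystem x ≤ v.embeddingSystem x := by
  rintro a ⟨h1, h2⟩
  have hs := D.s_ne_zero x.1 hx.1
  obtain ⟨e, rfl⟩ := (Submodule.mem_span_range_iff_exists_fun ℝ).1 h1
  obtain ⟨e', he'⟩ := (Submodule.mem_span_range_iff_exists_fun ℝ).1 h2
  have h (k) := coeff_eq_of_sum_eq hx he' k
  simp only [Fin.sum_univ_six] at h
  have h4 := h 4; have h5 := h 5; have h6 := h 6; have h7 := h 7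
  simp [charCoeff, neg] at h4 h5 h6 h7
  have e4 : e 4 = 0 := by
    apply mul_left_cancel₀ (mul_ne_zero two_ne_zero hs)
    linear_combination h7 - D.s x.1 * h4
  have e5 : e 5 = 0 := by
    apply mul_left_cancel₀ (mul_ne_zero two_ne_zero hs)
    linear_combination -h6 - D.s x.1 * h5
  rw [embeddingSystem_eq D]
  refine mem_span_comb ![e 0, e 1, e 2, e 3] fun X ↦ ?_
  rw [apply_eq_of_eq_sum rfl]
  simp [Fin.sum_univ_six, Fin.sum_univ_four, e4, e5, thetaCoeff]

/-- The final derived systems lie in the spans of the `ζ` for `s` and `-s`, which meet only in zero. -/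
theorem derivedFinal_inf_derivedFinal (hU : IsOpen U) (hx : x ∈ v.domain) :
    derivedFinal D.charSystem x ⊓ derivedFinal D.neg.charSystem x = ⊥ := by
  refine eq_bot_iff.2 ?_
  rintro a ⟨h1, h2⟩
  have hs := D.s_ne_zero x.1 hx.1
  obtain ⟨e, rfl⟩ := (Submodule.mem_span_range_iff_exists_fun ℝ).1
    (derived_le _ _ (derivedFinal_charSystem_le hU hx h1))
  obtain ⟨e', he'⟩ := (Submodule.mem_span_range_iff_exists_fun ℝ).1
    (derived_le _ _ (derivedFinal_charSystem_le hU hx h2))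
  have h (k) := coeff_eq_of_sum_eq hx he' k
  simp only [Fin.sum_univ_three] at h
  have h0 := h 0; have h3 := h 3; have h4 := h 4; have h5 := h 5; have h6 := h 6; have h7 := h 7
  simp [zetaCoeff, neg] at h0 h3 h4 h5 h6 h7
  have e1 : e 1 = 0 := by
    apply mul_left_cancel₀ (mul_ne_zero two_ne_zero hs)
    linear_combination h7 - D.s x.1 * h4
  have e2 : e 2 = 0 := by
    apply mul_left_cancel₀ (mul_ne_zero two_ne_zero hs)
    linear_combination -h6 - D.s x.1 * h5
  have e0 : e 0 = 0 := by
    apply mul_left_cancel₀ (mul_ne_zero two_ne_zero hs)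
    linear_combination h0 - D.s x.1 * h3 - D.a 0 x.1 * h4 - D.a 1 x.1 * h5
  simp [Fin.sum_univ_three, e0, e1, e2]

/-- A section of both characteristic systems is a section of the isometric embedding system; its
derivative is a sum of terms `θ ∧ β` and of the two decomposable 2-forms. -/
theorem extD_mem_lambdaTwo (hU : IsOpen U) {W : Set (M × F3)} (hW : W ⊆ v.domain) (hW' : IsOpen W)
    {α : OneForm modelN (M × F3)}
    (hα : IsSectionOn (fun x ↦ D.charSystem x ⊓ D.neg.charSystem x) W α) (hx : x ∈ W) :
    extD α x ∈ lambdaTwo (D.charSystem x) ⊔ lambdaTwo (D.neg.charSystem x) := by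
  have h1 : extD α x ∈ differentialIdealTwo v.embeddingSystem x :=
    Submodule.mem_sup_right (Submodule.subset_span ⟨W, hW', hx, α,
      ⟨hα.1, fun y hy ↦ charSystem_inf_charSystem_le (hW hy) (hα.2 y hy)⟩, rfl⟩)
  rw [D.differentialIdealTwo_embeddingSystem hU (hW hx)] at h1
  have hθ (D : RootData v) : v.embeddingSystem x ≤ D.charSystem x := by
    rw [charSystem_eq]
    exact Submodule.span_mono subset_union_left
  have hσ (D : RootData v) : D.sigmaForm x ∈ lambdaTwo (D.charSystem x) := by
    refine Submodule.subset_span ⟨_, ?_, _, ?_, rfl⟩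
    · exact Submodule.subset_span ⟨4, rfl⟩
    · exact Submodule.subset_span ⟨5, rfl⟩
  suffices h : idealTwo (v.embeddingSystem x) ⊔
      Submodule.span ℝ {D.sigmaForm x, D.neg.sigmaForm x} ≤
      lambdaTwo (D.charSystem x) ⊔ lambdaTwo (D.neg.charSystem x) from h h1
  refine sup_le (Submodule.span_le.2 ?_) (Submodule.span_le.2 ?_)
  · rintro _ ⟨a, ha, b, rfl⟩
    obtain ⟨b1, hb1, b2, hb2, rfl⟩ := Submodule.mem_sup.1
      (charSystem_sup_charSystem (D := D) (hW hx) ▸ Submodule.mem_top (x := b))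
    rw [wedge_add_right]
    exact Submodule.add_mem_sup (Submodule.subset_span ⟨a, hθ _ ha, b1, hb1, rfl⟩)
      (Submodule.subset_span ⟨a, hθ _ ha, b2, hb2, rfl⟩)
  · rintro _ (rfl | rfl)
    · exact Submodule.mem_sup_left (hσ D)
    · exact Submodule.mem_sup_right (hσ D.neg)

/-- If `s c = -a aᵀ` on `U`, then the isometric embedding system is Darboux integrable. -/
theorem isDarbouxIntegrable (hU : IsOpen U) (hD : ∀ p ∈ U, D.IsDegenerateAt p) :
    v.IsDarbouxIntegrable :=
  ⟨D.charSystem, D.neg.charSystem,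
    fun x hx ↦ ⟨v.domain, subset_rfl, v.isOpen_domain hU, hx, D.isDecompositionOn hU⟩,
    { sup_left := fun x hx ↦ charSystem_sup_derivedFinal hU hD hx
      sup_right := fun x hx ↦ by
        have := charSystem_sup_derivedFinal (D := D.neg) hU
          (fun p hp ↦ isDegenerateAt_neg (hD p hp)) hx
        rwa [neg_neg] at this
      inf_final := fun x hx ↦ derivedFinal_inf_derivedFinal hU hx
      extD_mem := fun W hW hW' α hα y hy ↦ extD_mem_lambdaTwo hU hW hW' hα hy }⟩

end OrthonormalFrame.RootData

end DarbouxPair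

/-! ### Uniqueness of the singular systems -/

section Decomposition

section Pointwise

variable {E : Type*} [NormedAddCommGroup E] [NormedSpace ℝ E]
  {H : Type*} [TopologicalSpace H] {I : ModelWithCorners ℝ E H}
  {N : Type*} [TopologicalSpace N] [ChartedSpace H N] {x : N}
  {θ θ' : Fin 4 → Covector I x} {σ σ' τ τ' : Fin 2 → Covector I x}

/-- If `σ₁ ∧ σ₂ = a σ'₁ ∧ σ'₂ + b τ'₁ ∧ τ'₂` modulo `θ'` with `a ≠ 0`, then the `σ` lie in the span of the
`θ'` and `σ'`: the left hand side has no mixed components, and `e`, `f` are dual to `σ'`, `τ'`. -/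
theorem span_eq_of_wedge_eq
    (h : LinearIndependent ℝ (Sum.elim θ σ)) (h' : LinearIndependent ℝ (Sum.elim θ' σ'))
    (hJ : Submodule.span ℝ (range θ) = Submodule.span ℝ (range θ'))
    (htop : ∀ a : Covector I x, ∃ (c₁ : Fin 4 → ℝ) (c₂ c₃ : Fin 2 → ℝ),
      a = ∑ i, c₁ i • θ' i + ∑ i, c₂ i • σ' i + ∑ i, c₃ i • τ' i)
    {e f : Fin 2 → TangentSpace I x} (hθe : ∀ i j, θ' i (e j) = 0) (hθf : ∀ i j, θ' i (f j) = 0)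
    (hσe : ∀ i j, σ' i (e j) = if i = j then 1 else 0) (hσf : ∀ i j, σ' i (f j) = 0)
    (hτe : ∀ i j, τ' i (e j) = 0) (hτf : ∀ i j, τ' i (f j) = if i = j then 1 else 0)
    {a b : ℝ} (ha : a ≠ 0)
    (hw : ∀ X Y : TangentSpace I x, (∀ i, θ' i X = 0) → (∀ i, θ' i Y = 0) →
      wedge (σ 0) (σ 1) X Y = a * wedge (σ' 0) (σ' 1) X Y + b * wedge (τ' 0) (τ' 1) X Y) :
    Submodule.span ℝ (range θ ∪ range σ) = Submodule.span ℝ (range θ' ∪ range σ') := by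
  have w1 := hw (e 0) (e 1) (hθe · 0) (hθe · 1)
  have w2 (j) := hw (e 0) (f j) (hθe · 0) (hθf · j)
  have w3 (j) := hw (e 1) (f j) (hθe · 1) (hθf · j)
  simp only [wedge_apply, hσe, hσf, hτe] at w1 w2 w3
  simp at w1 w2 w3
  have w2' : ∀ j, σ 0 (e 0) * σ 1 (f j) - σ 0 (f j) * σ 1 (e 0) = 0 :=
    Fin.forall_fin_two.2 w2
  have w3' : ∀ j, σ 0 (e 1) * σ 1 (f j) - σ 0 (f j) * σ 1 (e 1) = 0 :=
    Fin.forall_fin_two.2 w3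
  have hf (i j) : σ i (f j) = 0 := by
    apply mul_left_cancel₀ ha
    fin_cases i
    · simp only [Fin.zero_eta]
      linear_combination (-(σ 0 (f j))) * w1 + σ 0 (e 1) * w2' j - σ 0 (e 0) * w3' j
    · simp only [Fin.mk_one]
      linear_combination (-(σ 1 (f j))) * w1 + σ 1 (e 1) * w2' j - σ 1 (e 0) * w3' j
  have hle : Submodule.span ℝ (range θ ∪ range σ) ≤ Submodule.span ℝ (range θ' ∪ range σ') := by
    rw [Submodule.span_union, Submodule.span_union, hJ]
    refine sup_le_sup_left (Submodule.span_le.2 ?_) _ |>.trans (sup_le le_sup_left le_rfl)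
    rintro _ ⟨i, rfl⟩
    obtain ⟨c₁, c₂, c₃, hc⟩ := htop (σ i)
    have hc3 (j) : c₃ j = 0 := by
      have := DFunLike.congr_fun hc (f j)
      simp only [_root_.add_apply, _root_.sum_apply, _root_.smul_apply, hθf, hσf, hτf, hf] at this
      simpa using this.symm
    rw [hc]
    simp only [hc3, zero_smul, Finset.sum_const_zero, add_zero]
    exact Submodule.add_mem_sup
      (Submodule.sum_mem _ fun i _ ↦ Submodule.smul_mem _ _ (Submodule.subset_span ⟨i, rfl⟩))
      (Submodule.sum_mem _ fun i _ ↦ Submodule.smul_mem _ _ (Submodule.subset_span ⟨i, rfl⟩))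
  rw [← Set.Sum.elim_range, ← Set.Sum.elim_range] at hle ⊢
  have : FiniteDimensional ℝ (Submodule.span ℝ (range (Sum.elim θ' σ'))) :=
    FiniteDimensional.span_of_finite ℝ (finite_range _)
  refine Submodule.eq_of_le_of_finrank_eq hle ?_
  rw [finrank_span_eq_card h, finrank_span_eq_card h']

/-- A decomposable 2-form in the ideal generated by `θ'`, `σ'₁ ∧ σ'₂` and `τ'₁ ∧ τ'₂` is, modulo
`θ'`, a multiple of one of the last two forms. -/
theorem span_eq_of_wedge_mem (h : LinearIndependent ℝ (Sum.elim θ (Sum.elim σ τ)))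
    (h' : LinearIndependent ℝ (Sum.elim θ' (Sum.elim σ' τ')))
    (htop : Submodule.span ℝ (range (Sum.elim θ' (Sum.elim σ' τ'))) = ⊤)
    (hJ : Submodule.span ℝ (range θ) = Submodule.span ℝ (range θ'))
    (hmem : wedge (σ 0) (σ 1) ∈ idealTwo (Submodule.span ℝ (range θ')) ⊔
      Submodule.span ℝ {wedge (σ' 0) (σ' 1), wedge (τ' 0) (τ' 1)}) :
    Submodule.span ℝ (range θ ∪ range σ) = Submodule.span ℝ (range θ' ∪ range σ') ∨
    Submodule.span ℝ (range θ ∪ range σ) = Submodule.span ℝ (range θ' ∪ range τ') := by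
  obtain ⟨τ₁, hτ₁, τ₂, hτ₂, hsum⟩ := Submodule.mem_sup.1 hmem
  obtain ⟨a, b, rfl⟩ := Submodule.mem_span_pair.1 hτ₂
  have hw : ∀ X Y : TangentSpace I x, (∀ i, θ' i X = 0) → (∀ i, θ' i Y = 0) →
      wedge (σ 0) (σ 1) X Y = a * wedge (σ' 0) (σ' 1) X Y + b * wedge (τ' 0) (τ' 1) X Y := by
    intro X Y hX hY
    rw [← hsum, LinearMap.add_apply, LinearMap.add_apply, apply_eq_zero_of_mem_idealTwo hτ₁
      (eq_zero_of_mem_span_range hX) (eq_zero_of_mem_span_range hY), zero_add]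
    rfl
  have hcomb : ∀ a : Covector I x, ∃ (c₁ : Fin 4 → ℝ) (c₂ c₃ : Fin 2 → ℝ),
      a = ∑ i, c₁ i • θ' i + ∑ i, c₂ i • σ' i + ∑ i, c₃ i • τ' i := by
    intro a
    obtain ⟨c, rfl⟩ := (Submodule.mem_span_range_iff_exists_fun ℝ).1
      (htop ▸ Submodule.mem_top (x := a))
    refine ⟨fun i ↦ c (.inl i), fun i ↦ c (.inr (.inl i)), fun i ↦ c (.inr (.inr i)), ?_⟩
    simp [Fintype.sum_sum_type, add_assoc]
  obtain ⟨e, he⟩ := exists_dual_vectors h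
  obtain ⟨e', he'⟩ := exists_dual_vectors h'
  have hli : LinearIndependent ℝ (Sum.elim θ σ) := by
    have := h.comp (Sum.map id Sum.inl) (Function.injective_id.sumMap Sum.inl_injective)
    convert this using 1
    funext i
    rcases i with i | i <;> rfl
  have h1 : LinearIndependent ℝ (Sum.elim θ' σ') := by
    have := h'.comp (Sum.map id Sum.inl) (Function.injective_id.sumMap Sum.inl_injective)
    convert this using 1
    funext i
    rcases i with i | i <;> rfl
  have h2 : LinearIndependent ℝ (Sum.elim θ' τ') := by
    have := h'.comp (Sum.map id Sum.inr) (Function.injective_id.sumMap Sum.inr_injective)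
    convert this using 1
    funext i
    rcases i with i | i <;> rfl
  have k1 (i j) : θ' i (e' (.inr (.inl j))) = 0 := by simpa using he' (.inl i) (.inr (.inl j))
  have k2 (i j) : θ' i (e' (.inr (.inr j))) = 0 := by simpa using he' (.inl i) (.inr (.inr j))
  have k3 (i j) : σ' i (e' (.inr (.inl j))) = if i = j then 1 else 0 := by
    simpa using he' (.inr (.inl i)) (.inr (.inl j))
  have k4 (i j) : σ' i (e' (.inr (.inr j))) = 0 := by
    simpa using he' (.inr (.inl i)) (.inr (.inr j))
  have k5 (i j) : τ' i (e' (.inr (.inl j))) = 0 := by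
    simpa using he' (.inr (.inr i)) (.inr (.inl j))
  have k6 (i j) : τ' i (e' (.inr (.inr j))) = if i = j then 1 else 0 := by
    simpa using he' (.inr (.inr i)) (.inr (.inr j))
  by_cases ha : a = 0
  · right
    have hb : b ≠ 0 := by
      rintro rfl
      have hann (j) : ∀ i, θ' i (e (.inr (.inl j))) = 0 := by
        intro i
        have hmem' : θ' i ∈ Submodule.span ℝ (range θ) := by
          rw [hJ]
          exact Submodule.subset_span ⟨i, rfl⟩
        exact eq_zero_of_mem_span_range
          (fun i ↦ by simpa using he (.inl i) (.inr (.inl j))) _ hmem'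
      have h3 := hw _ _ (hann 0) (hann 1)
      have h4 (i j) : σ i (e (.inr (.inl j))) = if i = j then 1 else 0 := by
        simpa using he (.inr (.inl i)) (.inr (.inl j))
      rw [wedge_apply, h4, h4, h4, h4, ha] at h3
      simp at h3
    refine span_eq_of_wedge_eq hli h2 hJ (fun a ↦ ?_) k2 k1 k6 k5 k4 k3 hb
      (fun X Y hX hY ↦ (hw X Y hX hY).trans (add_comm _ _))
    obtain ⟨c₁, c₂, c₃, hc⟩ := hcomb a
    exact ⟨c₁, c₃, c₂, hc.trans (add_right_comm _ _ _)⟩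
  · exact Or.inl (span_eq_of_wedge_eq hli h1 hJ hcomb k1 k2 k3 k4 k5 k6 ha hw)

end Pointwise

variable {M : Type*} [TopologicalSpace M] [ChartedSpace E2 M] [IsManifold 𝓘(ℝ, E2) ∞ M]

namespace OrthonormalFrame.RootData

variable {g : Metric M} {U : Set M} {v : OrthonormalFrame g U} {D : RootData v} {x : M × F3}

theorem charSystem_ne (hx : x ∈ v.domain) : D.charSystem x ≠ D.neg.charSystem x := by
  intro h
  have h1 := charSystem_sup_charSystem (D := D) hx
  rw [← h, sup_idem] at h1
  obtain ⟨X, hX⟩ := exists_vector hx ![0, 0, 0, 0, 0, -D.s x.1, 1, 0]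
  have h2 : v.coframe 6 x ∈ D.charSystem x := h1 ▸ Submodule.mem_top
  have h3 := eq_zero_of_mem_span_range (X := X) (fun i ↦ by
    rw [comb_apply, Fin.sum_univ_eight]; fin_cases i <;> simp [hX, charCoeff]) _ h2
  rw [hX] at h3
  simp at h3

/-- The only possible singular systems of a decomposition are the two characteristic systems. -/
theorem eq_charSystem_of_isDecompositionOn (D : RootData v) (hU : IsOpen U)
    {V₁ V₂ : Pfaffian modelN (M × F3)} {W : Set (M × F3)}
    (h : IsDecompositionOn v.embeddingSystem V₁ V₂ W) (hxW : x ∈ W) (hx : x ∈ v.domain) :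
    (V₁ x = D.charSystem x ∧ V₂ x = D.neg.charSystem x) ∨
    (V₁ x = D.neg.charSystem x ∧ V₂ x = D.charSystem x) := by
  obtain ⟨r, p, q, s, t, θ, σ, τ, f, h, Φ, Ψ, hp, hq, -, -, -, -, -, -, -, hall⟩ := h
  obtain ⟨hli, htop, hΦ, hΨ, hJ, hI, hV₁, hV₂, -, -⟩ := hall x hxW
  have hr : r = 4 := by
    have h1 := finrank_span_eq_card (hli.comp Sum.inl Sum.inl_injective)
    have h2 := finrank_span_eq_card (linearIndependent_thetaCoeff (D := D) hx)
    have h3 : v.embeddingSystem x = Submodule.span ℝ (range fun i ↦ v.comb (D.thetaCoeff i) x) :=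
      embeddingSystem_eq D x
    rw [← h3, hJ] at h2
    simpa using h1.symm.trans h2
  have hn : r + (p + q) = 8 := by
    have h1 := finrank_span_eq_card hli
    have h2 := finrank_span_eq_card (linearIndependent_adaptedCoeff (D := D) hx)
    rw [htop] at h1
    rw [span_adaptedCoeff hx] at h2
    simpa using h1.symm.trans h2
  obtain rfl : p = 2 := by omega
  obtain rfl : q = 2 := by omega
  subst hr
  -- The 2-form of each root is decomposable and lies in the ideal generated by `θ`, `Φ` and `Ψ`.
  have key (D : RootData v) : D.charSystem x = V₁ x ∨ D.charSystem x = V₂ x := by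
    rw [hV₁, hV₂, D.charSystem_eq]
    refine span_eq_of_wedge_mem (τ := fun i ↦ v.comb (D.neg.sigmaCoeff i) x) ?_ hli htop hJ ?_
    · rw [adaptedCoeff_family]
      exact linearIndependent_adaptedCoeff hx
    · have h1 : D.sigmaForm x ∈ differentialIdealTwo v.embeddingSystem x := by
        rw [D.differentialIdealTwo_embeddingSystem hU hx]
        exact Submodule.mem_sup_right (Submodule.subset_span (Or.inl rfl))
      rw [hI, hJ] at h1
      suffices h2 : Submodule.span ℝ (range (fun b ↦ Φ b x) ∪ range (fun c ↦ Ψ c x)) ≤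
          Submodule.span ℝ {wedge (σ 0 x) (σ 1 x), wedge (τ 0 x) (τ 1 x)} from
        sup_le_sup_left h2 _ h1
      refine Submodule.span_le.2 ?_
      have hdec (c : Fin 2 → Fin 2 → ℝ) (σ : Fin 2 → Covector modelN x) :
          ∑ i, ∑ j, c i j • wedge (σ i) (σ j) = (c 0 1 + (-1 : ℝ) * c 1 0) • wedge (σ 0) (σ 1) := by
        ext X Y
        simp only [Fin.sum_univ_two, LinearMap.add_apply, LinearMap.smul_apply, wedge_apply,
          smul_eq_mul]
        ring
      rintro _ (⟨b, rfl⟩ | ⟨c, rfl⟩)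
      · simp only [hΦ]
        rw [hdec]
        exact Submodule.smul_mem _ _ (Submodule.subset_span (Or.inl rfl))
      · simp only [hΨ]
        rw [hdec]
        exact Submodule.smul_mem _ _ (Submodule.subset_span (Or.inr rfl))
  have hne := charSystem_ne (D := D) hx
  rcases key D with h1 | h1 <;> rcases key D.neg with h2 | h2
  · exact absurd (h1.trans h2.symm) hne
  · exact Or.inl ⟨h1.symm, h2.symm⟩
  · exact Or.inr ⟨h2.symm, h1.symm⟩
  · exact absurd (h1.trans h2.symm) hne

theorem sum_mem_charSystem_iff (hx : x ∈ v.domain) (c : Fin 8 → ℝ) :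
    ∑ k, c k • v.coframe k x ∈ D.charSystem x ↔
      c 6 - D.s x.1 * c 5 = 0 ∧ c 7 + D.s x.1 * c 4 = 0 := by
  constructor
  · intro h
    obtain ⟨X, hX⟩ := exists_vector hx ![0, 0, 0, 0, 0, -D.s x.1, 1, 0]
    obtain ⟨Y, hY⟩ := exists_vector hx ![0, 0, 0, 0, D.s x.1, 0, 0, 1]
    have h1 := eq_zero_of_mem_span_range (X := X) (fun i ↦ by
      rw [comb_apply, Fin.sum_univ_eight]; fin_cases i <;> simp [hX, charCoeff]) _ h
    have h2 := eq_zero_of_mem_span_range (X := Y) (fun i ↦ by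
      rw [comb_apply, Fin.sum_univ_eight]; fin_cases i <;> simp [hY, charCoeff]) _ h
    rw [_root_.sum_apply] at h1 h2
    simp [Fin.sum_univ_eight, hX, hY] at h1 h2
    exact ⟨by linear_combination h1, by linear_combination h2⟩
  · rintro ⟨h1, h2⟩
    have h1' : c 6 = D.s x.1 * c 5 := by linear_combination h1
    have h2' : c 7 = -D.s x.1 * c 4 := by linear_combination h2
    refine mem_span_comb ![c 0, c 1, c 2, c 3, c 4, c 5] fun X ↦ ?_
    rw [_root_.sum_apply]
    simp [Fin.sum_univ_eight, Fin.sum_univ_six, comb_apply, charCoeff, h1', h2']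
    ring

/-- Membership in a characteristic system is a closed condition. -/
theorem eventually_notMem_charSystem (hU : IsOpen U) {W : Set (M × F3)} (hW : IsOpen W)
    (hWU : W ⊆ v.domain) {α : OneForm modelN (M × F3)} (hα : SmoothOneFormOn α W) (hx : x ∈ W)
    (h : α x ∉ D.charSystem x) : ∀ᶠ y in 𝓝 x, α y ∉ D.charSystem y := by
  obtain ⟨c, hc, hαc⟩ := exists_coefficients hW hα
    (fun k ↦ (v.smooth_coframe hU k).mono hWU) hx (linearIndependent_coframe (hWU hx))
    fun y hy ↦ by
      obtain ⟨c, hc⟩ := span_coframe (hWU hy) (α y)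
      refine (Submodule.mem_span_range_iff_exists_fun ℝ).2 ⟨c, ?_⟩
      ext X
      rw [hc, _root_.sum_apply]
      rfl
  have hs : ContinuousAt (fun y : M × F3 ↦ D.s y.1) x :=
    ((D.smooth_s.continuousOn.continuousAt (hU.mem_nhds (hWU hx).1)).comp
      continuous_fst.continuousAt)
  have hcc (k) : ContinuousAt (c k) x := (hc k).continuousAt
  rw [hαc.self_of_nhds, sum_mem_charSystem_iff (hWU hx), not_and_or] at h
  have hev : ∀ᶠ y in 𝓝 x, ¬ (c 6 y - D.s y.1 * c 5 y = 0 ∧ c 7 y + D.s y.1 * c 4 y = 0) := by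
    rcases h with h | h
    · filter_upwards [((hcc 6).sub (hs.mul (hcc 5))).eventually_ne h] with y hy hy'
      exact hy hy'.1
    · filter_upwards [((hcc 7).add (hs.mul (hcc 4))).eventually_ne h] with y hy hy'
      exact hy hy'.2
  filter_upwards [hαc, hev, hW.mem_nhds hx] with y hy hy' hyW
  rwa [hy, sum_mem_charSystem_iff (hWU hyW) (fun k ↦ c k y)]

/-- A singular system cannot switch between the two characteristic systems near a point: it has a smooth
section which is not in the other characteristic system at the point. -/
theorem eventually_eq_charSystem (D : RootData v) (hU : IsOpen U)
    {V₁ V₂ : Pfaffian modelN (M × F3)} {W : Set (M × F3)} (hW : IsOpen W) (hWU : W ⊆ v.domain)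
    (h : IsDecompositionOn v.embeddingSystem V₁ V₂ W) (hx : x ∈ W)
    (hV : V₁ x = D.charSystem x) : ∀ᶠ y in 𝓝 x, V₁ y = D.charSystem y := by
  have h' := h
  obtain ⟨r, p, q, s, t, θ, σ, τ, f, k, Φ, Ψ, -, -, -, -, hθ, hσ, -, -, -, hall⟩ := h
  have hle : ¬ V₁ x ≤ D.neg.charSystem x := by
    intro hle
    rw [hV] at hle
    have h1 := charSystem_sup_charSystem (D := D) (hWU hx)
    rw [sup_eq_right.2 hle] at h1
    have h2 := charSystem_inf_charSystem_le (D := D) (hWU hx)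
    rw [inf_eq_left.2 hle] at h2
    have h3 : v.comb (D.charCoeff 4) x ∈ v.embeddingSystem x :=
      h2 (Submodule.subset_span ⟨4, rfl⟩)
    obtain ⟨X, hX⟩ := exists_vector (hWU hx) ![0, 0, 0, 0, 1, 0, 0, 0]
    have h4 := eq_zero_of_mem_span_range (X := X) (fun i ↦ by
      rw [theta_apply, hX]; fin_cases i <;> rfl) _ h3
    rw [comb_apply, Fin.sum_univ_eight] at h4
    simp [hX, charCoeff] at h4
  have hα : ∃ α : OneForm modelN (M × F3), SmoothOneFormOn α W ∧ (∀ y ∈ W, α y ∈ V₁ y) ∧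
      α x ∉ D.neg.charSystem x := by
    by_contra! hc
    apply hle
    rw [(hall x hx).2.2.2.2.2.2.1, Submodule.span_le]
    have hmem : ∀ y ∈ W, ∀ a ∈ range (fun i ↦ θ i y) ∪ range fun a ↦ σ a y, a ∈ V₁ y := by
      intro y hy a ha
      rw [(hall y hy).2.2.2.2.2.2.1]
      exact Submodule.subset_span ha
    rintro _ (⟨i, rfl⟩ | ⟨i, rfl⟩)
    · exact hc _ (hθ i) fun y hy ↦ hmem y hy _ (Or.inl ⟨i, rfl⟩)
    · exact hc _ (hσ i) fun y hy ↦ hmem y hy _ (Or.inr ⟨i, rfl⟩)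
  obtain ⟨α, hα, hαV, hαx⟩ := hα
  filter_upwards [eventually_notMem_charSystem hU hW hWU hα hx hαx, hW.mem_nhds hx] with y hy hyW
  rcases eq_charSystem_of_isDecompositionOn D hU h' hyW (hWU hyW) with h1 | h1
  · exact h1.1
  · exact absurd (h1.1 ▸ hαV y hyW) hy

/-- The derived flag only depends on the germ of a system, so that the singular system `V₁` may be
replaced by the characteristic system with which it agrees near the point. -/
theorem isDegenerateAt_of_eq (D : RootData v) (hU : IsOpen U)
    {V₁ V₂ : Pfaffian modelN (M × F3)} {W : Set (M × F3)} (hW : IsOpen W) (hWU : W ⊆ v.domain)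
    (h : IsDecompositionOn v.embeddingSystem V₁ V₂ W) (hx : x ∈ W)
    (hV₁ : V₁ x = D.charSystem x) (hV₂ : V₂ x = D.neg.charSystem x)
    (htop : V₂ x ⊔ derivedFinal V₁ x = ⊤) : D.IsDegenerateAt x.1 := by
  refine isDegenerateAt_of_sup_eq_top hU (hWU hx) (top_unique ?_)
  rw [← htop, hV₂]
  refine sup_le_sup_left ?_ _
  obtain ⟨W', hW', hW'o, hxW'⟩ := eventually_nhds_iff.1
    (eventually_eq_charSystem D hU hW hWU h hx hV₁)
  exact iInf_mono fun n ↦ derivedFlag_le_derivedFlag hW'o (fun y hy ↦ (hW' y hy).le) n x hxW'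

/-- The isometric embedding system is Darboux integrable only if `s c = -a aᵀ` on `U`. -/
theorem isDegenerateAt_of_isDarbouxIntegrable (D : RootData v) (hU : IsOpen U)
    (h : v.IsDarbouxIntegrable) {p : M} (hp : p ∈ U) : D.IsDegenerateAt p := by
  obtain ⟨V₁, V₂, hdec, hpair⟩ := h
  have hx : ((p, (0, 1)) : M × F3) ∈ v.domain := ⟨hp, mem_univ _⟩
  obtain ⟨W, hWU, hW, hxW, hd⟩ := hdec _ hx
  rcases eq_charSystem_of_isDecompositionOn D hU hd hxW hx with ⟨h1, h2⟩ | ⟨h1, h2⟩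
  · exact isDegenerateAt_of_eq D hU hW hWU hd hxW h1 h2 (hpair.sup_right _ hx)
  · have := isDegenerateAt_neg (isDegenerateAt_of_eq D.neg hU hW hWU hd hxW h1
      (by rw [neg_neg]; exact h2) (hpair.sup_right _ hx))
    rwa [neg_neg] at this

end OrthonormalFrame.RootData

end Decomposition

/-! ### The equations for the curvature -/

section RootOfCurvature

variable {M : Type*} [TopologicalSpace M] [ChartedSpace E2 M] [IsManifold 𝓘(ℝ, E2) ∞ M]

namespace OrthonormalFrame

variable {g : Metric M} {U : Set M} {v : OrthonormalFrame g U}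

theorem covDeriv_comp {u : M → ℝ} {F : ℝ → ℝ} {F' : ℝ} {p : M}
    (hu : MDifferentiableAt 𝓘(ℝ, E2) 𝓘(ℝ, ℝ) u p) (hF : HasDerivAt F F' (u p)) (i : Fin 2) :
    v.covDeriv (fun x ↦ F (u x)) i p = F' * v.covDeriv u i p :=
  DFunLike.congr_fun (differential_real_comp hu hF) (v.vec i p)

theorem q_pos {p : M} (hK : v.gaussCurvature p < 0) : 0 < v.q p :=
  Real.rpow_pos_of_pos (neg_pos.2 hK) _

theorem q_rpow_mul_self {p : M} (hK : v.gaussCurvature p < 0) :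
    v.q p ^ (-(2 / 3) : ℝ) * v.q p ^ (-(2 / 3) : ℝ) = -v.gaussCurvature p := by
  have hk : 0 < -v.gaussCurvature p := neg_pos.2 hK
  rw [← Real.rpow_add (q_pos hK), q, ← Real.rpow_mul hk.le]
  norm_num

theorem q_mul_gaussCurvature {p : M} (hK : v.gaussCurvature p < 0) :
    v.q p * v.gaussCurvature p = -v.q p ^ (-(1 / 3) : ℝ) := by
  have hq := q_pos hK
  have h : v.q p * (v.q p ^ (-(2 / 3) : ℝ) * v.q p ^ (-(2 / 3) : ℝ)) = v.q p ^ (-(1 / 3) : ℝ) := by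
    conv_lhs => rw [← Real.rpow_add hq]
    conv_lhs => enter [1]; rw [← Real.rpow_one (v.q p)]
    rw [← Real.rpow_add hq]
    norm_num
  rw [q_rpow_mul_self hK] at h
  linear_combination -h

variable (v) in
/-- The components `-qᵢ / (3q)` of `ds / (2s)`, where `s = q^{-2/3}`. -/
def logDeriv (i : Fin 2) : M → ℝ := v.covDeriv v.q i * fun p ↦ -(1 / 3) * (v.q p)⁻¹

theorem logDeriv_apply (i : Fin 2) (p : M) :
    v.logDeriv i p = v.covDeriv v.q i p * (-(1 / 3) * (v.q p)⁻¹) := rfl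

theorem covDeriv_logDeriv (hU : IsOpen U) (hK : ∀ p ∈ U, v.gaussCurvature p < 0) {p : M}
    (hp : p ∈ U) (i j : Fin 2) : v.covDeriv (v.logDeriv i) j p =
      -(1 / 3) * (v.q p)⁻¹ * v.covDeriv (v.covDeriv v.q i) j p +
        3 * v.logDeriv i p * v.logDeriv j p := by
  have hq := q_pos (hK p hp)
  have hsm := v.contMDiffOn_q hU hK
  have hqd := mdifferentiableAt_of_contMDiffOn hU hsm hp
  have hF := (hasDerivAt_inv hq.ne').const_mul (-(1 / 3) : ℝ)
  have hd : MDifferentiableAt 𝓘(ℝ, E2) 𝓘(ℝ, ℝ) (fun p ↦ -(1 / 3) * (v.q p)⁻¹) p :=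
    (hF.differentiableAt.mdifferentiableAt).comp p hqd
  refine (covDeriv_mul (mdifferentiableAt_of_contMDiffOn hU
    (v.contMDiffOn_covDeriv hU hsm i) hp) hd j).trans ?_
  rw [covDeriv_comp hqd hF]
  simp only [logDeriv_apply]
  field_simp
  ring

theorem covDeriv_covDeriv_zero (u : M → ℝ) (j : Fin 2) (p : M) :
    v.covDeriv (v.covDeriv u 0) j p =
      v.covDerivTwo u 0 j p - v.covDeriv u 1 p * v.etaConn p (v.vec j p) := by
  simp [covDerivTwo, etaMatrix]

theorem covDeriv_covDeriv_one (u : M → ℝ) (j : Fin 2) (p : M) :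
    v.covDeriv (v.covDeriv u 1) j p =
      v.covDerivTwo u 1 j p + v.covDeriv u 0 p * v.etaConn p (v.vec j p) := by
  simp [covDerivTwo, etaMatrix]

variable (v) in
theorem contMDiffOn_q_rpow (hU : IsOpen U) (hK : ∀ p ∈ U, v.gaussCurvature p < 0) :
    ContMDiffOn 𝓘(ℝ, E2) 𝓘(ℝ, ℝ) ∞ (fun p ↦ v.q p ^ (-(2 / 3) : ℝ)) U := by
  intro p hp
  have h : ContDiffAt ℝ ∞ (fun t : ℝ ↦ t ^ (-(2 / 3) : ℝ)) (v.q p) :=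
    contDiffAt_id.rpow_const_of_ne (q_pos (hK p hp)).ne'
  exact h.contMDiffAt.comp_contMDiffWithinAt p (v.contMDiffOn_q hU hK p hp)

variable (v) in
theorem contMDiffOn_logDeriv (hU : IsOpen U) (hK : ∀ p ∈ U, v.gaussCurvature p < 0) (i : Fin 2) :
    ContMDiffOn 𝓘(ℝ, E2) 𝓘(ℝ, ℝ) ∞ (v.logDeriv i) U :=
  (v.contMDiffOn_covDeriv hU (v.contMDiffOn_q hU hK) i).mul (contMDiffOn_const.mul
    ((v.contMDiffOn_q hU hK).inv₀ fun p hp ↦ (q_pos (hK p hp)).ne'))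

variable (v) in
/-- The square root `s = q^{-2/3}` of `-K`; the functions `c` are obtained by solving the equations
`aᵢⱼ = s² δᵢⱼ + aᵢ aⱼ - 2 s cᵢⱼ` for them, where `aᵢ = -qᵢ / (3q)`. -/
def rootData (hU : IsOpen U) (hK : ∀ p ∈ U, v.gaussCurvature p < 0) : RootData v where
  s p := v.q p ^ (-(2 / 3) : ℝ)
  a := v.logDeriv
  c := ![fun p ↦ (-v.gaussCurvature p - 2 * v.logDeriv 0 p * v.logDeriv 0 p +
      v.covDerivTwo v.q 0 0 p / (3 * v.q p)) / (2 * v.q p ^ (-(2 / 3) : ℝ)),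
    fun p ↦ (-2 * v.logDeriv 0 p * v.logDeriv 1 p +
      v.covDerivTwo v.q 0 1 p / (3 * v.q p)) / (2 * v.q p ^ (-(2 / 3) : ℝ)),
    fun p ↦ (-v.gaussCurvature p - 2 * v.logDeriv 1 p * v.logDeriv 1 p +
      v.covDerivTwo v.q 1 1 p / (3 * v.q p)) / (2 * v.q p ^ (-(2 / 3) : ℝ))]
  smooth_s := v.contMDiffOn_q_rpow hU hK
  smooth_a := v.contMDiffOn_logDeriv hU hK
  smooth_c i := by
    have hq := v.contMDiffOn_q hU hK
    have hKs := (v.contMDiffOn_gaussCurvature hU).neg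
    have h2 (i j) : ContMDiffOn 𝓘(ℝ, E2) 𝓘(ℝ, ℝ) ∞
        (fun p ↦ v.covDerivTwo v.q i j p / (3 * v.q p)) U :=
      (v.contMDiffOn_covDerivTwo hU hq i j).div₀ (contMDiffOn_const.mul hq)
        fun p hp ↦ mul_ne_zero three_ne_zero (q_pos (hK p hp)).ne'
    have ha (c : ℝ) (i j) : ContMDiffOn 𝓘(ℝ, E2) 𝓘(ℝ, ℝ) ∞
        (fun p ↦ c * v.logDeriv i p * v.logDeriv j p) U :=
      (contMDiffOn_const.mul (v.contMDiffOn_logDeriv hU hK i)).mul (v.contMDiffOn_logDeriv hU hK j)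
    have hs : ContMDiffOn 𝓘(ℝ, E2) 𝓘(ℝ, ℝ) ∞ (fun p ↦ 2 * v.q p ^ (-(2 / 3) : ℝ)) U :=
      contMDiffOn_const.mul (v.contMDiffOn_q_rpow hU hK)
    have hs0 : ∀ p ∈ U, 2 * v.q p ^ (-(2 / 3) : ℝ) ≠ 0 := fun p hp ↦
      mul_ne_zero two_ne_zero (Real.rpow_pos_of_pos (q_pos (hK p hp)) _).ne'
    fin_cases i
    · exact ((hKs.sub (ha 2 0 0)).add (h2 0 0)).div₀ hs hs0
    · exact ((ha (-2) 0 1).add (h2 0 1)).div₀ hs hs0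
    · exact ((hKs.sub (ha 2 1 1)).add (h2 1 1)).div₀ hs hs0
  s_ne_zero p hp := (Real.rpow_pos_of_pos (q_pos (hK p hp)) _).ne'
  gaussCurvature_eq p hp := by
    have := q_rpow_mul_self (hK p hp)
    rw [sq]
    linear_combination this
  covDeriv_s p hp i := by
    have hq := q_pos (hK p hp)
    have hqd := mdifferentiableAt_of_contMDiffOn hU (v.contMDiffOn_q hU hK) hp
    rw [covDeriv_comp hqd (Real.hasDerivAt_rpow_const (Or.inl hq.ne')), Real.rpow_sub_one hq.ne']
    simp only [logDeriv_apply]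
    field_simp
  covDeriv_a_zero_zero p hp := by
    have hq := q_pos (hK p hp)
    have hs := (Real.rpow_pos_of_pos hq (-(2 / 3) : ℝ)).ne'
    have h1 := q_rpow_mul_self (hK p hp)
    have hdiv (X : ℝ) : X / (3 * v.q p) = 1 / 3 * (v.q p)⁻¹ * X := by field_simp
    rw [covDeriv_logDeriv hU hK hp, covDeriv_covDeriv_zero]
    simp only [Matrix.cons_val, mul_div_cancel₀ _ (mul_ne_zero two_ne_zero hs)]
    rw [hdiv]
    simp only [logDeriv_apply]
    linear_combination -h1
  covDeriv_a_zero_one p hp := by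
    have hq := q_pos (hK p hp)
    have hs := (Real.rpow_pos_of_pos hq (-(2 / 3) : ℝ)).ne'
    have hdiv (X : ℝ) : X / (3 * v.q p) = 1 / 3 * (v.q p)⁻¹ * X := by field_simp
    rw [covDeriv_logDeriv hU hK hp, covDeriv_covDeriv_zero]
    simp only [Matrix.cons_val, mul_div_cancel₀ _ (mul_ne_zero two_ne_zero hs)]
    rw [hdiv]
    simp only [logDeriv_apply]
    ring
  covDeriv_a_one_zero p hp := by
    have hq := q_pos (hK p hp)
    have hs := (Real.rpow_pos_of_pos hq (-(2 / 3) : ℝ)).ne'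
    have hdiv (X : ℝ) : X / (3 * v.q p) = 1 / 3 * (v.q p)⁻¹ * X := by field_simp
    rw [covDeriv_logDeriv hU hK hp, covDeriv_covDeriv_one]
    rw [← covDerivTwo_symm hU hp (v.contMDiffOn_q hU hK)]
    simp only [Matrix.cons_val, mul_div_cancel₀ _ (mul_ne_zero two_ne_zero hs)]
    rw [hdiv]
    simp only [logDeriv_apply]
    ring
  covDeriv_a_one_one p hp := by
    have hq := q_pos (hK p hp)
    have hs := (Real.rpow_pos_of_pos hq (-(2 / 3) : ℝ)).ne'
    have h1 := q_rpow_mul_self (hK p hp)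
    have hdiv (X : ℝ) : X / (3 * v.q p) = 1 / 3 * (v.q p)⁻¹ * X := by field_simp
    rw [covDeriv_logDeriv hU hK hp, covDeriv_covDeriv_one]
    simp only [Matrix.cons_val, mul_div_cancel₀ _ (mul_ne_zero two_ne_zero hs)]
    rw [hdiv]
    simp only [logDeriv_apply]
    linear_combination -h1

/-- Since `2 s cᵢⱼ = s² δᵢⱼ - 2 aᵢ aⱼ + qᵢⱼ / (3q)`, the degeneracy condition amounts to
`qᵢⱼ = -3 q s² δᵢⱼ = -3 q^{-1/3} δᵢⱼ`. -/
theorem isDegenerateAt_rootData_iff (hU : IsOpen U) (hK : ∀ p ∈ U, v.gaussCurvature p < 0) {p : M}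
    (hp : p ∈ U) : (v.rootData hU hK).IsDegenerateAt p ↔
      v.covDerivTwo v.q 0 0 p = -3 * v.q p ^ (-(1 / 3) : ℝ) ∧
      v.covDerivTwo v.q 1 1 p = -3 * v.q p ^ (-(1 / 3) : ℝ) ∧
      v.covDerivTwo v.q 0 1 p = 0 := by
  have hq := q_pos (hK p hp)
  have hs := Real.rpow_pos_of_pos hq (-(2 / 3) : ℝ)
  have h1 := q_mul_gaussCurvature (hK p hp)
  have hcancel (X : ℝ) : v.q p ^ (-(2 / 3) : ℝ) * (X / (2 * v.q p ^ (-(2 / 3) : ℝ))) = X / 2 := by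
    field_simp
  simp only [RootData.IsDegenerateAt, rootData, Matrix.cons_val, hcancel]
  refine ⟨fun ⟨e0, e1, e2⟩ ↦ ⟨?_, ?_, ?_⟩, fun ⟨e0, e2, e1⟩ ↦ ⟨?_, ?_, ?_⟩⟩
  · field_simp at e0
    linear_combination e0 + 3 * h1
  · field_simp at e2
    linear_combination e2 + 3 * h1
  · field_simp at e1
    linear_combination e1
  · rw [e0]
    field_simp
    linear_combination -h1
  · rw [e1]
    ring
  · rw [e2]
    field_simp
    linear_combination -h1

/-- For a negatively curved metric, Darboux integrability of the isometric embedding system is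
equivalent to the equations for `q`. -/
theorem isDarbouxIntegrable_iff (hU : IsOpen U) (hK : ∀ p ∈ U, v.gaussCurvature p < 0) :
    v.IsDarbouxIntegrable ↔ v.SatisfiesQEquations := by
  constructor
  · intro h p hp
    obtain ⟨h0, h1, h2⟩ := (isDegenerateAt_rootData_iff hU hK hp).1
      ((v.rootData hU hK).isDegenerateAt_of_isDarbouxIntegrable hU h hp)
    exact ⟨h0, h1, h2, (covDerivTwo_symm hU hp (v.contMDiffOn_q hU hK)).symm.trans h2⟩
  · intro h
    refine RootData.isDarbouxIntegrable (D := v.rootData hU hK) hU fun p hp ↦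
      (isDegenerateAt_rootData_iff hU hK hp).2 ?_
    obtain ⟨h0, h1, h2, -⟩ := h p hp
    exact ⟨h0, h1, h2⟩

end OrthonormalFrame

end RootOfCurvature

/-! ### Change of frame -/

section ChangeOfFrame

variable {M : Type*} [TopologicalSpace M] [ChartedSpace E2 M] [IsManifold 𝓘(ℝ, E2) ∞ M]

namespace OrthonormalFrame

variable {g : Metric M} {U : Set M} {v w : OrthonormalFrame g U}

/-- The orthogonal change of frame from `w` to `v`: the rotation with cosine `c` and sine `s`, followed
by multiplication of the second vector by the determinant `d = ±1`. -/
structure Rotation (v w : OrthonormalFrame g U) where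
  /-- The cosine of the angle. -/
  c : M → ℝ
  /-- The sine of the angle. -/
  s : M → ℝ
  /-- The determinant. -/
  d : M → ℝ
  smooth_c : ContMDiffOn 𝓘(ℝ, E2) 𝓘(ℝ, ℝ) ∞ c U
  smooth_s : ContMDiffOn 𝓘(ℝ, E2) 𝓘(ℝ, ℝ) ∞ s U
  smooth_d : ContMDiffOn 𝓘(ℝ, E2) 𝓘(ℝ, ℝ) ∞ d U
  sq_add_sq : ∀ p ∈ U, c p * c p + s p * s p = 1
  d_mul_d : ∀ p ∈ U, d p * d p = 1
  eta_zero : ∀ p ∈ U, ∀ X, v.eta 0 p X = c p * w.eta 0 p X + s p * w.eta 1 p X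
  eta_one : ∀ p ∈ U, ∀ X, v.eta 1 p X = d p * (-s p * w.eta 0 p X + c p * w.eta 1 p X)

theorem nonempty_rotation (v w : OrthonormalFrame g U) : Nonempty (Rotation v w) := by
  have hsm (i j) := contMDiffOn_metric g (v.smooth i) (w.smooth j)
  have hrel : ∀ p ∈ U, ∀ i j, v.eta i p (w.vec 0 p) * v.eta j p (w.vec 0 p) +
      v.eta i p (w.vec 1 p) * v.eta j p (w.vec 1 p) = if i = j then 1 else 0 := by
    intro p hp i j
    have h1 := covector_eq (v := w) hp (v.eta i p) (v.vec j p)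
    have h2 (k) : w.eta k p (v.vec j p) = v.eta j p (w.vec k p) := g.symm _ _ _
    rw [eta_vec hp, h2, h2] at h1
    exact h1.symm
  have hd : ∀ p ∈ U, ∀ X, v.eta 1 p X = _ := fun p hp X ↦ covector_eq (v := w) hp (v.eta 1 p) X
  refine ⟨⟨fun p ↦ v.eta 0 p (w.vec 0 p), fun p ↦ v.eta 0 p (w.vec 1 p),
    fun p ↦ v.eta 0 p (w.vec 0 p) * v.eta 1 p (w.vec 1 p) -
      v.eta 0 p (w.vec 1 p) * v.eta 1 p (w.vec 0 p), hsm 0 0, hsm 0 1,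
    ((hsm 0 0).mul (hsm 1 1)).sub ((hsm 0 1).mul (hsm 1 0)), fun p hp ↦ ?_, fun p hp ↦ ?_,
    fun p hp X ↦ covector_eq (v := w) hp (v.eta 0 p) X, fun p hp X ↦ ?_⟩⟩
  · simpa using hrel p hp 0 0
  · have h00 := hrel p hp 0 0; have h01 := hrel p hp 0 1; have h11 := hrel p hp 1 1
    simp at h00 h01 h11
    generalize v.eta 0 p (w.vec 0 p) = a at *
    generalize v.eta 0 p (w.vec 1 p) = b at *
    generalize v.eta 1 p (w.vec 0 p) = c at *
    generalize v.eta 1 p (w.vec 1 p) = d at *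
    linear_combination (c * c + d * d) * h00 + h11 - (a * c + b * d) * h01
  · rw [hd p hp]
    have h00 := hrel p hp 0 0; have h01 := hrel p hp 0 1
    simp at h00 h01
    generalize v.eta 0 p (w.vec 0 p) = a at *
    generalize v.eta 0 p (w.vec 1 p) = b at *
    generalize v.eta 1 p (w.vec 0 p) = c at *
    generalize v.eta 1 p (w.vec 1 p) = d at *
    linear_combination (-(c * w.eta 0 p X + d * w.eta 1 p X)) * h00 +
      (a * w.eta 0 p X + b * w.eta 1 p X) * h01

/-- The connection form is determined by the structure equations. -/
theorem etaConn_eq_of {p : M} (hp : p ∈ U) {α : Covector 𝓘(ℝ, E2) p}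
    (h0 : ∀ A B, extD (v.eta 0) p A B = -(α A * v.eta 1 p B - α B * v.eta 1 p A))
    (h1 : ∀ A B, extD (v.eta 1) p A B = α A * v.eta 0 p B - α B * v.eta 0 p A)
    (X : TangentSpace 𝓘(ℝ, E2) p) : v.etaConn p X = α X := by
  have h : v.etaConn p X = -extD (v.eta 0) p (v.vec 0 p) (v.vec 1 p) * v.eta 0 p X -
      extD (v.eta 1) p (v.vec 0 p) (v.vec 1 p) * v.eta 1 p X := rfl
  rw [h, h0, h1, covector_eq (v := v) hp α X]
  simp only [eta_vec hp]
  simp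

namespace Rotation

variable (R : Rotation v w) {p : M}

theorem mdifferentiableAt_c (hU : IsOpen U) (hp : p ∈ U) :
    MDifferentiableAt 𝓘(ℝ, E2) 𝓘(ℝ, ℝ) R.c p := mdifferentiableAt_of_contMDiffOn hU R.smooth_c hp

theorem mdifferentiableAt_s (hU : IsOpen U) (hp : p ∈ U) :
    MDifferentiableAt 𝓘(ℝ, E2) 𝓘(ℝ, ℝ) R.s p := mdifferentiableAt_of_contMDiffOn hU R.smooth_s hp

theorem mdifferentiableAt_d (hU : IsOpen U) (hp : p ∈ U) :
    MDifferentiableAt 𝓘(ℝ, E2) 𝓘(ℝ, ℝ) R.d p := mdifferentiableAt_of_contMDiffOn hU R.smooth_d hp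

theorem differential_d (hU : IsOpen U) (hp : p ∈ U) (X : TangentSpace 𝓘(ℝ, E2) p) :
    differential 𝓘(ℝ, E2) R.d p X = 0 := by
  have hd := R.mdifferentiableAt_d hU hp
  have h : differential 𝓘(ℝ, E2) (fun y ↦ R.d y * R.d y) p = 0 := by
    rw [← differential_const (I := 𝓘(ℝ, E2)) 1 p]
    exact differential_congr (Filter.mem_of_superset (hU.mem_nhds hp) R.d_mul_d)
  rw [differential_mul hd hd] at h
  have h1 : R.d p * differential 𝓘(ℝ, E2) R.d p X + R.d p * differential 𝓘(ℝ, E2) R.d p X = 0 :=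
    DFunLike.congr_fun h X
  linear_combination (R.d p / 2) * h1 - differential 𝓘(ℝ, E2) R.d p X * R.d_mul_d p hp

theorem differential_sq (hU : IsOpen U) (hp : p ∈ U) (X : TangentSpace 𝓘(ℝ, E2) p) :
    R.c p * differential 𝓘(ℝ, E2) R.c p X + R.s p * differential 𝓘(ℝ, E2) R.s p X = 0 := by
  have hc := R.mdifferentiableAt_c hU hp
  have hs := R.mdifferentiableAt_s hU hp
  have h : differential 𝓘(ℝ, E2) (fun y ↦ R.c y * R.c y + R.s y * R.s y) p = 0 := by
    rw [← differential_const (I := 𝓘(ℝ, E2)) 1 p]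
    exact differential_congr (Filter.mem_of_superset (hU.mem_nhds hp) R.sq_add_sq)
  rw [differential_add (mdifferentiableAt_mul hc hc) (mdifferentiableAt_mul hs hs),
    differential_mul hc hc, differential_mul hs hs] at h
  have h1 : (R.c p * differential 𝓘(ℝ, E2) R.c p X + R.c p * differential 𝓘(ℝ, E2) R.c p X) +
    (R.s p * differential 𝓘(ℝ, E2) R.s p X + R.s p * differential 𝓘(ℝ, E2) R.s p X) = 0 :=
    DFunLike.congr_fun h X
  linear_combination h1 / 2

/-- The differentials of the cosine and the sine are proportional. -/
theorem wedge_differential (hU : IsOpen U) (hp : p ∈ U) (X Y : TangentSpace 𝓘(ℝ, E2) p) :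
    differential 𝓘(ℝ, E2) R.c p X * differential 𝓘(ℝ, E2) R.s p Y -
      differential 𝓘(ℝ, E2) R.c p Y * differential 𝓘(ℝ, E2) R.s p X = 0 := by
  have hX := R.differential_sq hU hp X
  have hY := R.differential_sq hU hp Y
  have h := R.sq_add_sq p hp
  generalize differential 𝓘(ℝ, E2) R.c p X = cX at *
  generalize differential 𝓘(ℝ, E2) R.s p X = sX at *
  generalize differential 𝓘(ℝ, E2) R.c p Y = cY at *
  generalize differential 𝓘(ℝ, E2) R.s p Y = sY at *
  linear_combination (-(cX * sY - cY * sX)) * h + (R.c p * sY - R.s p * cY) * hX +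
    (R.s p * cX - R.c p * sX) * hY

/-- The connection form changes by the differential `s dc - c ds` of the angle and by the sign `d`. -/
theorem etaConn_eq (hU : IsOpen U) (hp : p ∈ U) (X : TangentSpace 𝓘(ℝ, E2) p) :
    v.etaConn p X = R.d p * (w.etaConn p X + R.s p * differential 𝓘(ℝ, E2) R.c p X -
      R.c p * differential 𝓘(ℝ, E2) R.s p X) := by
  obtain ⟨s0, s1, -⟩ := w.structure_equations hp
  have hη (i : Fin 2) := (w.smooth_eta i).differentiableFormAt hU hp
  have hc := R.mdifferentiableAt_c hU hp
  have hs := R.mdifferentiableAt_s hU hp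
  have hd := R.mdifferentiableAt_d hU hp
  have h0 : extD (v.eta 0) p = _ := (extD_congr (β := fun y ↦ ∑ i, ![R.c, R.s] i y • w.eta i y) (by
    filter_upwards [hU.mem_nhds hp] with y hy
    ext X
    rw [R.eta_zero y hy, Fin.sum_univ_two]
    rfl)).trans (extD_sum_smul (by rw [Fin.forall_fin_two]; exact ⟨hc, hs⟩) hη)
  have h1 : extD (v.eta 1) p = _ := (extD_congr (β := fun y ↦ ∑ i,
    ![fun y ↦ R.d y * (-1 * R.s y), fun y ↦ R.d y * R.c y] i y • w.eta i y) (by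
    filter_upwards [hU.mem_nhds hp] with y hy
    ext X
    rw [R.eta_one y hy, Fin.sum_univ_two]
    change _ = R.d y * (-1 * R.s y) * w.eta 0 y X + R.d y * R.c y * w.eta 1 y X
    ring)).trans (extD_sum_smul (by
      rw [Fin.forall_fin_two]
      exact ⟨mdifferentiableAt_mul hd (mdifferentiableAt_mul mdifferentiableAt_const hs),
        mdifferentiableAt_mul hd hc⟩) hη)
  have d1 (A) : differential 𝓘(ℝ, E2) (fun y ↦ R.d y * (-1 * R.s y)) p A =
      -R.d p * differential 𝓘(ℝ, E2) R.s p A := by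
    rw [differential_mul hd (mdifferentiableAt_mul mdifferentiableAt_const hs),
      differential_mul mdifferentiableAt_const hs, differential_const]
    change R.d p * (-1 * differential 𝓘(ℝ, E2) R.s p A + R.s p * 0) +
      -1 * R.s p * differential 𝓘(ℝ, E2) R.d p A = _
    rw [R.differential_d hU hp]
    ring
  have d2 (A) : differential 𝓘(ℝ, E2) (fun y ↦ R.d y * R.c y) p A =
      R.d p * differential 𝓘(ℝ, E2) R.c p A := by
    rw [differential_mul hd hc]
    change R.d p * differential 𝓘(ℝ, E2) R.c p A + R.c p * differential 𝓘(ℝ, E2) R.d p A = _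
    rw [R.differential_d hU hp]
    ring
  have hcs := R.sq_add_sq p hp
  have hdd := R.d_mul_d p hp
  refine (etaConn_eq_of hp (α := R.d p • (w.etaConn p + R.s p • differential 𝓘(ℝ, E2) R.c p -
      R.c p • differential 𝓘(ℝ, E2) R.s p)) (fun A B ↦ ?_) (fun A B ↦ ?_) X).trans rfl
  · rw [h0, Fin.sum_univ_two]
    simp only [Matrix.cons_val, s0, s1, LinearMap.add_apply, LinearMap.smul_apply,
      LinearMap.neg_apply, wedge_apply, smul_eq_mul, R.eta_one p hp]
    have e (A) : (R.d p • (w.etaConn p + R.s p • differential 𝓘(ℝ, E2) R.c p -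
      R.c p • differential 𝓘(ℝ, E2) R.s p)) A = R.d p * (w.etaConn p A +
        R.s p * differential 𝓘(ℝ, E2) R.c p A - R.c p * differential 𝓘(ℝ, E2) R.s p A) := rfl
    rw [e, e]
    have hA := R.differential_sq hU hp A
    have hB := R.differential_sq hU hp B
    generalize differential 𝓘(ℝ, E2) R.c p A = cA at *
    generalize differential 𝓘(ℝ, E2) R.s p A = sA at *
    generalize differential 𝓘(ℝ, E2) R.c p B = cB at *
    generalize differential 𝓘(ℝ, E2) R.s p B = sB at *
    linear_combination (R.c p * w.eta 0 p B + R.s p * w.eta 1 p B) * hA -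
      (R.c p * w.eta 0 p A + R.s p * w.eta 1 p A) * hB -
      (cA * w.eta 0 p B + sA * w.eta 1 p B - cB * w.eta 0 p A - sB * w.eta 1 p A) * hcs -
      ((w.etaConn p A + R.s p * cA - R.c p * sA) * (R.s p * w.eta 0 p B - R.c p * w.eta 1 p B) -
      (w.etaConn p B + R.s p * cB - R.c p * sB) *
        (R.s p * w.eta 0 p A - R.c p * w.eta 1 p A)) * hdd
  · rw [h1, Fin.sum_univ_two]
    simp only [Matrix.cons_val, s0, s1, LinearMap.add_apply, LinearMap.smul_apply,
      LinearMap.neg_apply, wedge_apply, smul_eq_mul, R.eta_zero p hp, d1, d2]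
    have e (A) : (R.d p • (w.etaConn p + R.s p • differential 𝓘(ℝ, E2) R.c p -
      R.c p • differential 𝓘(ℝ, E2) R.s p)) A = R.d p * (w.etaConn p A +
        R.s p * differential 𝓘(ℝ, E2) R.c p A - R.c p * differential 𝓘(ℝ, E2) R.s p A) := rfl
    rw [e, e]
    have hA := R.differential_sq hU hp A
    have hB := R.differential_sq hU hp B
    generalize differential 𝓘(ℝ, E2) R.c p A = cA at *
    generalize differential 𝓘(ℝ, E2) R.s p A = sA at *
    generalize differential 𝓘(ℝ, E2) R.c p B = cB at *
    generalize differential 𝓘(ℝ, E2) R.s p B = sB at *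
    linear_combination R.d p * (-R.s p * w.eta 0 p B + R.c p * w.eta 1 p B) * hA -
      R.d p * (-R.s p * w.eta 0 p A + R.c p * w.eta 1 p A) * hB +
      R.d p * (sA * w.eta 0 p B - cA * w.eta 1 p B - sB * w.eta 0 p A + cB * w.eta 1 p A) * hcs

/-- The Gauss curvature does not depend on the frame. -/
theorem gaussCurvature_eq (R : Rotation v w) (hU : IsOpen U) (hp : p ∈ U) :
    v.gaussCurvature p = w.gaussCurvature p := by
  have hc := R.mdifferentiableAt_c hU hp
  have hs := R.mdifferentiableAt_s hU hp
  have hd := R.mdifferentiableAt_d hU hp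
  have h : extD v.etaConn p = _ := (extD_congr (β := fun y ↦ ∑ i,
    ![R.d, fun y ↦ R.d y * R.s y, fun y ↦ R.d y * (-1 * R.c y)] i y •
      ![w.etaConn, differential 𝓘(ℝ, E2) R.c, differential 𝓘(ℝ, E2) R.s] i y) (by
    filter_upwards [hU.mem_nhds hp] with y hy
    ext X
    rw [R.etaConn_eq hU hy, Fin.sum_univ_three]
    change _ = R.d y * w.etaConn y X + R.d y * R.s y * differential 𝓘(ℝ, E2) R.c y X +
      R.d y * (-1 * R.c y) * differential 𝓘(ℝ, E2) R.s y X
    ring)).trans (extD_sum_smul (by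
      intro i
      fin_cases i
      · exact hd
      · exact mdifferentiableAt_mul hd hs
      · exact mdifferentiableAt_mul hd (mdifferentiableAt_mul mdifferentiableAt_const hc)) (by
      intro i
      fin_cases i
      · exact (w.smooth_etaConn hU).differentiableFormAt hU hp
      · exact differentiableFormAt_differential hU R.smooth_c hp
      · exact differentiableFormAt_differential hU R.smooth_s hp))
  have d1 (A) : differential 𝓘(ℝ, E2) (fun y ↦ R.d y * (-1 * R.c y)) p A =
      -R.d p * differential 𝓘(ℝ, E2) R.c p A := by
    rw [differential_mul hd (mdifferentiableAt_mul mdifferentiableAt_const hc),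
      differential_mul mdifferentiableAt_const hc, differential_const]
    change R.d p * (-1 * differential 𝓘(ℝ, E2) R.c p A + R.c p * 0) +
      -1 * R.c p * differential 𝓘(ℝ, E2) R.d p A = _
    rw [R.differential_d hU hp]
    ring
  have d2 (A) : differential 𝓘(ℝ, E2) (fun y ↦ R.d y * R.s y) p A =
      R.d p * differential 𝓘(ℝ, E2) R.s p A := by
    rw [differential_mul hd hs]
    change R.d p * differential 𝓘(ℝ, E2) R.s p A + R.s p * differential 𝓘(ℝ, E2) R.d p A = _
    rw [R.differential_d hU hp]
    ring
  obtain ⟨-, -, s2⟩ := w.structure_equations hp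
  have hw := R.wedge_differential hU hp (v.vec 0 p) (v.vec 1 p)
  have hcs := R.sq_add_sq p hp
  have hdd := R.d_mul_d p hp
  have e (i j) := eta_vec (v := v) hp i j
  have e00 := e 0 0; have e01 := e 0 1; have e10 := e 1 0; have e11 := e 1 1
  rw [R.eta_zero p hp] at e00 e01
  rw [R.eta_one p hp] at e10 e11
  -- The two area forms differ by the factor `d`.
  have harea : w.eta 0 p (v.vec 0 p) * w.eta 1 p (v.vec 1 p) -
      w.eta 0 p (v.vec 1 p) * w.eta 1 p (v.vec 0 p) = R.d p := by
    simp only [reduceIte, zero_ne_one, one_ne_zero] at e00 e01 e10 e11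
    generalize w.eta 0 p (v.vec 0 p) = a at *
    generalize w.eta 0 p (v.vec 1 p) = b at *
    generalize w.eta 1 p (v.vec 0 p) = a' at *
    generalize w.eta 1 p (v.vec 1 p) = b' at *
    linear_combination (-(a * b' - b * a')) * hdd + R.d p * ((-R.d p * (a * b' - b * a')) * hcs +
      R.d p * (-R.s p * b + R.c p * b') * e00 + e11 - R.d p * (-R.s p * a + R.c p * a') * e01)
  rw [gaussCurvature, h, Fin.sum_univ_three]
  simp only [Matrix.cons_val, s2, LinearMap.add_apply, LinearMap.smul_apply,
    wedge_apply, smul_eq_mul, d1, d2, extD_differential hU R.smooth_c hp,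
    extD_differential hU R.smooth_s hp, R.differential_d hU hp, LinearMap.zero_apply]
  linear_combination (-2 * R.d p) * hw + R.d p * w.gaussCurvature p * harea +
    w.gaussCurvature p * hdd

theorem q_eq (R : Rotation v w) (hU : IsOpen U) (hp : p ∈ U) : v.q p = w.q p := by
  rw [q, q, R.gaussCurvature_eq hU hp]

theorem differential_q_eq (R : Rotation v w) (hU : IsOpen U) (hp : p ∈ U) :
    differential 𝓘(ℝ, E2) v.q p = differential 𝓘(ℝ, E2) w.q p :=
  differential_congr (Filter.mem_of_superset (hU.mem_nhds hp) fun _ hy ↦ R.q_eq hU hy)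

theorem covDeriv_q_zero (R : Rotation v w) (hU : IsOpen U) (hp : p ∈ U) :
    v.covDeriv v.q 0 p = R.c p * w.covDeriv w.q 0 p + R.s p * w.covDeriv w.q 1 p := by
  have h1 : v.covDeriv v.q 0 p = differential 𝓘(ℝ, E2) w.q p (v.vec 0 p) :=
    DFunLike.congr_fun (R.differential_q_eq hU hp) _
  have h2 (k) : w.eta k p (v.vec 0 p) = v.eta 0 p (w.vec k p) := g.symm _ _ _
  rw [h1, differential_apply (v := w) hp, h2, h2, R.eta_zero p hp, R.eta_zero p hp]
  simp [eta_vec hp]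
  ring

theorem covDeriv_q_one (R : Rotation v w) (hU : IsOpen U) (hp : p ∈ U) :
    v.covDeriv v.q 1 p =
      R.d p * (-1 * R.s p * w.covDeriv w.q 0 p + R.c p * w.covDeriv w.q 1 p) := by
  have h1 : v.covDeriv v.q 1 p = differential 𝓘(ℝ, E2) w.q p (v.vec 1 p) :=
    DFunLike.congr_fun (R.differential_q_eq hU hp) _
  have h2 (k) : w.eta k p (v.vec 1 p) = v.eta 1 p (w.vec k p) := g.symm _ _ _
  rw [h1, differential_apply (v := w) hp, h2, h2, R.eta_one p hp, R.eta_one p hp]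
  simp [eta_vec hp]
  ring

/-- The equations say that the Hessian of `q` is `-3 q^{-1/3} g`, which does not depend on the
frame. -/
theorem satisfiesQEquations (R : Rotation v w) (hU : IsOpen U)
    (hK : ∀ p ∈ U, w.gaussCurvature p < 0) (h : w.SatisfiesQEquations) :
    v.SatisfiesQEquations := by
  intro p hp
  obtain ⟨h00, h11, h01, h10⟩ := h p hp
  have hc := R.mdifferentiableAt_c hU hp
  have hs := R.mdifferentiableAt_s hU hp
  have hd := R.mdifferentiableAt_d hU hp
  have hq (i) := mdifferentiableAt_of_contMDiffOn hU
    (w.contMDiffOn_covDeriv hU (w.contMDiffOn_q hU hK) i) hp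
  have hcs := R.sq_add_sq p hp
  have hdd := R.d_mul_d p hp
  have hs' := mdifferentiableAt_mul (mdifferentiableAt_const (c := (-1 : ℝ))) hs
  have d0 : differential 𝓘(ℝ, E2) (v.covDeriv v.q 0) p = _ :=
    (differential_congr (Filter.mem_of_superset (hU.mem_nhds hp)
      fun _ hy ↦ R.covDeriv_q_zero hU hy)).trans <|
    (differential_add (mdifferentiableAt_mul hc (hq 0)) (mdifferentiableAt_mul hs (hq 1))).trans <|
    congrArg₂ (· + ·) (differential_mul hc (hq 0)) (differential_mul hs (hq 1))
  have d1 : differential 𝓘(ℝ, E2) (v.covDeriv v.q 1) p = _ :=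
    (differential_congr (Filter.mem_of_superset (hU.mem_nhds hp)
      fun _ hy ↦ R.covDeriv_q_one hU hy)).trans <|
    (differential_mul hd (mdifferentiableAt_add (mdifferentiableAt_mul hs' (hq 0))
      (mdifferentiableAt_mul hc (hq 1)))).trans <|
    congrArg₂ (fun a b ↦ R.d p • a + b)
      ((differential_add (mdifferentiableAt_mul hs' (hq 0)) (mdifferentiableAt_mul hc (hq 1))).trans
      (congrArg₂ (· + ·) ((differential_mul hs' (hq 0)).trans
        (congrArg₂ (fun a b ↦ a + w.covDeriv w.q 0 p • b) rfl
          (differential_mul mdifferentiableAt_const hs))) (differential_mul hc (hq 1)))) rfl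
  -- The defining equations of the second derivatives, with the asserted values of these.
  have e0 (X : TangentSpace 𝓘(ℝ, E2) p) : differential 𝓘(ℝ, E2) (v.covDeriv v.q 0) p X =
      -v.covDeriv v.q 1 p * v.etaConn p X + -3 * v.q p ^ (-(1 / 3) : ℝ) * v.eta 0 p X := by
    have e : differential 𝓘(ℝ, E2) (v.covDeriv v.q 0) p X =
        (R.c p * differential 𝓘(ℝ, E2) (w.covDeriv w.q 0) p X +
          w.covDeriv w.q 0 p * differential 𝓘(ℝ, E2) R.c p X) +
        (R.s p * differential 𝓘(ℝ, E2) (w.covDeriv w.q 1) p X +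
          w.covDeriv w.q 1 p * differential 𝓘(ℝ, E2) R.s p X) := DFunLike.congr_fun d0 X
    rw [e, differential_covDeriv_zero hp, differential_covDeriv_one hp, h00, h01, h10, h11,
      R.covDeriv_q_one hU hp, R.etaConn_eq hU hp, R.eta_zero p hp, R.q_eq hU hp]
    have hX := R.differential_sq hU hp X
    generalize differential 𝓘(ℝ, E2) R.c p X = cX at *
    generalize differential 𝓘(ℝ, E2) R.s p X = sX at *
    linear_combination (w.covDeriv w.q 0 p * R.c p + w.covDeriv w.q 1 p * R.s p) * hX -
      (w.covDeriv w.q 0 p * cX + w.covDeriv w.q 1 p * sX) * hcs +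
      (R.c p * w.covDeriv w.q 1 p - R.s p * w.covDeriv w.q 0 p) *
        (w.etaConn p X + R.s p * cX - R.c p * sX) * hdd
  have e1 (X : TangentSpace 𝓘(ℝ, E2) p) : differential 𝓘(ℝ, E2) (v.covDeriv v.q 1) p X =
      v.covDeriv v.q 0 p * v.etaConn p X + -3 * v.q p ^ (-(1 / 3) : ℝ) * v.eta 1 p X := by
    have e : differential 𝓘(ℝ, E2) (v.covDeriv v.q 1) p X =
        R.d p * ((-1 * R.s p * differential 𝓘(ℝ, E2) (w.covDeriv w.q 0) p X +
          w.covDeriv w.q 0 p * (-1 * differential 𝓘(ℝ, E2) R.s p X +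
            R.s p * differential 𝓘(ℝ, E2) (fun _ : M ↦ (-1 : ℝ)) p X)) +
        (R.c p * differential 𝓘(ℝ, E2) (w.covDeriv w.q 1) p X +
          w.covDeriv w.q 1 p * differential 𝓘(ℝ, E2) R.c p X)) +
        (-1 * R.s p * w.covDeriv w.q 0 p + R.c p * w.covDeriv w.q 1 p) *
          differential 𝓘(ℝ, E2) R.d p X := DFunLike.congr_fun d1 X
    have e' : differential 𝓘(ℝ, E2) (fun _ : M ↦ (-1 : ℝ)) p X = 0 :=
      DFunLike.congr_fun (differential_const (-1) p) X
    rw [e, e', R.differential_d hU hp, differential_covDeriv_zero hp, differential_covDeriv_one hp,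
      h00, h01, h10, h11, R.covDeriv_q_zero hU hp, R.etaConn_eq hU hp, R.eta_one p hp,
      R.q_eq hU hp]
    have hX := R.differential_sq hU hp X
    generalize differential 𝓘(ℝ, E2) R.c p X = cX at *
    generalize differential 𝓘(ℝ, E2) R.s p X = sX at *
    linear_combination
      R.d p * (R.c p * w.covDeriv w.q 1 p - R.s p * w.covDeriv w.q 0 p) * hX +
      R.d p * (w.covDeriv w.q 0 p * sX - w.covDeriv w.q 1 p * cX) * hcs
  have f00 := e0 (v.vec 0 p); have f01 := e0 (v.vec 1 p)
  have f10 := e1 (v.vec 0 p); have f11 := e1 (v.vec 1 p)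
  rw [differential_covDeriv_zero hp] at f00 f01
  rw [differential_covDeriv_one hp] at f10 f11
  simp [eta_vec hp] at f00 f01 f10 f11
  exact ⟨by linarith, by linarith, by linarith, by linarith⟩

end Rotation

end OrthonormalFrame

end ChangeOfFrame

/-! ### Darboux integrability of the metric -/

section LocalFrames

variable {M : Type*} [TopologicalSpace M] [ChartedSpace E2 M] [IsManifold 𝓘(ℝ, E2) ∞ M]

namespace OrthonormalFrame

variable {g : Metric M} {U : Set M}

/-- The restriction of a frame field to a smaller set. -/
def restrict (v : OrthonormalFrame g U) {U' : Set M} (h : U' ⊆ U) : OrthonormalFrame g U' where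
  vec := v.vec
  smooth i := (v.smooth i).mono h
  orthonormal p hp := v.orthonormal p (h hp)

theorem SatisfiesQEquations.restrict {v : OrthonormalFrame g U} (hv : v.SatisfiesQEquations)
    {U' : Set M} (h : U' ⊆ U) : (v.restrict h).SatisfiesQEquations :=
  fun p hp ↦ hv p (h hp)

/-- Gram–Schmidt orthonormalization of a local frame of the tangent bundle. -/
theorem exists_of_linearIndependent (X : Fin 2 → ∀ p : M, TangentSpace 𝓘(ℝ, E2) p)
    (hX : ∀ i, ContMDiffOn 𝓘(ℝ, E2) 𝓘(ℝ, E2).tangent ∞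
      (fun p ↦ (⟨p, X i p⟩ : TangentBundle 𝓘(ℝ, E2) M)) U)
    (hli : ∀ p ∈ U, LinearIndependent ℝ fun i ↦ X i p) : Nonempty (OrthonormalFrame g U) := by
  have hsm (i j) := contMDiffOn_metric g (hX i) (hX j)
  have h0 : ∀ p ∈ U, 0 < g.inner p (X 0 p) (X 0 p) := fun p hp ↦ g.pos p _ ((hli p hp).ne_zero 0)
  -- The component of the second field orthogonal to the first one.
  let f : M → ℝ := fun p ↦ g.inner p (X 0 p) (X 1 p) / g.inner p (X 0 p) (X 0 p)
  let Y : ∀ p : M, TangentSpace 𝓘(ℝ, E2) p := fun p ↦ X 1 p - f p • X 0 p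
  have hf : ContMDiffOn 𝓘(ℝ, E2) 𝓘(ℝ, ℝ) ∞ f U :=
    (hsm 0 1).div₀ (hsm 0 0) fun p hp ↦ (h0 p hp).ne'
  have hY : ContMDiffOn 𝓘(ℝ, E2) 𝓘(ℝ, E2).tangent ∞
      (fun p ↦ (⟨p, Y p⟩ : TangentBundle 𝓘(ℝ, E2) M)) U :=
    (hX 1).sub_section (hf.smul_section (hX 0))
  have h1 : ∀ p ∈ U, 0 < g.inner p (Y p) (Y p) := fun p hp ↦ g.pos p _ fun h ↦ by
    have := Fintype.linearIndependent_iff.1 (hli p hp) ![-f p, 1] (by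
      rw [Fin.sum_univ_two, ← h]
      simp [Y]
      module) 1
    simp at this
  have hXY : ∀ p ∈ U, g.inner p (X 0 p) (Y p) = 0 := fun p hp ↦ by
    have e : g.inner p (X 0 p) (Y p) =
        g.inner p (X 0 p) (X 1 p) - f p * g.inner p (X 0 p) (X 0 p) := by
      rw [map_sub, map_smul, smul_eq_mul]
    rw [e, div_mul_cancel₀ _ (h0 p hp).ne', sub_self]
  have hsqrt {u : M → ℝ} (hu : ContMDiffOn 𝓘(ℝ, E2) 𝓘(ℝ, ℝ) ∞ u U) (hpos : ∀ p ∈ U, 0 < u p) :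
      ContMDiffOn 𝓘(ℝ, E2) 𝓘(ℝ, ℝ) ∞ (fun p ↦ (√(u p))⁻¹) U :=
    ContMDiffOn.inv₀ (fun p hp ↦
      (Real.contDiffAt_sqrt (hpos p hp).ne').contMDiffAt.comp_contMDiffWithinAt p (hu p hp))
      fun p hp ↦ (Real.sqrt_pos.2 (hpos p hp)).ne'
  have hnorm {a : ℝ} (ha : 0 < a) : (√a)⁻¹ * ((√a)⁻¹ * a) = 1 := by
    have := (Real.sqrt_pos.2 ha).ne'
    field_simp
    exact (Real.sq_sqrt ha.le).symm
  refine ⟨⟨![fun p ↦ (√(g.inner p (X 0 p) (X 0 p)))⁻¹ • X 0 p,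
    fun p ↦ (√(g.inner p (Y p) (Y p)))⁻¹ • Y p], ?_, fun p hp ↦ ?_⟩⟩
  · rw [Fin.forall_fin_two]
    exact ⟨(hsqrt (hsm 0 0) h0).smul_section (hX 0),
      (hsqrt (contMDiffOn_metric g hY hY) h1).smul_section hY⟩
  · have e (a b : ℝ) (A B : TangentSpace 𝓘(ℝ, E2) p) :
        g.inner p (a • A) (b • B) = a * (b * g.inner p A B) := by
      rw [map_smul, map_smul]
      exact mul_left_comm b a _
    have hYX : g.inner p (Y p) (X 0 p) = 0 := (g.symm p _ _).trans (hXY p hp)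
    simp only [Fin.forall_fin_two, Matrix.cons_val, e, hXY p hp, hYX, hnorm (h0 p hp),
      hnorm (h1 p hp)]
    simp

variable (g) in
/-- Every point has a neighbourhood with an orthonormal frame field. -/
theorem exists_local (p : M) :
    ∃ U : Set M, IsOpen U ∧ p ∈ U ∧ Nonempty (OrthonormalFrame g U) := by
  let e := trivializationAt E2 (TangentSpace 𝓘(ℝ, E2)) p
  have h := e.isLocalFrameOn_localFrame_baseSet 𝓘(ℝ, E2) ∞ (EuclideanSpace.basisFun (Fin 2) ℝ).toBasis
  exact ⟨e.baseSet, e.open_baseSet, FiberBundle.mem_baseSet_trivializationAt' p,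
    exists_of_linearIndependent _ h.contMDiffOn fun p hp ↦ h.linearIndependent hp⟩

end OrthonormalFrame

theorem isDarbouxIntegrableMetric_iff {g : Metric M} (hK : IsNegativelyCurved g) :
    IsDarbouxIntegrableMetric g ↔
      ∀ U : Set M, IsOpen U → ∀ v : OrthonormalFrame g U, v.SatisfiesQEquations := by
  constructor
  · intro h U hU v p hp
    obtain ⟨U', hU', hp', w, hw⟩ := h p
    have hq := (w.isDarbouxIntegrable_iff hU' (hK U' hU' w)).1 hw
    obtain ⟨R⟩ := OrthonormalFrame.nonempty_rotation (v.restrict (inter_subset_left (t := U')))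
      (w.restrict (inter_subset_right (s := U)))
    exact R.satisfiesQEquations (hU.inter hU') (hK _ (hU.inter hU') _) (hq.restrict _) p ⟨hp, hp'⟩
  · intro h p
    obtain ⟨U, hU, hp, ⟨v⟩⟩ := OrthonormalFrame.exists_local g p
    exact ⟨U, hU, hp, v, (v.isDarbouxIntegrable_iff hU (hK U hU v)).2 (h U hU v)⟩

end LocalFrames

end IsoEmbedding

end

theorem mainTheorem1 {M : Type*} [TopologicalSpace M]
    [ChartedSpace (EuclideanSpace ℝ (Fin 2)) M]
    [IsManifold 𝓘(ℝ, EuclideanSpace ℝ (Fin 2)) ∞ M]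
    (g : IsoEmbedding.Metric M) (hK : IsoEmbedding.IsNegativelyCurved g) :
    (∀ U : Set M, IsOpen U → ∀ v : IsoEmbedding.OrthonormalFrame g U,
      (v.IsDarbouxIntegrable ↔ v.SatisfiesQEquations)) ∧
    (IsoEmbedding.IsDarbouxIntegrableMetric g ↔
      ∀ U : Set M, IsOpen U → ∀ v : IsoEmbedding.OrthonormalFrame g U, v.SatisfiesQEquations) :=
  ⟨fun U hU v ↦ v.isDarbouxIntegrable_iff hU (hK U hU v),
    IsoEmbedding.isDarbouxIntegrableMetric_iff hK⟩
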